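/- Let $U\subseteq\mathbb C^2$ be an open set containing $0=(0,0)$, and let $\omega=A\,dx+B\,dy$ be a holomorphic $1$-form on $U$ ($A,B$ holomorphic) whose only zero in $U$ is the origin. For a composition $\pi:V\to U$ of finitely many point blow-ups of complex surfaces, all of them centered at points lying over $0$, and for $p\in V$, let $\widetilde\omega$ denote, in a coordinate chart of $V$ centered on $p$, a local generator at $p$ of the transformed foliation: a holomorphic $1$-form near $p$ with no zero other than possibly $p$ itself, such that $\pi^*\omega=h\,\widetilde\omega$ near $p$ with $h$ holomorphic. It is unique up to multiplication by a nowhere vanishing holomorphic function (and is what is meant by "$\pi^*\omega$" as the transform of $\omega$). The order $\nu_p$ is the degree of the first nonzero homogeneous component of the Taylor series of $\widetilde\omega$ at $p$. Call $\pi$ a Seidenberg reduction of $\omega$ if $\nu_p\le 1$ for every $p\in V$. Theorem. A Seidenberg reduction of $\omega$ exists. Moreover, for every Seidenberg reduction $\pi:V\to U$ there is a further composition $\sigma:V'\to V$ of finitely many point blow-ups, centered at points lying over $\pi^{-1}(0)$, such that $\pi'=\pi\circ\sigma:V'\to U$ is again a Seidenberg reduction of $\omega$, and for every $p\in V'$ with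 $\nu_p=1$ there are a coordinate chart $(u,v)$ of $V'$ centered on $p$ and a local generator $\widetilde\omega$ of the transformed foliation at $p$ such that, near $p$, either $$\widetilde\omega=(\lambda_1+f)\,v\,du-(\lambda_2+g)\,u\,dv$$ with $\lambda_1,\lambda_2\in\mathbb C$, $\lambda_1\lambda_2\neq0$, $\lambda_1/\lambda_2\notin\mathbb N$, $\lambda_2/\lambda_1\notin\mathbb N$, and $f,g$ holomorphic functions vanishing at $p$, or $$\widetilde\omega=(v+f)\,du+g\,u\,dv$$ (saddle-node) with $f,g$ holomorphic, $f$ of order at least $2$ at $p$ and $g$ vanishing at $p$. -/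

import Mathlib

open Set Filter Topology
open scoped Manifold ContDiff

/-- A complex surface: a Hausdorff complex manifold of dimension two. -/
structure ComplexSurface : Type 1 where
  carrier : Type
  [topology : TopologicalSpace carrier]
  [charted : ChartedSpace (ℂ × ℂ) carrier]
  [manifold : IsManifold 𝓘(ℂ, ℂ × ℂ) ω carrier]
  [hausdorff : T2Space carrier]

namespace ComplexSurface

instance : CoeSort ComplexSurface Type := ⟨ComplexSurface.carrier⟩

attribute [instance] topology charted manifold hausdorff

/-- An open subset of `ℂ²`, as a complex surface. -/
noncomputable abbrev ofOpens (U : TopologicalSpace.Opens (ℂ × ℂ)) : ComplexSurface where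
  carrier := U

/-- `φ` is a holomorphic coordinate chart `(u, v)` of `S`, defined near `p` and centered on `p`. -/
def IsChartCenteredAt {S : ComplexSurface} (φ : OpenPartialHomeomorph S (ℂ × ℂ)) (p : S) : Prop :=
  φ ∈ IsManifold.maximalAtlas 𝓘(ℂ, ℂ × ℂ) ω S ∧ p ∈ φ.source ∧ φ p = 0

/-- `σ : S' → S` is the blow-up of the surface `S` at the point `p`: it is biholomorphic over
`S \ {p}`, and over the domain of some chart `φ` centered on `p` it is the standard blow-up of the
origin of `ℂ²`, that is, `σ ⁻¹ (dom φ)` is covered by two coordinate systems `(x, t)` and `(s, y)`,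
glued by `s = 1 / t`, `y = t x`, in which `σ` is `(x, t) ↦ (x, t x)` and `(s, y) ↦ (s y, y)`. -/
def IsBlowUpAt {S' S : ComplexSurface} (p : S) (σ : S' → S) : Prop :=
  ContMDiff 𝓘(ℂ, ℂ × ℂ) 𝓘(ℂ, ℂ × ℂ) ω σ ∧
  BijOn σ (σ ⁻¹' {p}ᶜ) {p}ᶜ ∧
  IsLocalDiffeomorphOn 𝓘(ℂ, ℂ × ℂ) 𝓘(ℂ, ℂ × ℂ) ω σ (σ ⁻¹' {p}ᶜ) ∧
  ∃ φ : OpenPartialHomeomorph S (ℂ × ℂ), IsChartCenteredAt φ p ∧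
  ∃ ψ₀ ∈ IsManifold.maximalAtlas 𝓘(ℂ, ℂ × ℂ) ω S',
  ∃ ψ₁ ∈ IsManifold.maximalAtlas 𝓘(ℂ, ℂ × ℂ) ω S',
    ψ₀.source ∪ ψ₁.source = σ ⁻¹' φ.source ∧
    ψ₀.target = {z | (z.1, z.2 * z.1) ∈ φ.target} ∧
    ψ₁.target = {z | (z.1 * z.2, z.2) ∈ φ.target} ∧
    (∀ a ∈ ψ₀.source, φ (σ a) = ((ψ₀ a).1, (ψ₀ a).2 * (ψ₀ a).1)) ∧
    (∀ a ∈ ψ₁.source, φ (σ a) = ((ψ₁ a).1 * (ψ₁ a).2, (ψ₁ a).2)) ∧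
    (∀ a ∈ ψ₀.source, a ∈ ψ₁.source ↔ (ψ₀ a).2 ≠ 0) ∧
    (∀ a ∈ ψ₁.source, a ∈ ψ₀.source ↔ (ψ₁ a).1 ≠ 0) ∧
    (∀ a ∈ ψ₀.source ∩ ψ₁.source, ψ₁ a = ((ψ₀ a).2⁻¹, (ψ₀ a).2 * (ψ₀ a).1))

/-- `π : S' → S` is a composition of finitely many point blow-ups, each of them centered at a point
that lies over the subset `Z` of `S`. -/
inductive IsIteratedBlowUp (S : ComplexSurface) (Z : Set S) :
    ∀ S' : ComplexSurface, (S' → S) → Prop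
  | refl : IsIteratedBlowUp S Z S id
  | step {S₁ S₂ : ComplexSurface} {π : S₁ → S} {σ : S₂ → S₁} (p : S₁)
      (h : IsIteratedBlowUp S Z S₁ π) (hp : π p ∈ Z) (hσ : IsBlowUpAt p σ) :
      IsIteratedBlowUp S Z S₂ (π ∘ σ)

end ComplexSurface

namespace PlaneFoliation

open ComplexSurface

/-- The `1`-form `A dx + B dy` on `ℂ²`. -/
noncomputable def oneForm (A B : ℂ × ℂ → ℂ) : ℂ × ℂ → (ℂ × ℂ →L[ℂ] ℂ) := fun z =>
  A z • ContinuousLinearMap.fst ℂ ℂ ℂ + B z • ContinuousLinearMap.snd ℂ ℂ ℂ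

/-- The pull-back of a `1`-form by a map. -/
noncomputable def pullback (θ : ℂ × ℂ → (ℂ × ℂ →L[ℂ] ℂ)) (F : ℂ × ℂ → ℂ × ℂ) :
    ℂ × ℂ → (ℂ × ℂ →L[ℂ] ℂ) := fun z =>
  (θ (F z)).comp (fderiv ℂ F z)

/-- The order at the origin of `ℂ²` of an analytic function or `1`-form: the degree of the first
nonzero homogeneous component of its Taylor series (`⊤` if there is none). -/
noncomputable def order {E : Type*} [NormedAddCommGroup E] [NormedSpace ℂ E]
    (f : ℂ × ℂ → E) : ℕ∞ :=
  ⨅ (n : ℕ) (_ : iteratedFDeriv ℂ n f 0 ≠ 0), (n : ℕ∞)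

/-- The germ at the origin of the `1`-form `η` defines, in the chart `φ` of the surface `S`, the
transform by `f : S → ℂ²` of the foliation defined by the `1`-form `θ`: the pull-back of `θ` is
`h • η` with `h` a holomorphic function, and `η` is holomorphic and has at most an isolated zero
at the origin. Such an `η` is unique up to multiplication by a nonvanishing function. -/
def IsTransform (θ : ℂ × ℂ → (ℂ × ℂ →L[ℂ] ℂ)) {S : ComplexSurface} (f : S → ℂ × ℂ)
    (φ : OpenPartialHomeomorph S (ℂ × ℂ)) (η : ℂ × ℂ → (ℂ × ℂ →L[ℂ] ℂ)) : Prop :=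
  AnalyticAt ℂ η 0 ∧ (∀ᶠ z in 𝓝[≠] 0, η z ≠ 0) ∧
  ∃ h : ℂ × ℂ → ℂ, AnalyticAt ℂ h 0 ∧
    ∀ᶠ z in 𝓝 0, pullback θ (fun w => f (φ.symm w)) z = h z • η z

/-- The transformed foliation has order `k` at `p`. -/
def HasOrderAt (θ : ℂ × ℂ → (ℂ × ℂ →L[ℂ] ℂ)) {S : ComplexSurface} (f : S → ℂ × ℂ)
    (p : S) (k : ℕ∞) : Prop :=
  ∃ φ : OpenPartialHomeomorph S (ℂ × ℂ), IsChartCenteredAt φ p ∧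
    ∃ η, IsTransform θ f φ η ∧ order η = k

/-- `η = (λ₁ + h.o.t.) v du - (λ₂ + h.o.t.) u dv` near the origin, with `λ₁ λ₂ ≠ 0` and neither
`λ₁ / λ₂` nor `λ₂ / λ₁` in `ℕ`. -/
def IsNonresonantForm (η : ℂ × ℂ → (ℂ × ℂ →L[ℂ] ℂ)) : Prop :=
  ∃ l₁ l₂ : ℂ, l₁ * l₂ ≠ 0 ∧ (∀ n : ℕ, l₁ / l₂ ≠ n) ∧ (∀ n : ℕ, l₂ / l₁ ≠ n) ∧
  ∃ f g : ℂ × ℂ → ℂ, AnalyticAt ℂ f 0 ∧ AnalyticAt ℂ g 0 ∧ 1 ≤ order f ∧ 1 ≤ order g ∧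
    ∀ᶠ z in 𝓝 0, η z = oneForm (fun w => (l₁ + f w) * w.2) (fun w => -((l₂ + g w) * w.1)) z

/-- `η = (v + h.o.t.) du + (h.o.t.) u dv` near the origin, a saddle-node. -/
def IsSaddleNodeForm (η : ℂ × ℂ → (ℂ × ℂ →L[ℂ] ℂ)) : Prop :=
  ∃ f g : ℂ × ℂ → ℂ, AnalyticAt ℂ f 0 ∧ AnalyticAt ℂ g 0 ∧ 2 ≤ order f ∧ 1 ≤ order g ∧
    ∀ᶠ z in 𝓝 0, η z = oneForm (fun w => w.2 + f w) (fun w => g w * w.1) z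

/-- In some coordinate chart centered on `p`, the transformed foliation is defined by a `1`-form in
one of the two final forms. -/
def HasFinalForm (θ : ℂ × ℂ → (ℂ × ℂ →L[ℂ] ℂ)) {S : ComplexSurface} (f : S → ℂ × ℂ)
    (p : S) : Prop :=
  ∃ φ : OpenPartialHomeomorph S (ℂ × ℂ), IsChartCenteredAt φ p ∧
    ∃ η, IsTransform θ f φ η ∧ (IsNonresonantForm η ∨ IsSaddleNodeForm η)

/-- The map `π : V → U`, seen as a map to `ℂ²`. -/
def toPlane {U : TopologicalSpace.Opens (ℂ × ℂ)} {V : ComplexSurface}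
    (π : V → ofOpens U) : V → ℂ × ℂ := fun p => (show U from π p).1

/-- `π : V → U` is a Seidenberg reduction of the `1`-form `θ` at the origin: a finite composition
of blow-ups at points over the origin such that the transformed foliation has order at most one at
all points of `V`. -/
def IsSeidenbergReduction (θ : ℂ × ℂ → (ℂ × ℂ →L[ℂ] ℂ)) (U : TopologicalSpace.Opens (ℂ × ℂ))
    (V : ComplexSurface) (π : V → ofOpens U) : Prop :=
  IsIteratedBlowUp (ofOpens U) {q | (show U from q).1 = 0} V π ∧
  ∀ p : V, ∃ k ≤ 1, HasOrderAt θ (toPlane π) p k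

end PlaneFoliation

/-!
The proof has a local and a global part. The local part is `IsolatedForm.resolvable`: the germ of a
`1`-form `A dx + B dy` with an isolated zero is resolved by finitely many blow-ups. Here
`Resolvable` is an inductive predicate on germs at the origin of `ℂ²`. A germ is resolvable if it is
regular or in final form, if a change of coordinates and the division by a unit make it so, or if
its transforms at all the points of the exceptional divisor are resolvable. An induction that shows
`Resolvable` is a termination proof for the process of blowing up.

*Linear part that is not nilpotent* (`IsolatedForm.resolvable_of_not_nilpotent`). Without resonance
there are invariant curves tangent to the eigendirections with nonzero eigenvalue. They are obtained
from the theorem of Briot and Bouquet (`briotBouquet`), which is proved by Picard iteration; when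
they are straightened to coordinate axes, the form is in final form. A node whose eigenvalues have
an integral ratio is blown up: the ratio decreases by one, down to the ratio one, where the node is
either dicritical, with a regular blow-up, or has a saddle-node as its only singular point after the
blow-up.

*Nilpotent nonzero linear part* (`IsolatedForm.resolvable_of_nilpotent_of_ne`). After one blow-up
the form is `α dx + x y β dy` with `β` a unit, and further blow-ups lower the order of `α` along the
axis `y = 0` (`IsolatedForm.resolvable_of_nilpotent_transform`).

*Order at least two* (`LogPresentation.resolvable`). Along the exceptional divisor the form is
written as `y ^ e a dx + x b dy` with `e ≤ 1`, up to a common factor. The order `r` of the pair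
`(a, b)` does not increase under blow-ups. After one blow-up, the restrictions of `a` and `b` to the
last component of the divisor have order at most `r`; from then on, `r` drops at the point at
infinity of each new divisor. At the other points the contact of smooth arcs transversal to the
divisor with the singular point decreases. This contact is bounded because the zero is isolated
(`IsolatedForm.exists_contactBound`); the bound is found by following a curve of maximal contact.

The global part turns this into a statement on surfaces. The blow-up of a surface at a point exists
(`BlowUpSpace.isBlowUpAt`): it is glued from the charts of the surface and two new ones. The
transformed foliation has a local generator at each point, and on the compact exceptional divisor
only finitely many points are singular (`IsBlowUpCharts.finite_not_isRegularAt`). These points can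
be treated one after the other (`exists_reduction_of_finite`), since a blow-up is biholomorphic off
its center; so resolvability of germs yields iterated blow-ups (`Resolvable.isReducible`). The
argument starts from any iterated blow-up of `U` over the origin, which gives both the existence of
a Seidenberg reduction and the possibility of continuing a given one (`exists_isReducedAt`).

The order at a point is the order of any local generator in any chart. That a regular point does not
have order one comes down to the fact that the zeros of a holomorphic function of two variables are
not isolated (`frequently_eq_zero`, `GermForm.ne_zero_of_regular`): a generator that vanished at a
regular point would be the product of a nonvanishing form and a function with a zero.
-/
namespace PlaneFoliation

attribute [local fun_prop] analyticAt_fst analyticAt_snd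

/-! ### Power series expansions in two variables -/

/-- `f` vanishes at the origin to order at least `k`, as an estimate. -/
def OrdGE (k : ℕ) (f : ℂ × ℂ → ℂ) : Prop := f =O[𝓝 0] fun z => ‖z‖ ^ k

/-- A homogeneous polynomial map of degree `n` on `ℂ²`, in coordinates. -/
theorem exists_coeff_of_continuousMultilinearMap (n : ℕ)
    (p : ContinuousMultilinearMap ℂ (fun _ : Fin n => ℂ × ℂ) ℂ) :
    ∃ c : ℕ → ℂ, (∀ i, ‖c i‖ ≤ 2 ^ n * ‖p‖) ∧
      ∀ z : ℂ × ℂ, p (fun _ => z) = ∑ i ∈ Finset.range (n + 1), c i * z.1 ^ i * z.2 ^ (n - i) := by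
  classical
  refine ⟨fun i => ∑ s ∈ Finset.powersetCard i (Finset.univ : Finset (Fin n)),
    p (s.piecewise (fun _ => ((1 : ℂ), (0 : ℂ))) (fun _ => ((0 : ℂ), (1 : ℂ)))), fun i => ?_,
    fun z => ?_⟩
  · have hb : ∀ s : Finset (Fin n),
        ‖p (s.piecewise (fun _ => ((1 : ℂ), (0 : ℂ))) (fun _ => ((0 : ℂ), (1 : ℂ))))‖ ≤ ‖p‖ := by
      intro s
      refine (p.le_opNorm _).trans (mul_le_of_le_one_right (norm_nonneg _) ?_)
      refine Finset.prod_le_one (fun _ _ => norm_nonneg _) fun i _ => ?_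
      by_cases h : i ∈ s <;> simp [h]
    refine (norm_sum_le _ _).trans ((Finset.sum_le_sum fun s _ => hb s).trans ?_)
    rw [Finset.sum_const, Finset.card_powersetCard, nsmul_eq_mul, Finset.card_univ,
      Fintype.card_fin]
    gcongr
    exact_mod_cast Nat.choose_le_two_pow n i
  · have hz : (fun _ : Fin n => z) = (fun _ => z.1 • ((1 : ℂ), (0 : ℂ))) +
        (fun _ => z.2 • ((0 : ℂ), (1 : ℂ))) := by
      funext i; ext <;> simp
    have hs : ∀ s : Finset (Fin n),
        p (s.piecewise (fun _ => z.1 • ((1 : ℂ), (0 : ℂ))) (fun _ => z.2 • ((0 : ℂ), (1 : ℂ)))) =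
        p (s.piecewise (fun _ => ((1 : ℂ), (0 : ℂ))) (fun _ => ((0 : ℂ), (1 : ℂ)))) *
          z.1 ^ s.card * z.2 ^ (n - s.card) := by
      intro s
      have h1 : s.piecewise (fun _ => z.1 • ((1 : ℂ), (0 : ℂ))) (fun _ => z.2 • ((0 : ℂ), (1 : ℂ)))
          = fun i => (if i ∈ s then z.1 else z.2) •
            (s.piecewise (fun _ => ((1 : ℂ), (0 : ℂ))) (fun _ => ((0 : ℂ), (1 : ℂ))) i) := by
        funext i
        by_cases h : i ∈ s <;> simp [h]
      rw [h1, p.map_smul_univ, Finset.prod_ite, Finset.prod_const, Finset.prod_const]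
      have h2 : (Finset.univ.filter fun i => i ∈ s) = s := by ext; simp
      have h3 : (Finset.univ.filter fun i => i ∉ s).card = n - s.card := by
        rw [← Finset.compl_filter, h2, Finset.card_compl, Fintype.card_fin]
      rw [h2, h3, smul_eq_mul]
      ring
    rw [hz, p.map_add_univ, ← Finset.powerset_univ, Finset.sum_powerset, Finset.card_univ,
      Fintype.card_fin]
    refine Finset.sum_congr rfl fun i _ => ?_
    rw [Finset.sum_mul, Finset.sum_mul]
    refine Finset.sum_congr rfl fun s hs' => ?_
    rw [hs, (Finset.mem_powersetCard.1 hs').2]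

theorem isBigO_norm_pow_of_le {m n : ℕ} (h : m ≤ n) :
    (fun z : ℂ × ℂ => ‖z‖ ^ n) =O[𝓝 0] fun z => ‖z‖ ^ m := by
  refine Asymptotics.IsBigO.of_bound 1 ?_
  filter_upwards [Metric.closedBall_mem_nhds (0 : ℂ × ℂ) one_pos] with z hz
  rw [mem_closedBall_zero_iff] at hz
  simpa using pow_le_pow_of_le_one (norm_nonneg z) hz h

/-- The Taylor expansion of an analytic function of two variables, by homogeneous components. -/
theorem exists_hasSum_of_analyticAt {f : ℂ × ℂ → ℂ} (hf : AnalyticAt ℂ f 0) :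
    ∃ (c : ℕ → ℕ → ℂ) (C r : ℝ), 0 < C ∧ 0 < r ∧ (∀ n i, ‖c n i‖ ≤ C * r ^ n) ∧
      (∀ᶠ z in 𝓝 0, HasSum (fun n => ∑ i ∈ Finset.range (n + 1), c n i * z.1 ^ i * z.2 ^ (n - i))
        (f z)) ∧
      (∀ N, OrdGE N fun z => f z - ∑ n ∈ Finset.range N,
        ∑ i ∈ Finset.range (n + 1), c n i * z.1 ^ i * z.2 ^ (n - i)) ∧
      ∀ k, OrdGE k f → ∀ n < k, ∀ z : ℂ × ℂ,
        ∑ i ∈ Finset.range (n + 1), c n i * z.1 ^ i * z.2 ^ (n - i) = 0 := by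
  obtain ⟨p, hp⟩ := hf
  choose c hc hc' using fun n => exists_coeff_of_continuousMultilinearMap n (p n)
  obtain ⟨C, r, hC, hr, hb⟩ := p.le_mul_pow_of_radius_pos hp.radius_pos
  refine ⟨c, C, 2 * r, hC, by positivity, fun n i => (hc n i).trans ?_, ?_, fun N => ?_, ?_⟩
  · rw [mul_pow]
    calc 2 ^ n * ‖p n‖ ≤ 2 ^ n * (C * r ^ n) := by gcongr; exact hb n
      _ = _ := by ring
  · obtain ⟨R, hR⟩ := hp
    filter_upwards [Metric.eball_mem_nhds (0 : ℂ × ℂ) hR.r_pos] with z hz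
    have := hR.hasSum hz
    simpa only [zero_add, hc'] using this
  · have := hp.isBigO_sub_partialSum_pow N
    simpa only [OrdGE, zero_add, FormalMultilinearSeries.partialSum, hc'] using this
  · intro k hk n
    induction n using Nat.strong_induction_on with
    | _ n ih =>
      intro hn z
      rw [← hc']
      refine Asymptotics.IsBigO.continuousMultilinearMap_apply_eq_zero ?_ z
      have h1 := hp.isBigO_sub_partialSum_pow (n + 1)
      have h2 : OrdGE (n + 1) f := hk.trans (isBigO_norm_pow_of_le hn)
      have h3 := h2.sub h1
      refine h3.congr_left fun w => ?_
      simp only [zero_add, FormalMultilinearSeries.partialSum, sub_sub_cancel]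
      rw [Finset.sum_range_succ, Finset.sum_eq_zero, zero_add]
      intro m hm
      rw [hc', ih m (Finset.mem_range.1 hm) ((Finset.mem_range.1 hm).trans hn)]

/-- A double sequence of coefficients with geometric growth is the Taylor expansion of an analytic
function. -/
theorem exists_analyticAt_of_coeff {c : ℕ → ℕ → ℂ} {C r : ℝ} (hC : 0 < C) (hr : 0 < r)
    (hc : ∀ n i, ‖c n i‖ ≤ C * r ^ n) :
    ∃ f : ℂ × ℂ → ℂ, AnalyticAt ℂ f 0 ∧
      ∀ᶠ z in 𝓝 0, HasSum (fun n => ∑ i ∈ Finset.range (n + 1), c n i * z.1 ^ i * z.2 ^ (n - i))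
        (f z) := by
  classical
  -- the monomial `x ^ i * y ^ (n - i)` as a multilinear map: the first `i` factors take `x`
  let l : ∀ n : ℕ, ℕ → Fin n → (ℂ × ℂ →L[ℂ] ℂ) := fun n i k =>
    if (k : ℕ) < i then ContinuousLinearMap.fst ℂ ℂ ℂ else ContinuousLinearMap.snd ℂ ℂ ℂ
  let mon : ∀ n : ℕ, ℕ → ContinuousMultilinearMap ℂ (fun _ : Fin n => ℂ × ℂ) ℂ := fun n i =>
    (ContinuousMultilinearMap.mkPiAlgebraFin ℂ n ℂ).compContinuousLinearMap (l n i)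
  have hmon : ∀ n i, ‖mon n i‖ ≤ 1 := by
    intro n i
    refine (ContinuousMultilinearMap.norm_compContinuousLinearMap_le _ _).trans ?_
    rw [ContinuousMultilinearMap.norm_mkPiAlgebraFin, one_mul]
    refine Finset.prod_le_one (fun _ _ => norm_nonneg _) fun k _ => ?_
    simp only [l]
    split_ifs
    · exact ContinuousLinearMap.norm_fst_le ..
    · exact ContinuousLinearMap.norm_snd_le ..
  have hmon' : ∀ n i, i ≤ n → ∀ z : ℂ × ℂ, mon n i (fun _ => z) = z.1 ^ i * z.2 ^ (n - i) := by
    intro n i hi z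
    have h1 : mon n i (fun _ => z) = ∏ k : Fin n, if (k : ℕ) < i then z.1 else z.2 := by
      simp only [mon, ContinuousMultilinearMap.compContinuousLinearMap_apply,
        ContinuousMultilinearMap.mkPiAlgebraFin_apply, List.prod_ofFn]
      refine Finset.prod_congr rfl fun k _ => ?_
      simp only [l]
      split_ifs <;> rfl
    rw [h1, Fin.prod_univ_eq_prod_range (fun k => if k < i then z.1 else z.2) n,
      ← Finset.prod_range_mul_prod_Ico _ hi]
    congr 1
    · rw [Finset.prod_congr rfl fun k hk => if_pos (Finset.mem_range.1 hk)]; simp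
    · rw [Finset.prod_congr rfl fun k hk => if_neg (not_lt.2 (Finset.mem_Ico.1 hk).1)]; simp
  let q : FormalMultilinearSeries ℂ (ℂ × ℂ) ℂ := fun n =>
    ∑ i ∈ Finset.range (n + 1), c n i • mon n i
  have hq : ∀ n, ‖q n‖ ≤ C * (2 * r) ^ n := by
    intro n
    refine (norm_sum_le _ _).trans
      ((Finset.sum_le_sum (g := fun _ => C * r ^ n) fun i _ => ?_).trans ?_)
    · rw [norm_smul]
      exact (mul_le_of_le_one_right (norm_nonneg _) (hmon n i)).trans (hc n i)
    · rw [Finset.sum_const, Finset.card_range, nsmul_eq_mul, mul_pow]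
      have : ((n + 1 : ℕ) : ℝ) ≤ 2 ^ n := by exact_mod_cast Nat.lt_two_pow_self
      calc ((n + 1 : ℕ) : ℝ) * (C * r ^ n) ≤ 2 ^ n * (C * r ^ n) := by gcongr
        _ = _ := by ring
  have hrad : 0 < q.radius := by
    have h2 : (0 : ℝ) ≤ (2 * r)⁻¹ := by positivity
    let ρ : NNReal := ⟨(2 * r)⁻¹, h2⟩
    have : (ρ : ENNReal) ≤ q.radius := by
      refine q.le_radius_of_bound C fun n => ?_
      calc ‖q n‖ * (ρ : ℝ) ^ n ≤ C * (2 * r) ^ n * (2 * r)⁻¹ ^ n :=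
            mul_le_mul_of_nonneg_right (hq n) (pow_nonneg h2 n)
        _ = C := by rw [mul_assoc, ← mul_pow, mul_inv_cancel₀ (by positivity), one_pow, mul_one]
    refine lt_of_lt_of_le ?_ this
    rw [ENNReal.coe_pos]
    exact show (0 : ℝ) < (2 * r)⁻¹ by positivity
  have hball := q.hasFPowerSeriesOnBall hrad
  refine ⟨q.sum, hball.analyticAt, ?_⟩
  filter_upwards [Metric.eball_mem_nhds (0 : ℂ × ℂ) hrad] with z hz
  have := hball.hasSum hz
  rw [zero_add] at this
  refine this.congr_fun ?_
  intro n
  simp only [q, sum_apply, smul_apply,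
    smul_eq_mul]
  refine Finset.sum_congr rfl fun i hi => ?_
  rw [hmon' n i (Nat.lt_succ_iff.1 (Finset.mem_range.1 hi)), mul_assoc]

/-- The curve `{x = 0}` is a prime divisor: a function that vanishes on it is divisible by `x`. -/
theorem exists_eq_fst_mul {f : ℂ × ℂ → ℂ} (hf : AnalyticAt ℂ f 0)
    (h0 : ∀ᶠ y in 𝓝 (0 : ℂ), f (0, y) = 0) :
    ∃ g : ℂ × ℂ → ℂ, AnalyticAt ℂ g 0 ∧ ∀ᶠ z in 𝓝 0, f z = z.1 * g z := by
  obtain ⟨c, C, r, hC, hr, hc, hs, -, -⟩ := exists_hasSum_of_analyticAt hf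
  have hc0 : ∀ n, c n 0 = 0 := by
    have hp : HasFPowerSeriesAt (fun y => f (0, y))
        (FormalMultilinearSeries.ofScalars ℂ fun n => c n 0) 0 := by
      rw [hasFPowerSeriesAt_iff]
      have ht : Tendsto (fun y : ℂ => ((0 : ℂ), y)) (𝓝 0) (𝓝 (0 : ℂ × ℂ)) :=
        (Continuous.prodMk_right (0 : ℂ)).tendsto' _ _ rfl
      filter_upwards [ht.eventually hs] with y hy
      rw [zero_add]
      refine hy.congr_fun fun n => ?_
      rw [Finset.sum_range_succ']
      simp [FormalMultilinearSeries.coeff_ofScalars, mul_comm]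
    have h1 := hp.eq_zero_of_eventually h0
    intro n
    rw [← FormalMultilinearSeries.coeff_ofScalars (𝕜 := ℂ) (p := fun n => c n 0), h1]
    rfl
  obtain ⟨g, hg, hgs⟩ := exists_analyticAt_of_coeff (c := fun n i => c (n + 1) (i + 1))
    (C := C * r) (r := r) (by positivity) hr fun n i => (hc _ _).trans (le_of_eq (by ring))
  refine ⟨g, hg, ?_⟩
  filter_upwards [hs, hgs] with z h1 h2
  have h3 := h2.mul_left z.1
  rw [← hasSum_nat_add_iff' 1] at h1
  simp only [Finset.range_one, Finset.sum_singleton, zero_add, hc0] at h1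
  simp only [zero_mul, sub_zero] at h1
  refine h1.unique (h3.congr_fun fun n => ?_)
  rw [Finset.sum_range_succ' _ (n + 1), hc0, zero_mul, zero_mul, add_zero, Finset.mul_sum]
  refine Finset.sum_congr rfl fun i hi => ?_
  rw [show n + 1 - (i + 1) = n - i by omega]
  ring

/-! ### Orders of vanishing -/

namespace OrdGE

variable {f g : ℂ × ℂ → ℂ} {k l : ℕ}

theorem mono (h : OrdGE k f) (hl : l ≤ k) : OrdGE l f := h.trans (isBigO_norm_pow_of_le hl)

theorem add (hf : OrdGE k f) (hg : OrdGE k g) : OrdGE k fun z => f z + g z :=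
  Asymptotics.IsBigO.add hf hg

theorem sub (hf : OrdGE k f) (hg : OrdGE k g) : OrdGE k fun z => f z - g z :=
  Asymptotics.IsBigO.sub hf hg

theorem mul (hf : OrdGE k f) (hg : OrdGE l g) : OrdGE (k + l) fun z => f z * g z := by
  have := Asymptotics.IsBigO.mul hf hg
  simpa only [OrdGE, pow_add] using this

theorem congr (hf : OrdGE k f) (h : ∀ᶠ z in 𝓝 0, f z = g z) : OrdGE k g :=
  Asymptotics.IsBigO.congr' hf h EventuallyEq.rfl

theorem of_continuousAt (hf : ContinuousAt f 0) : OrdGE 0 f := by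
  simpa [OrdGE] using hf.isBigO_one ℂ |>.norm_right

theorem one_iff (hf : AnalyticAt ℂ f 0) : OrdGE 1 f ↔ f 0 = 0 := by
  refine ⟨fun h => ?_, fun h => ?_⟩
  · have h' : f =O[𝓝 0] fun z => ‖z - 0‖ ^ 1 := by simpa [OrdGE] using h
    exact h'.eq_zero_of_norm_pow one_ne_zero
  · have := hf.differentiableAt.isBigO_sub
    simpa [OrdGE, h] using this.norm_right

theorem two_iff (hf : AnalyticAt ℂ f 0) : OrdGE 2 f ↔ f 0 = 0 ∧ fderiv ℂ f 0 = 0 := by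
  refine ⟨fun h => ?_, fun h => ?_⟩
  · have h' : f =O[𝓝 0] fun z => ‖z - 0‖ ^ 2 := by simpa [OrdGE] using h
    exact ⟨h'.eq_zero_of_norm_pow two_ne_zero, (h'.hasFDerivAt one_lt_two).fderiv⟩
  · obtain ⟨p, hp⟩ := hf
    have h1 := hp.isBigO_sub_partialSum_pow 2
    refine h1.congr_left fun z => ?_
    have h3 : p 0 (fun _ => z) = 0 := by rw [← h.1]; exact hp.coeff_zero _
    have h4 : p 1 (fun _ => z) = 0 := by
      have := congrArg (fun q => q z) (hp.fderiv_eq.symm.trans h.2)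
      simp only [continuousMultilinearCurryFin1_apply] at this
      refine Eq.trans (congrArg (p 1) ?_) this
      funext i
      rw [Fin.fin_one_eq_zero i]; rfl
    simp [FormalMultilinearSeries.partialSum, Finset.sum_range_succ, h3, h4]

theorem swap (hf : OrdGE k f) : OrdGE k fun z => f z.swap := by
  have h : Tendsto (Prod.swap : ℂ × ℂ → ℂ × ℂ) (𝓝 0) (𝓝 0) := continuous_swap.tendsto' _ _ rfl
  have := hf.comp_tendsto h
  refine this.congr_right fun z => ?_
  simp [Prod.norm_def, max_comm]

theorem eventually_eq_zero (hf : AnalyticAt ℂ f 0) (h : ∀ k, OrdGE k f) : ∀ᶠ z in 𝓝 0, f z = 0 := by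
  obtain ⟨c, C, r, -, -, -, hs, -, h0⟩ := exists_hasSum_of_analyticAt hf
  filter_upwards [hs] with z hz
  simp only [fun n => h0 (n + 1) (h _) n (Nat.lt_succ_self n) z] at hz
  exact hz.unique hasSum_zero

/-- The leading homogeneous component. -/
theorem exists_leading (hf : AnalyticAt ℂ f 0) (h : OrdGE k f) :
    ∃ c : ℕ → ℂ, OrdGE (k + 1)
      fun z => f z - ∑ i ∈ Finset.range (k + 1), c i * z.1 ^ i * z.2 ^ (k - i) := by
  obtain ⟨c, C, r, -, -, -, -, h1, h0⟩ := exists_hasSum_of_analyticAt hf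
  refine ⟨c k, (h1 (k + 1)).congr (Eventually.of_forall fun z => ?_)⟩
  rw [Finset.sum_range_succ, Finset.sum_eq_zero fun n hn => h0 k h n (Finset.mem_range.1 hn) z,
    zero_add]

end OrdGE

/-! ### Density of the complement of the zero set -/

/-- The zero set of `h` has no interior point near the origin. -/
def DenseNe (h : ℂ × ℂ → ℂ) : Prop := ∀ᶠ z in 𝓝 (0 : ℂ × ℂ), ∃ᶠ w in 𝓝 z, h w ≠ 0

theorem frequently_fst_ne (z : ℂ × ℂ) (c : ℂ) : ∃ᶠ w in 𝓝 z, w.1 ≠ c := by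
  intro h
  simp only [not_not] at h
  have ht : Tendsto (fun s : ℂ => (z.1 + s, z.2)) (𝓝 0) (𝓝 z) :=
    (by fun_prop : Continuous fun s : ℂ => (z.1 + s, z.2)).tendsto' _ _ (by simp)
  have h1 : ∀ᶠ s : ℂ in 𝓝 0, z.1 + s = c := ht.eventually h
  have h2 : ∀ᶠ s : ℂ in 𝓝[≠] 0, s ≠ c - z.1 := by
    by_cases hz : c - z.1 = 0
    · rw [hz]; exact eventually_mem_nhdsWithin
    · exact mem_nhdsWithin_of_mem_nhds (isOpen_ne.mem_nhds (Ne.symm hz))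
  obtain ⟨s, hs, hs'⟩ := ((h1.filter_mono nhdsWithin_le_nhds).and h2).exists
  exact hs' (by rw [← hs]; ring)

theorem denseNe_fst_pow (k : ℕ) : DenseNe fun z => z.1 ^ k :=
  Eventually.of_forall fun z => (frequently_fst_ne z 0).mono fun _ h => pow_ne_zero _ h

theorem denseNe_of_analyticAt {f : ℂ × ℂ → ℂ} (hf : AnalyticAt ℂ f 0)
    (h : ¬ ∀ᶠ z in 𝓝 0, f z = 0) : DenseNe f := by
  obtain ⟨ρ, hρ, hb⟩ := Metric.eventually_nhds_iff_ball.1 hf.eventually_analyticAt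
  filter_upwards [Metric.ball_mem_nhds (0 : ℂ × ℂ) hρ] with z hz hz'
  simp only [not_not] at hz'
  have := AnalyticOnNhd.eqOn_zero_of_preconnected_of_eventuallyEq_zero
    (f := f) (U := Metric.ball 0 ρ) hb (convex_ball _ _).isPreconnected hz hz'
  exact h (Filter.mem_of_superset (Metric.ball_mem_nhds (0 : ℂ × ℂ) hρ) this)

/-- Analytic functions may be cancelled. -/
theorem eventually_eq_of_mul {h f g : ℂ × ℂ → ℂ} (hh : DenseNe h) (hf : AnalyticAt ℂ f 0)
    (hg : AnalyticAt ℂ g 0) (hfg : ∀ᶠ z in 𝓝 0, h z * f z = h z * g z) :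
    ∀ᶠ z in 𝓝 0, f z = g z := by
  filter_upwards [hh, hf.eventually_analyticAt, hg.eventually_analyticAt,
    hfg.eventually_nhds] with z h1 h2 h3 h4
  exact tendsto_nhds_unique_of_frequently_eq h2.continuousAt h3.continuousAt
    ((h1.and_eventually h4).mono fun w hw => mul_left_cancel₀ hw.1 hw.2)

/-- An estimate that holds outside of the line `x = 0` holds on this line as well, by density. -/
theorem eventually_le_of_fst_ne {f : ℂ × ℂ → ℂ} {b : ℂ × ℂ → ℝ} (hf : AnalyticAt ℂ f 0)
    (hb : Continuous b) (h : ∀ᶠ z in 𝓝 (0 : ℂ × ℂ), z.1 ≠ 0 → ‖f z‖ ≤ b z) :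
    ∀ᶠ z in 𝓝 0, ‖f z‖ ≤ b z := by
  filter_upwards [hf.eventually_analyticAt, h.eventually_nhds] with z h2 h4
  by_contra! hc
  have h5 : ∀ᶠ w in 𝓝 z, b w < ‖f w‖ :=
    hb.continuousAt.eventually_lt h2.continuousAt.norm hc
  obtain ⟨w, hw1, hw2, hw3⟩ := ((frequently_fst_ne z 0).and_eventually (h4.and h5)).exists
  exact absurd (hw2 hw1) (not_le.2 hw3)

theorem tendsto_prodMk_zero : Tendsto (fun y : ℂ => ((0 : ℂ), y)) (𝓝 0) (𝓝 (0 : ℂ × ℂ)) :=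
  (Continuous.prodMk_right (0 : ℂ)).tendsto' _ _ rfl

/-- Divisibility by `x ^ k` can be tested by the size of the function. -/
theorem exists_eq_fst_pow_mul {f : ℂ × ℂ → ℂ} (hf : AnalyticAt ℂ f 0) {k : ℕ}
    (h : f =O[𝓝 0] fun z => z.1 ^ k) :
    ∃ g : ℂ × ℂ → ℂ, AnalyticAt ℂ g 0 ∧ ∀ᶠ z in 𝓝 0, f z = z.1 ^ k * g z := by
  induction k generalizing f with
  | zero => exact ⟨f, hf, by simp⟩
  | succ k ih =>
    obtain ⟨C, hC⟩ := h.bound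
    obtain ⟨g, hg, hfg⟩ := exists_eq_fst_mul hf (by
      filter_upwards [tendsto_prodMk_zero.eventually hC] with y hy
      simpa using hy)
    obtain ⟨g', hg', hgg⟩ := ih hg (by
      refine Asymptotics.IsBigO.of_bound C (eventually_le_of_fst_ne hg (by fun_prop) ?_)
      filter_upwards [hC, hfg] with z h1 h2 h3
      rw [h2, norm_mul, pow_succ, norm_mul] at h1
      have : 0 < ‖z.1‖ := norm_pos_iff.2 h3
      refine le_of_mul_le_mul_left (h1.trans_eq ?_) this
      ring)
    refine ⟨g', hg', ?_⟩
    filter_upwards [hfg, hgg] with z h1 h2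
    rw [h1, h2]; ring

/-- The standard chart of the blow-up of the origin, centered at the point of the exceptional
divisor of slope `t`. -/
def blowChart (t : ℂ) (z : ℂ × ℂ) : ℂ × ℂ := (z.1, (t + z.2) * z.1)

theorem analyticAt_blowChart (t : ℂ) (z : ℂ × ℂ) : AnalyticAt ℂ (blowChart t) z := by
  unfold blowChart; fun_prop

@[simp] theorem blowChart_zero (t : ℂ) : blowChart t 0 = 0 := by simp [blowChart]

theorem tendsto_blowChart (t : ℂ) : Tendsto (blowChart t) (𝓝 0) (𝓝 0) := by
  simpa using (analyticAt_blowChart t 0).continuousAt.tendsto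

theorem isBigO_blowChart (t : ℂ) : blowChart t =O[𝓝 0] fun z => z.1 := by
  refine Asymptotics.IsBigO.of_bound (‖t‖ + 1) ?_
  filter_upwards [Metric.closedBall_mem_nhds (0 : ℂ × ℂ) one_pos] with z hz
  rw [mem_closedBall_zero_iff] at hz
  have h2 : ‖t + z.2‖ ≤ ‖t‖ + 1 :=
    (norm_add_le _ _).trans (by gcongr; exact (norm_snd_le z).trans hz)
  simp only [blowChart, Prod.norm_def, sup_le_iff, norm_mul]
  exact ⟨by nlinarith [norm_nonneg t, norm_nonneg z.1], by gcongr⟩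

/-- The pull-back of a function of order at least `k` to the blow-up is divisible by the `k`-th
power of the exceptional divisor, and the quotient restricts to the leading form. -/
theorem exists_blowChart_eq {f : ℂ × ℂ → ℂ} (hf : AnalyticAt ℂ f 0) {k : ℕ} {c : ℕ → ℂ}
    (h : OrdGE k f) (hc : OrdGE (k + 1)
      fun z => f z - ∑ i ∈ Finset.range (k + 1), c i * z.1 ^ i * z.2 ^ (k - i)) (t : ℂ) :
    ∃ g : ℂ × ℂ → ℂ, AnalyticAt ℂ g 0 ∧ (∀ᶠ z in 𝓝 0, f (blowChart t z) = z.1 ^ k * g z) ∧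
      ∀ᶠ s in 𝓝 (0 : ℂ), g (0, s) = ∑ i ∈ Finset.range (k + 1), c i * (t + s) ^ (k - i) := by
  have hF : AnalyticAt ℂ (fun z => f (blowChart t z)) 0 :=
    AnalyticAt.fun_comp (by simpa using hf) (analyticAt_blowChart t 0)
  have hpow : ∀ n, (fun z => ‖blowChart t z‖ ^ n) =O[𝓝 0] fun z => z.1 ^ n := fun n =>
    (isBigO_blowChart t).norm_left.pow n
  obtain ⟨g, hg, hfg⟩ := exists_eq_fst_pow_mul hF (k := k)
    ((h.comp_tendsto (tendsto_blowChart t)).trans (hpow k))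
  refine ⟨g, hg, hfg, ?_⟩
  obtain ⟨C, hC⟩ := ((hc.comp_tendsto (tendsto_blowChart t)).trans (hpow (k + 1))).bound
  have hd : AnalyticAt ℂ (fun z : ℂ × ℂ =>
      g z - ∑ i ∈ Finset.range (k + 1), c i * (t + z.2) ^ (k - i)) 0 := by
    refine hg.sub (Finset.analyticAt_fun_sum _ fun i _ => ?_)
    fun_prop
  have := eventually_le_of_fst_ne (b := fun z => C * ‖z.1‖) hd (by fun_prop) (by
    filter_upwards [hC, hfg] with z h1 h2 h3
    have h4 : f (blowChart t z) - ∑ i ∈ Finset.range (k + 1),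
        c i * (blowChart t z).1 ^ i * (blowChart t z).2 ^ (k - i) =
        z.1 ^ k * (g z - ∑ i ∈ Finset.range (k + 1), c i * (t + z.2) ^ (k - i)) := by
      rw [h2, mul_sub, Finset.mul_sum]
      congr 1
      refine Finset.sum_congr rfl fun i hi => ?_
      obtain ⟨j, rfl⟩ := Nat.exists_eq_add_of_le (Nat.lt_succ_iff.1 (Finset.mem_range.1 hi))
      simp only [blowChart, Nat.add_sub_cancel_left, mul_pow, pow_add]
      ring
    simp only [Function.comp_apply] at h1
    rw [h4, norm_mul, pow_succ, norm_mul] at h1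
    have : 0 < ‖z.1 ^ k‖ := norm_pos_iff.2 (pow_ne_zero _ h3)
    refine le_of_mul_le_mul_left (h1.trans_eq ?_) this
    ring)
  filter_upwards [tendsto_prodMk_zero.eventually this] with s hs
  simpa [sub_eq_zero] using hs

/-- The order of a nonzero polynomial at a point is at most its degree. -/
theorem analyticOrderAt_sum_le {k : ℕ} {c : ℕ → ℂ} (t : ℂ) (hc : ∃ i ≤ k, c i ≠ 0) {g : ℂ → ℂ}
    (hg : ∀ᶠ s in 𝓝 (0 : ℂ), g s = ∑ i ∈ Finset.range (k + 1), c i * (t + s) ^ (k - i)) :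
    analyticOrderAt g 0 ≤ k := by
  classical
  let P : Polynomial ℂ := ∑ i ∈ Finset.range (k + 1), Polynomial.C (c i) * Polynomial.X ^ (k - i)
  have hP : P ≠ 0 := by
    obtain ⟨i, hi, hci⟩ := hc
    intro h
    have h1 : P.coeff (k - i) = c i := by
      simp only [P, Polynomial.finsetSum_coeff, Polynomial.coeff_C_mul_X_pow]
      rw [Finset.sum_eq_single i]
      · simp
      · intro j hj hji
        rw [if_neg]
        have := Finset.mem_range.1 hj
        omega
      · intro h'; exact absurd (Finset.mem_range.2 (Nat.lt_succ_of_le hi)) h'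
    rw [h, Polynomial.coeff_zero] at h1
    exact hci h1.symm
  have hdeg : P.natDegree ≤ k := by
    refine Polynomial.natDegree_sum_le_of_forall_le _ _ fun i _ => ?_
    exact (Polynomial.natDegree_C_mul_X_pow_le _ _).trans (Nat.sub_le _ _)
  obtain ⟨Q, hQ, hQt⟩ := Polynomial.exists_eq_pow_rootMultiplicity_mul_and_not_dvd P hP t
  have hm : P.rootMultiplicity t ≤ k := by
    refine le_trans ?_ hdeg
    exact (Polynomial.rootMultiplicity_le_iff hP t _).2 fun h => by
      have := Polynomial.natDegree_le_of_dvd h hP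
      rw [Polynomial.natDegree_pow, Polynomial.natDegree_X_sub_C] at this
      omega
  have h1 : analyticOrderAt g 0 = (P.rootMultiplicity t : ℕ∞) := by
    have h2 : g =ᶠ[𝓝 0] fun s => s ^ P.rootMultiplicity t * Q.eval (t + s) := by
      filter_upwards [hg] with s hs
      rw [hs]
      have : ∑ i ∈ Finset.range (k + 1), c i * (t + s) ^ (k - i) = P.eval (t + s) := by
        simp [P, Polynomial.eval_finsetSum]
      rw [this]
      conv_lhs => rw [hQ]
      simp
    have h3 : AnalyticAt ℂ (fun s => Q.eval (t + s)) 0 := by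
      simp only [Polynomial.eval_eq_sum_range]; fun_prop
    have h4 : AnalyticAt ℂ (fun s => s ^ P.rootMultiplicity t * Q.eval (t + s)) 0 := by fun_prop
    rw [analyticOrderAt_congr h2, h4.analyticOrderAt_eq_natCast]
    refine ⟨_, h3, ?_, by simp⟩
    simpa [← Polynomial.IsRoot.def, ← Polynomial.dvd_iff_isRoot] using hQt
  rw [h1]
  exact_mod_cast hm

/-- The zeros of a holomorphic function of two variables are not isolated. -/
theorem frequently_eq_zero {g : ℂ × ℂ → ℂ} (hg : AnalyticAt ℂ g 0) (h0 : g 0 = 0) :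
    ∃ᶠ z in 𝓝 0, z ≠ 0 ∧ g z = 0 := by
  intro hcon
  obtain ⟨ρ, hρ, hb⟩ := Metric.eventually_nhds_iff_ball.1 (hg.eventually_analyticAt.and hcon)
  have hmem : ∀ x y : ℂ, ‖x‖ < ρ → ‖y‖ < ρ → (x, y) ∈ Metric.ball (0 : ℂ × ℂ) ρ := by
    intro x y hx hy
    rw [mem_ball_zero_iff, Prod.norm_def]
    exact max_lt hx hy
  have hne : ∀ x y : ℂ, ‖x‖ < ρ → ‖y‖ < ρ → (x, y) ≠ 0 → g (x, y) ≠ 0 := fun x y hx hy h h' =>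
    (hb _ (hmem x y hx hy)).2 ⟨h, h'⟩
  -- `1 / g` is bounded on the compact set `{|x| ≤ ρ / 2, |y| = ρ / 2}`, hence at the points `(x, 0)`
  -- with `x ≠ 0` small, by the maximum principle on vertical discs; but `g (x, 0)` tends to zero
  set K : Set (ℂ × ℂ) := Metric.closedBall 0 (ρ / 2) ×ˢ Metric.sphere 0 (ρ / 2) with hK
  have hKc : IsCompact K := (isCompact_closedBall _ _).prod (isCompact_sphere _ _)
  have hKm : ∀ z ∈ K, ‖z.1‖ < ρ ∧ ‖z.2‖ < ρ ∧ z ≠ 0 := by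
    rintro ⟨x, y⟩ ⟨hx, hy⟩
    simp only [mem_closedBall_zero_iff, mem_sphere_zero_iff_norm] at hx hy
    refine ⟨by simp only; linarith, by simp only; linarith, fun h => ?_⟩
    rw [(Prod.mk_eq_zero.1 h).2, norm_zero] at hy
    linarith
  have hcont : ContinuousOn (fun z => (g z)⁻¹) K := by
    refine ContinuousOn.inv₀ (fun z hz => ?_) fun z hz =>
      hne z.1 z.2 (hKm z hz).1 (hKm z hz).2.1 (hKm z hz).2.2
    exact (hb z (hmem z.1 z.2 (hKm z hz).1 (hKm z hz).2.1)).1.continuousAt.continuousWithinAt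
  obtain ⟨C, hC⟩ := hKc.exists_bound_of_continuousOn hcont
  have hmax : ∀ x : ℂ, x ≠ 0 → ‖x‖ < ρ / 2 → ‖(g (x, 0))⁻¹‖ ≤ C := by
    intro x hx hxρ
    have hd : DiffContOnCl ℂ (fun y => (g (x, y))⁻¹) (Metric.ball 0 (ρ / 2)) := by
      refine DifferentiableOn.diffContOnCl fun y hy => ?_
      rw [closure_ball _ (by positivity), mem_closedBall_zero_iff] at hy
      refine DifferentiableAt.differentiableWithinAt ?_
      have h1 := (hb _ (hmem x y (by linarith) (by linarith))).1.differentiableAt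
      refine DifferentiableAt.inv (DifferentiableAt.fun_comp' y h1 (by fun_prop)) ?_
      exact hne x y (by linarith) (by linarith) fun h => hx (Prod.mk_eq_zero.1 h).1
    refine Complex.norm_le_of_forall_mem_frontier_norm_le Metric.isBounded_ball hd (C := C) ?_
      (subset_closure (Metric.mem_ball_self (by positivity)))
    intro y hy
    rw [frontier_ball _ (by positivity)] at hy
    exact hC (x, y) ⟨by simpa using hxρ.le, hy⟩
  have ht : Tendsto (fun x : ℂ => g (x, 0)) (𝓝[≠] 0) (𝓝 0) := by
    have : ContinuousAt (fun x : ℂ => g (x, 0)) 0 :=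
      ContinuousAt.comp (f := fun x : ℂ => (x, (0 : ℂ))) hg.continuousAt (by fun_prop)
    have h2 := this.tendsto
    rw [show g (0, 0) = 0 from h0] at h2
    exact h2.mono_left nhdsWithin_le_nhds
  have hmul : Tendsto (fun x : ℂ => ‖g (x, 0)‖ * C) (𝓝[≠] 0) (𝓝 0) := by
    simpa using ht.norm.mul_const C
  have h1 : ∀ᶠ x : ℂ in 𝓝[≠] 0, ‖g (x, 0)‖ * C < 1 := hmul.eventually (gt_mem_nhds one_pos)
  have h2 : ∀ᶠ x : ℂ in 𝓝[≠] 0, ‖x‖ < ρ / 2 := by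
    refine mem_nhdsWithin_of_mem_nhds ?_
    filter_upwards [Metric.ball_mem_nhds (0 : ℂ) (half_pos hρ)] with x hx
    simpa using hx
  obtain ⟨x, h1, h2, h3⟩ := (h1.and (h2.and eventually_mem_nhdsWithin)).exists
  have h4 := hmax x h3 h2
  have h5 : g (x, 0) ≠ 0 := hne x 0 (by linarith) (by simpa using hρ)
    fun h => h3 (Prod.mk_eq_zero.1 h).1
  have h6 : ‖g (x, 0)‖ * ‖(g (x, 0))⁻¹‖ = 1 := by rw [← norm_mul, mul_inv_cancel₀ h5, norm_one]
  nlinarith [norm_nonneg (g (x, 0))]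

/-! ### Germs of `1`-forms with an isolated zero, and their blow-ups -/

/-- `A dx + B dy` is holomorphic near the origin, with no zero except possibly the origin. -/
structure IsolatedForm (A B : ℂ × ℂ → ℂ) : Prop where
  left : AnalyticAt ℂ A 0
  right : AnalyticAt ℂ B 0
  isolated : ∀ᶠ z in 𝓝 0, A z = 0 → B z = 0 → z = 0

/-- `A' dx + B' dt` is the transform of `A dx + B dy` at the point of slope `t` of the exceptional
divisor: the pull-back is divided by the power `x ^ K` of the exceptional divisor. -/
structure IsBlowUpForm (K : ℕ) (t : ℂ) (A B A' B' : ℂ × ℂ → ℂ) : Prop where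
  isolatedForm : IsolatedForm A' B'
  eq : ∀ᶠ z in 𝓝 0, A (blowChart t z) + (t + z.2) * B (blowChart t z) = z.1 ^ K * A' z ∧
    z.1 * B (blowChart t z) = z.1 ^ K * B' z

theorem IsolatedForm.swap {A B : ℂ × ℂ → ℂ} (h : IsolatedForm A B) :
    IsolatedForm (fun z => B z.swap) (fun z => A z.swap) := by
  have hs : AnalyticAt ℂ (Prod.swap : ℂ × ℂ → ℂ × ℂ) 0 := by
    change AnalyticAt ℂ (fun z : ℂ × ℂ => (z.2, z.1)) 0; fun_prop
  have ht : Tendsto (Prod.swap : ℂ × ℂ → ℂ × ℂ) (𝓝 0) (𝓝 0) := continuous_swap.tendsto' _ _ rfl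
  refine ⟨AnalyticAt.fun_comp (by simpa using h.right) hs,
    AnalyticAt.fun_comp (by simpa using h.left) hs, ?_⟩
  filter_upwards [ht.eventually h.isolated] with z hz h1 h2
  have := hz h2 h1
  rw [← Prod.swap_swap z, this]; rfl

/-- The two components do not vanish simultaneously along a smooth curve through the origin. -/
theorem IsolatedForm.not_eventually {A B : ℂ × ℂ → ℂ} (h : IsolatedForm A B) :
    ¬ ∀ᶠ y in 𝓝 (0 : ℂ), A (0, y) = 0 ∧ B (0, y) = 0 := by
  intro h'
  have h1 := (h'.and (tendsto_prodMk_zero.eventually h.isolated)).filter_mono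
    (nhdsWithin_le_nhds (s := {0}ᶜ))
  obtain ⟨y, ⟨⟨hA, hB⟩, hy⟩, hy0⟩ := (h1.and eventually_mem_nhdsWithin).exists
  exact hy0 (Prod.mk_eq_zero.1 (hy hA hB)).2

theorem analyticAt_comp_mk_zero {A : ℂ × ℂ → ℂ} (h : AnalyticAt ℂ A 0) :
    AnalyticAt ℂ (fun y : ℂ => A (0, y)) 0 :=
  AnalyticAt.fun_comp (g := A) (f := fun y : ℂ => ((0 : ℂ), y)) h (by fun_prop)

theorem analyticAt_comp_blowChart {A : ℂ × ℂ → ℂ} (h : AnalyticAt ℂ A 0) (t : ℂ) :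
    AnalyticAt ℂ (fun z => A (blowChart t z)) 0 :=
  AnalyticAt.fun_comp (by simpa using h) (analyticAt_blowChart t 0)

/-- A pair `A'`, `B'` that satisfies the equations of the blow-up and does not vanish identically on
the exceptional divisor has at most an isolated zero: on the divisor its zeros are isolated, and
outside of the divisor they are zeros of the original form. -/
theorem isBlowUpForm_of_not_eventually {K : ℕ} {t : ℂ} {A B A' B' : ℂ × ℂ → ℂ}
    (h : IsolatedForm A B) (hA' : AnalyticAt ℂ A' 0) (hB' : AnalyticAt ℂ B' 0)
    (hn : ¬ ∀ᶠ y in 𝓝 (0 : ℂ), A' (0, y) = 0 ∧ B' (0, y) = 0)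
    (heq : ∀ᶠ z in 𝓝 0, A (blowChart t z) + (t + z.2) * B (blowChart t z) = z.1 ^ K * A' z ∧
      z.1 * B (blowChart t z) = z.1 ^ K * B' z) :
    IsBlowUpForm K t A B A' B' := by
  refine ⟨⟨hA', hB', ?_⟩, heq⟩
  have h1 : ∀ᶠ y in 𝓝 (0 : ℂ), A' (0, y) = 0 → B' (0, y) = 0 → y = 0 := by
    rcases (analyticAt_comp_mk_zero hA').eventually_eq_zero_or_eventually_ne_zero with h1 | h1
    · rcases (analyticAt_comp_mk_zero hB').eventually_eq_zero_or_eventually_ne_zero with h2 | h2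
      · exact absurd (h1.and h2) hn
      · filter_upwards [eventually_nhdsWithin_iff.1 h2] with y hy _ h3
        by_contra hy0
        exact hy hy0 h3
    · filter_upwards [eventually_nhdsWithin_iff.1 h1] with y hy h3 _
      by_contra hy0
      exact hy hy0 h3
  have h2 : Tendsto (fun z : ℂ × ℂ => z.2) (𝓝 0) (𝓝 0) := continuous_snd.tendsto' _ _ rfl
  filter_upwards [heq, (tendsto_blowChart t).eventually h.isolated, h2.eventually h1]
    with z h3 h4 h5 h6 h7
  by_cases hz : z.1 = 0
  · have hz' : z = (0, z.2) := Prod.ext hz rfl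
    rw [hz'] at h6 h7 ⊢
    rw [h5 h6 h7]; rfl
  · rw [h6, h7, mul_zero] at h3
    have hB : B (blowChart t z) = 0 := by simpa [hz] using h3.2
    have hA : A (blowChart t z) = 0 := by simpa [hB] using h3.1
    exact absurd (congrArg Prod.fst (h4 hA hB)) hz

/-- The largest power of `x` that divides both functions can be split off. It exists because only the
zero function is divisible by all powers of `x`. -/
theorem exists_eq_fst_pow_mul_pair {A B : ℂ × ℂ → ℂ} (hA : AnalyticAt ℂ A 0)
    (hB : AnalyticAt ℂ B 0) (hn : ¬ ∀ᶠ z in 𝓝 0, A z = 0 ∧ B z = 0) :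
    ∃ (K : ℕ) (A' B' : ℂ × ℂ → ℂ), AnalyticAt ℂ A' 0 ∧ AnalyticAt ℂ B' 0 ∧
      (∀ᶠ z in 𝓝 0, A z = z.1 ^ K * A' z ∧ B z = z.1 ^ K * B' z) ∧
      ¬ ∀ᶠ y in 𝓝 (0 : ℂ), A' (0, y) = 0 ∧ B' (0, y) = 0 := by
  by_contra! hcon
  have key : ∀ K : ℕ, ∃ A' B' : ℂ × ℂ → ℂ, AnalyticAt ℂ A' 0 ∧ AnalyticAt ℂ B' 0 ∧
      (∀ᶠ z in 𝓝 0, A z = z.1 ^ K * A' z ∧ B z = z.1 ^ K * B' z) := by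
    intro K
    induction K with
    | zero => exact ⟨A, B, hA, hB, by simp⟩
    | succ K ih =>
      obtain ⟨A', B', hA', hB', h⟩ := ih
      have h0 := hcon K A' B' hA' hB' h
      obtain ⟨a, ha, haa⟩ := exists_eq_fst_mul hA' (h0.mono fun _ h => h.1)
      obtain ⟨b, hb, hbb⟩ := exists_eq_fst_mul hB' (h0.mono fun _ h => h.2)
      refine ⟨a, b, ha, hb, ?_⟩
      filter_upwards [h, haa, hbb] with z h1 h2 h3
      rw [h1.1, h1.2, h2, h3]
      constructor <;> ring
  have hord : ∀ k, OrdGE k fun z : ℂ × ℂ => z.1 ^ k := by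
    intro k
    exact Asymptotics.IsBigO.of_norm_le fun z => by
      simpa using pow_le_pow_left₀ (norm_nonneg _) (norm_fst_le z) k
  refine hn ?_
  have h1 : ∀ k, OrdGE k A := fun k => by
    obtain ⟨A', B', hA', hB', h⟩ := key k
    exact ((hord k).mul (OrdGE.of_continuousAt hA'.continuousAt)).congr (h.mono fun z h => h.1.symm)
  have h2 : ∀ k, OrdGE k B := fun k => by
    obtain ⟨A', B', hA', hB', h⟩ := key k
    exact ((hord k).mul (OrdGE.of_continuousAt hB'.continuousAt)).congr (h.mono fun z h => h.2.symm)
  exact (OrdGE.eventually_eq_zero hA h1).and (OrdGE.eventually_eq_zero hB h2)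

/-- The transform exists at each point of the exceptional divisor. -/
theorem exists_isBlowUpForm {A B : ℂ × ℂ → ℂ} (h : IsolatedForm A B) (t : ℂ) :
    ∃ (K : ℕ) (A' B' : ℂ × ℂ → ℂ), IsBlowUpForm K t A B A' B' := by
  have hA := analyticAt_comp_blowChart h.left t
  have hB := analyticAt_comp_blowChart h.right t
  obtain ⟨K, A', B', hA', hB', heq, hn⟩ := exists_eq_fst_pow_mul_pair
    (A := fun z => A (blowChart t z) + (t + z.2) * B (blowChart t z))
    (B := fun z => z.1 * B (blowChart t z)) (hA.add ((analyticAt_const.add analyticAt_snd).mul hB))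
    (analyticAt_fst.mul hB) (by
      intro h'
      obtain ⟨z, hz, h1, h2⟩ := ((frequently_fst_ne 0 0).and_eventually
        (h'.and ((tendsto_blowChart t).eventually h.isolated))).exists
      have hB : B (blowChart t z) = 0 := by simpa [hz] using h1.2
      have hA : A (blowChart t z) = 0 := by simpa [hB] using h1.1
      exact absurd (congrArg Prod.fst (h2 hA hB)) hz)
  exact ⟨K, A', B', isBlowUpForm_of_not_eventually h hA' hB' hn heq⟩

/-- The germ at the origin of `A dx + B dy` can be brought into final form by finitely many point
blow-ups: either it is regular or in final form already, up to changes of coordinates and units, or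
this holds at all the points of the exceptional divisor of the blow-up of the origin. The points of
the divisor other than `∞` are parametrized by their slope; the point `∞` is the point of slope `0`
after exchange of the coordinates. -/
inductive Resolvable : (ℂ × ℂ → ℂ) → (ℂ × ℂ → ℂ) → Prop
  | regular {A B : ℂ × ℂ → ℂ} (h : A 0 ≠ 0 ∨ B 0 ≠ 0) : Resolvable A B
  | final {A B : ℂ × ℂ → ℂ}
      (h : IsNonresonantForm (oneForm A B) ∨ IsSaddleNodeForm (oneForm A B)) : Resolvable A B
  | change {A B A' B' : ℂ × ℂ → ℂ} {Φ : ℂ × ℂ → ℂ × ℂ} {u : ℂ × ℂ → ℂ}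
      {L : (ℂ × ℂ) ≃L[ℂ] (ℂ × ℂ)} (hΦ : AnalyticAt ℂ Φ 0) (h0 : Φ 0 = 0)
      (hL : HasFDerivAt Φ (L : ℂ × ℂ →L[ℂ] ℂ × ℂ) 0) (hu : AnalyticAt ℂ u 0) (hu0 : u 0 ≠ 0)
      (hi : IsolatedForm A' B')
      (h : ∀ᶠ z in 𝓝 0, pullback (oneForm A B) Φ z = u z • oneForm A' B' z)
      (hr : Resolvable A' B') : Resolvable A B
  | blowUp {A B : ℂ × ℂ → ℂ} {K : ℂ → ℕ} {A' B' : ℂ → ℂ × ℂ → ℂ} {K' : ℕ} {A'' B'' : ℂ × ℂ → ℂ}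
      (h : ∀ t, IsBlowUpForm (K t) t A B (A' t) (B' t))
      (h' : IsBlowUpForm K' 0 (fun z => B z.swap) (fun z => A z.swap) A'' B'')
      (hr : ∀ t, Resolvable (A' t) (B' t)) (hr' : Resolvable A'' B'') : Resolvable A B

theorem Resolvable.of_blowUp {A B : ℂ × ℂ → ℂ}
    (h : ∀ t, ∃ K A' B', IsBlowUpForm K t A B A' B' ∧ Resolvable A' B')
    (h' : ∃ K A' B', IsBlowUpForm K 0 (fun z => B z.swap) (fun z => A z.swap) A' B' ∧
      Resolvable A' B') : Resolvable A B := by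
  choose K A' B' h1 h2 using h
  obtain ⟨K', A'', B'', h3, h4⟩ := h'
  exact .blowUp h1 h3 h2 h4

theorem clm_apply_eq {E : Type*} [NormedAddCommGroup E] [NormedSpace ℂ E] (L : ℂ × ℂ →L[ℂ] E)
    (v : ℂ × ℂ) : L v = v.1 • L (1, 0) + v.2 • L (0, 1) := by
  rw [← map_smul, ← map_smul, ← map_add]
  simp

/-- The coefficients of the pull-back of `A dx + B dy` by a map with derivative `L`. -/
theorem pullback_oneForm {A B : ℂ × ℂ → ℂ} {Φ : ℂ × ℂ → ℂ × ℂ} {L : ℂ × ℂ →L[ℂ] ℂ × ℂ} {z : ℂ × ℂ}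
    (h : HasFDerivAt Φ L z) {a b : ℂ × ℂ → ℂ}
    (ha : A (Φ z) * (L (1, 0)).1 + B (Φ z) * (L (1, 0)).2 = a z)
    (hb : A (Φ z) * (L (0, 1)).1 + B (Φ z) * (L (0, 1)).2 = b z) :
    pullback (oneForm A B) Φ z = oneForm a b z := by
  ext
  · simpa [pullback, oneForm, h.fderiv] using ha
  · simpa [pullback, oneForm, h.fderiv] using hb

theorem oneForm_smul (u A B : ℂ × ℂ → ℂ) (z : ℂ × ℂ) :
    u z • oneForm A B z = oneForm (fun z => u z * A z) (fun z => u z * B z) z := by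
  simp [oneForm, smul_add, smul_smul]

theorem analyticAt_swap (z : ℂ × ℂ) : AnalyticAt ℂ (Prod.swap : ℂ × ℂ → ℂ × ℂ) z := by
  change AnalyticAt ℂ (fun z : ℂ × ℂ => (z.2, z.1)) z
  fun_prop

theorem analyticAt_comp_swap {f : ℂ × ℂ → ℂ} (hf : AnalyticAt ℂ f 0) :
    AnalyticAt ℂ (fun z : ℂ × ℂ => f z.swap) 0 :=
  AnalyticAt.fun_comp (f := Prod.swap) (x := (0 : ℂ × ℂ)) (by simpa using hf) (analyticAt_swap 0)

theorem tendsto_swap : Tendsto (Prod.swap : ℂ × ℂ → ℂ × ℂ) (𝓝 0) (𝓝 0) :=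
  continuous_swap.tendsto' _ _ rfl

/-- Exchange of the coordinates. -/
theorem Resolvable.of_swap {A B : ℂ × ℂ → ℂ} (h : IsolatedForm A B)
    (hr : Resolvable (fun z => B z.swap) (fun z => A z.swap)) : Resolvable A B := by
  refine .change (Φ := Prod.swap) (u := fun _ => 1) (L := ContinuousLinearEquiv.prodComm ℂ ℂ ℂ)
    (analyticAt_swap 0) rfl (ContinuousLinearEquiv.prodComm ℂ ℂ ℂ).hasFDerivAt analyticAt_const
    one_ne_zero h.swap (Eventually.of_forall fun z => ?_) hr
  rw [one_smul]
  exact pullback_oneForm (ContinuousLinearEquiv.prodComm ℂ ℂ ℂ).hasFDerivAt (by simp) (by simp)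

/-- The linear automorphism `(x, y) ↦ (x, a x + b y)` of `ℂ²`. -/
noncomputable def shear (a b : ℂ) (hb : b ≠ 0) : (ℂ × ℂ) ≃L[ℂ] (ℂ × ℂ) :=
  ContinuousLinearEquiv.equivOfInverse
    ((ContinuousLinearMap.fst ℂ ℂ ℂ).prod
      (a • ContinuousLinearMap.fst ℂ ℂ ℂ + b • ContinuousLinearMap.snd ℂ ℂ ℂ))
    ((ContinuousLinearMap.fst ℂ ℂ ℂ).prod
      ((-(b⁻¹ * a)) • ContinuousLinearMap.fst ℂ ℂ ℂ + b⁻¹ • ContinuousLinearMap.snd ℂ ℂ ℂ))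
    (fun z => by ext <;> simp; field_simp; ring) (fun z => by ext <;> simp; field_simp; ring)

/-- A change of coordinates `(x, y) ↦ (x, q(x, y))`, followed by division by a unit. -/
theorem IsolatedForm.change_snd {A B A' B' q u : ℂ × ℂ → ℂ} (h : IsolatedForm A B)
    (hq : AnalyticAt ℂ q 0) (hq0 : q 0 = 0) (hq1 : fderiv ℂ q 0 (0, 1) ≠ 0)
    (hu : AnalyticAt ℂ u 0) (hu0 : u 0 ≠ 0) (hA' : AnalyticAt ℂ A' 0) (hB' : AnalyticAt ℂ B' 0)
    (h1 : ∀ᶠ z in 𝓝 0, A (z.1, q z) + B (z.1, q z) * fderiv ℂ q z (1, 0) = u z * A' z)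
    (h2 : ∀ᶠ z in 𝓝 0, B (z.1, q z) * fderiv ℂ q z (0, 1) = u z * B' z) :
    IsolatedForm A' B' ∧ (Resolvable A' B' → Resolvable A B) := by
  set Φ : ℂ × ℂ → ℂ × ℂ := fun z => (z.1, q z) with hΦdef
  have hΦ : AnalyticAt ℂ Φ 0 := analyticAt_fst.prod hq
  have hΦ0 : Φ 0 = 0 := by simp [hΦdef, hq0]
  have hd : ∀ᶠ z in 𝓝 0, HasFDerivAt Φ
      ((ContinuousLinearMap.fst ℂ ℂ ℂ).prod (fderiv ℂ q z)) z := by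
    filter_upwards [hq.eventually_analyticAt] with z hz
    exact hasFDerivAt_fst.prodMk hz.differentiableAt.hasFDerivAt
  have hL : ((ContinuousLinearMap.fst ℂ ℂ ℂ).prod (fderiv ℂ q 0)) =
      (shear (fderiv ℂ q 0 (1, 0)) (fderiv ℂ q 0 (0, 1)) hq1 : ℂ × ℂ →L[ℂ] ℂ × ℂ) := by
    refine ContinuousLinearMap.ext fun v => ?_
    have := clm_apply_eq (fderiv ℂ q 0) v
    ext
    · simp [shear]
    · simp only [ContinuousLinearMap.prod_apply, this]
      simp [shear, mul_comm]
  have hd0 := hd.self_of_nhds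
  rw [hL] at hd0
  have hi : IsolatedForm A' B' := by
    refine ⟨hA', hB', ?_⟩
    have hs : HasStrictFDerivAt Φ
        (shear (fderiv ℂ q 0 (1, 0)) (fderiv ℂ q 0 (0, 1)) hq1 : ℂ × ℂ →L[ℂ] ℂ × ℂ) 0 := by
      rw [← hd0.fderiv]; exact hΦ.hasStrictFDerivAt
    have ht : Tendsto Φ (𝓝 0) (𝓝 0) := by
      have := hΦ.continuousAt.tendsto
      rwa [hΦ0] at this
    have hq2 : ∀ᶠ z in 𝓝 0, fderiv ℂ q z (0, 1) ≠ 0 := by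
      have : ContinuousAt (fun z => fderiv ℂ q z (0, 1)) 0 :=
        hq.fderiv.continuousAt.clm_apply continuousAt_const
      exact this.eventually_ne hq1
    filter_upwards [h1, h2, hs.eventually_left_inverse, ht.eventually h.isolated, hq2]
      with z h3 h4 h5 h6 h7 h8 h9
    rw [h9, mul_zero] at h4
    have hB : B (Φ z) = 0 := (mul_eq_zero.1 h4).resolve_right h7
    have hA : A (Φ z) = 0 := by
      rw [h8, mul_zero] at h3
      have h3' : A (Φ z) + B (Φ z) * fderiv ℂ q z (1, 0) = 0 := h3
      simpa [hB] using h3'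
    have h10 := h6 hA hB
    have h11 := hs.eventually_left_inverse.self_of_nhds
    rw [hΦ0] at h11
    rw [← h5, h10, h11]
  refine ⟨hi, fun hr => .change hΦ hΦ0 hd0 hu hu0 hi ?_ hr⟩
  filter_upwards [hd, h1, h2] with z h3 h4 h5
  rw [oneForm_smul]
  exact pullback_oneForm h3 (by simpa using h4) (by simpa using h5)

/-! ### Linear parts -/

theorem exists_linear {A : ℂ × ℂ → ℂ} (hA : AnalyticAt ℂ A 0) :
    OrdGE 2 fun z => A z - (A 0 + (fderiv ℂ A 0 (1, 0) * z.1 + fderiv ℂ A 0 (0, 1) * z.2)) := by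
  have h1 : AnalyticAt ℂ
      (fun z : ℂ × ℂ => A 0 + (fderiv ℂ A 0 (1, 0) * z.1 + fderiv ℂ A 0 (0, 1) * z.2)) 0 := by
    fun_prop
  refine (OrdGE.two_iff (hA.fun_sub h1)).2 ⟨by simp, ?_⟩
  have h2 : HasFDerivAt
      (fun z : ℂ × ℂ => A 0 + (fderiv ℂ A 0 (1, 0) * z.1 + fderiv ℂ A 0 (0, 1) * z.2))
      (fderiv ℂ A 0 (1, 0) • ContinuousLinearMap.fst ℂ ℂ ℂ +
        fderiv ℂ A 0 (0, 1) • ContinuousLinearMap.snd ℂ ℂ ℂ) 0 :=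
    ((hasFDerivAt_fst.const_mul _).add (hasFDerivAt_snd.const_mul _)).const_add _
  have h3 := (hA.differentiableAt.hasFDerivAt.fun_sub h2).fderiv
  rw [h3]
  refine ContinuousLinearMap.ext fun v => ?_
  rw [sub_apply, clm_apply_eq (fderiv ℂ A 0) v]
  simp [mul_comm]

/-- A germ of a function whose linear part is `a x + b y`. -/
def HasLinearPart (A : ℂ × ℂ → ℂ) (a b : ℂ) : Prop :=
  AnalyticAt ℂ A 0 ∧ OrdGE 2 fun z => A z - (a * z.1 + b * z.2)

namespace HasLinearPart

variable {A B : ℂ × ℂ → ℂ} {a b : ℂ}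

theorem hasFDerivAt (h : HasLinearPart A a b) : HasFDerivAt A
    (a • ContinuousLinearMap.fst ℂ ℂ ℂ + b • ContinuousLinearMap.snd ℂ ℂ ℂ) 0 := by
  have h1 : AnalyticAt ℂ (fun z : ℂ × ℂ => a * z.1 + b * z.2) 0 := by fun_prop
  have h2 : HasFDerivAt (fun z : ℂ × ℂ => a * z.1 + b * z.2)
      (a • ContinuousLinearMap.fst ℂ ℂ ℂ + b • ContinuousLinearMap.snd ℂ ℂ ℂ) 0 :=
    (hasFDerivAt_fst.const_mul _).add (hasFDerivAt_snd.const_mul _)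
  have h3 := ((OrdGE.two_iff (h.1.sub h1)).1 h.2).2
  have h4 : HasFDerivAt (fun z => A z - (a * z.1 + b * z.2)) (0 : ℂ × ℂ →L[ℂ] ℂ) 0 := by
    rw [← h3]; exact (h.1.sub h1).differentiableAt.hasFDerivAt
  simpa using h4.fun_add h2

theorem apply_zero (h : HasLinearPart A a b) : A 0 = 0 := by
  have h1 : AnalyticAt ℂ (fun z : ℂ × ℂ => a * z.1 + b * z.2) 0 := by fun_prop
  simpa using ((OrdGE.two_iff (h.1.sub h1)).1 h.2).1

/-- A function that vanishes at the origin has a linear part, given by its derivatives. -/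
theorem mk' (hA : AnalyticAt ℂ A 0) (h0 : A 0 = 0) {L : ℂ × ℂ →L[ℂ] ℂ} (h : HasFDerivAt A L 0)
    (ha : L (1, 0) = a) (hb : L (0, 1) = b) : HasLinearPart A a b := by
  have := exists_linear hA
  simp only [h0, zero_add, h.fderiv, ha, hb] at this
  exact ⟨hA, this⟩

theorem exists_of (hA : AnalyticAt ℂ A 0) (h0 : A 0 = 0) : ∃ a b, HasLinearPart A a b :=
  ⟨_, _, mk' hA h0 hA.differentiableAt.hasFDerivAt rfl rfl⟩

theorem swap (h : HasLinearPart A a b) : HasLinearPart (fun z => A z.swap) b a := by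
  refine ⟨analyticAt_comp_swap h.1, h.2.swap.congr (Eventually.of_forall fun z => ?_)⟩
  simp only [Prod.fst_swap, Prod.snd_swap]
  ring

end HasLinearPart

/-- The form `A dx + B dy` after the shear `(x, y) ↦ (x, y + k(x))`. -/
theorem IsolatedForm.shear {A B : ℂ × ℂ → ℂ} (h : IsolatedForm A B) {k : ℂ → ℂ}
    (hk : AnalyticAt ℂ k 0) (hk0 : k 0 = 0) {a₁ a₂ b₁ b₂ : ℂ} (hA : HasLinearPart A a₁ a₂)
    (hB : HasLinearPart B b₁ b₂) :
    let A' := fun z : ℂ × ℂ => A (z.1, z.2 + k z.1) + B (z.1, z.2 + k z.1) * deriv k z.1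
    let B' := fun z : ℂ × ℂ => B (z.1, z.2 + k z.1)
    let c := deriv k 0
    HasLinearPart A' (a₁ + (a₂ + b₁) * c + b₂ * c ^ 2) (a₂ + b₂ * c) ∧
      HasLinearPart B' (b₁ + b₂ * c) b₂ ∧ IsolatedForm A' B' ∧
        (Resolvable A' B' → Resolvable A B) := by
  intro A' B' c
  have hk1 : AnalyticAt ℂ (fun z : ℂ × ℂ => k z.1) 0 :=
    AnalyticAt.fun_comp (f := fun z : ℂ × ℂ => z.1) hk analyticAt_fst
  have hk2 : AnalyticAt ℂ (fun z : ℂ × ℂ => deriv k z.1) 0 :=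
    AnalyticAt.fun_comp (f := fun z : ℂ × ℂ => z.1) hk.deriv analyticAt_fst
  have hΦ0 : ((0 : ℂ × ℂ).1, (0 : ℂ × ℂ).2 + k (0 : ℂ × ℂ).1) = 0 := by simp [hk0]
  have hΦ : AnalyticAt ℂ (fun z : ℂ × ℂ => (z.1, z.2 + k z.1)) 0 := by fun_prop
  have hA1 : AnalyticAt ℂ (fun z : ℂ × ℂ => A (z.1, z.2 + k z.1)) 0 :=
    AnalyticAt.fun_comp (hΦ0.symm ▸ h.left) hΦ
  have hB1 : AnalyticAt ℂ B' 0 :=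
    AnalyticAt.fun_comp (hΦ0.symm ▸ h.right) hΦ
  have hA1' : AnalyticAt ℂ A' 0 := hA1.add (hB1.mul hk2)
  have hkd : ∀ᶠ z : ℂ × ℂ in 𝓝 0, HasFDerivAt (fun z : ℂ × ℂ => z.2 + k z.1)
      (ContinuousLinearMap.snd ℂ ℂ ℂ + deriv k z.1 • ContinuousLinearMap.fst ℂ ℂ ℂ) z := by
    have ht : Tendsto (fun z : ℂ × ℂ => z.1) (𝓝 0) (𝓝 0) := continuous_fst.tendsto' _ _ rfl
    filter_upwards [ht.eventually hk.eventually_analyticAt] with z hz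
    exact hasFDerivAt_snd.fun_add
      (hz.differentiableAt.hasDerivAt.comp_hasFDerivAt z hasFDerivAt_fst)
  have hkd0 := hkd.self_of_nhds
  have hΦd := (hasFDerivAt_fst (𝕜 := ℂ) (p := (0 : ℂ × ℂ))).prodMk hkd0
  have hAd := HasFDerivAt.comp (g := A) (0 : ℂ × ℂ) (hΦ0.symm ▸ hA.hasFDerivAt) hΦd
  have hBd := HasFDerivAt.comp (g := B) (0 : ℂ × ℂ) (hΦ0.symm ▸ hB.hasFDerivAt) hΦd
  have hB0 : B' 0 = 0 := by
    change B ((0 : ℂ × ℂ).1, (0 : ℂ × ℂ).2 + k (0 : ℂ × ℂ).1) = 0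
    rw [hΦ0, hB.apply_zero]
  have hA0 : A' 0 = 0 := by
    change A ((0 : ℂ × ℂ).1, (0 : ℂ × ℂ).2 + k (0 : ℂ × ℂ).1) + B' 0 * _ = 0
    rw [hΦ0, hA.apply_zero, hB0]; simp
  refine ⟨HasLinearPart.mk' hA1' hA0
    (hAd.fun_add (hBd.fun_mul hk2.differentiableAt.hasFDerivAt)) ?_ ?_,
    HasLinearPart.mk' hB1 hB0 hBd ?_ ?_, ?_⟩
  · have hB0' : B ((0 : ℂ × ℂ).1, (0 : ℂ × ℂ).2 + k (0 : ℂ × ℂ).1) = 0 := hB0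
    simp only [Function.comp_apply, hB0']
    simp [c]; ring
  · have hB0' : B ((0 : ℂ × ℂ).1, (0 : ℂ × ℂ).2 + k (0 : ℂ × ℂ).1) = 0 := hB0
    simp only [Function.comp_apply, hB0']
    simp [c]; ring
  · simp [c]
  · simp
  · refine h.change_snd (q := fun z => z.2 + k z.1) (u := fun _ => 1) (analyticAt_snd.add hk1)
      (by simp [hk0]) (by rw [hkd0.fderiv]; simp) analyticAt_const one_ne_zero hA1' hB1 ?_ ?_
    · filter_upwards [hkd] with z hz
      rw [hz.fderiv]; simp [A']
    · filter_upwards [hkd] with z hz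
      rw [hz.fderiv]; simp [B']

/-- The blow-up of a form with nonzero linear part, at the point of slope `t`. The hypothesis `hP`
says that the tangent cone `x A₁ + y B₁` of the linear part `A₁ dx + B₁ dy` is not zero, so that the
exceptional divisor is invariant and divided out once. -/
theorem exists_blowUp_linear {A B : ℂ × ℂ → ℂ} (h : IsolatedForm A B) {a₁ a₂ b₁ b₂ : ℂ}
    (hA : HasLinearPart A a₁ a₂) (hB : HasLinearPart B b₁ b₂)
    (hP : a₁ ≠ 0 ∨ a₂ + b₁ ≠ 0 ∨ b₂ ≠ 0) (t : ℂ) :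
    ∃ A' B', IsBlowUpForm 1 t A B A' B' ∧ A' 0 = a₁ + (a₂ + b₁) * t + b₂ * t ^ 2 ∧
      (A' 0 = 0 → ∃ e, HasLinearPart A' e (a₂ + b₁ + 2 * b₂ * t)) ∧
      HasLinearPart B' (b₁ + b₂ * t) 0 := by
  have hA1 : OrdGE 1 A := (OrdGE.one_iff hA.1).2 hA.apply_zero
  have hB1 : OrdGE 1 B := (OrdGE.one_iff hB.1).2 hB.apply_zero
  obtain ⟨g, hg, hg1, hg2⟩ := exists_blowChart_eq hA.1 (c := fun i => if i = 0 then a₂ else a₁) hA1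
    (hA.2.congr (Eventually.of_forall fun z => by simp [Finset.sum_range_succ]; ring)) t
  obtain ⟨l, hl, hl1, hl2⟩ := exists_blowChart_eq hB.1 (c := fun i => if i = 0 then b₂ else b₁) hB1
    (hB.2.congr (Eventually.of_forall fun z => by simp [Finset.sum_range_succ]; ring)) t
  simp only [Finset.sum_range_succ, Finset.range_zero, Finset.sum_empty] at hg2 hl2
  norm_num at hg2 hl2
  have hA' : AnalyticAt ℂ (fun z : ℂ × ℂ => g z + (t + z.2) * l z) 0 := by fun_prop
  have hB' : AnalyticAt ℂ (fun z : ℂ × ℂ => z.1 * l z) 0 := by fun_prop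
  have hA0 : ∀ᶠ s in 𝓝 (0 : ℂ), g (0, s) + (t + s) * l (0, s) =
      a₁ + (a₂ + b₁) * (t + s) + b₂ * (t + s) ^ 2 := by
    filter_upwards [hg2, hl2] with s h1 h2
    rw [h1, h2]; ring
  have hA00 := hA0.self_of_nhds
  have hl0 := hl2.self_of_nhds
  simp only [add_zero] at hA00 hl0
  refine ⟨_, _, isBlowUpForm_of_not_eventually h hA' hB' ?_ ?_, ?_, ?_, ?_⟩
  · intro hcon
    have h1 : ∀ᶠ s in 𝓝 (0 : ℂ), (∑ i ∈ Finset.range (2 + 1),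
        (if i = 0 then b₂ else if i = 1 then a₂ + b₁ else a₁) * (t + s) ^ (2 - i)) = 0 := by
      filter_upwards [hcon, hA0] with s h1 h2
      rw [← h1.1, h2]
      simp [Finset.sum_range_succ]; ring
    have h2 := analyticOrderAt_sum_le (k := 2)
      (c := fun i => if i = 0 then b₂ else if i = 1 then a₂ + b₁ else a₁) t (by
        rcases hP with h | h | h
        · exact ⟨2, le_rfl, by simpa using h⟩
        · exact ⟨1, by norm_num, by simpa using h⟩
        · exact ⟨0, by norm_num, by simpa using h⟩) (g := fun _ => 0)
      (h1.mono fun s hs => hs.symm)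
    rw [analyticOrderAt_eq_top.2 (by simp)] at h2
    exact absurd h2 (by simp)
  · filter_upwards [hg1, hl1] with z h1 h2
    rw [h1, h2]
    constructor <;> ring
  · rw [← hA00]; simp [show (0 : ℂ × ℂ) = (0, 0) from rfl]
  · intro h0
    refine ⟨fderiv ℂ (fun z : ℂ × ℂ => g z + (t + z.2) * l z) 0 (1, 0), HasLinearPart.mk' hA' h0
      hA'.differentiableAt.hasFDerivAt rfl ?_⟩
    have h1 : HasDerivAt (fun s : ℂ => g (0, s) + (t + s) * l (0, s))
        (fderiv ℂ (fun z : ℂ × ℂ => g z + (t + z.2) * l z) 0 (0, 1)) 0 :=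
      HasFDerivAt.comp_hasDerivAt (f := fun s : ℂ => ((0 : ℂ), s)) (0 : ℂ)
        hA'.differentiableAt.hasFDerivAt ((hasDerivAt_const _ _).prodMk (hasDerivAt_id _))
    have h2 : HasDerivAt (fun s : ℂ => a₁ + (a₂ + b₁) * (t + s) + b₂ * (t + s) ^ 2)
        (a₂ + b₁ + 2 * b₂ * t) 0 := by
      have h3 : HasDerivAt (fun s : ℂ => t + s) 1 0 := (hasDerivAt_id _).const_add t
      exact (((h3.const_mul (a₂ + b₁)).const_add a₁).fun_add
        ((h3.fun_pow 2).const_mul b₂)).congr_deriv (by push_cast; ring)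
    exact (h1.congr_of_eventuallyEq (hA0.mono fun s h => h.symm)).unique h2
  · refine HasLinearPart.mk' hB' (by simp) (hasFDerivAt_fst.fun_mul hl.differentiableAt.hasFDerivAt)
      ?_ (by simp)
    have : l 0 = b₂ * t + b₁ := hl0
    simp [this]; ring

/-! ### The theorem of Briot and Bouquet -/

/-- The inverse of the Euler operator `k ↦ x k' + s k` on holomorphic functions on a disc, as an
integral along rays. It is used for `2 ≤ Re s`, where the integrand is bounded. -/
noncomputable def eulerInv (s : ℂ) (H : ℂ → ℂ) (x : ℂ) : ℂ :=
  ∫ τ in (0 : ℝ)..1, (τ : ℂ) ^ (s - 1) * H (τ * x)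

theorem norm_ofReal_cpow_le_one {s : ℂ} (hs : 2 ≤ s.re) {τ : ℝ} (h0 : 0 < τ) (h1 : τ ≤ 1) :
    ‖(τ : ℂ) ^ (s - 1)‖ ≤ 1 := by
  rw [Complex.norm_cpow_eq_rpow_re_of_pos h0]
  exact Real.rpow_le_one h0.le h1 (by simp; linarith)

theorem continuous_cpow {s : ℂ} (hs : 2 ≤ s.re) : Continuous fun τ : ℝ => (τ : ℂ) ^ (s - 1) :=
  Complex.continuous_ofReal_cpow_const (by simp; linarith)

theorem ofReal_mul_mem_ball {δ : ℝ} {x : ℂ} (hx : ‖x‖ < δ) {τ : ℝ} (h0 : 0 ≤ τ) (h1 : τ ≤ 1) :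
    (τ : ℂ) * x ∈ Metric.ball (0 : ℂ) δ := by
  rw [mem_ball_zero_iff, norm_mul, Complex.norm_real, Real.norm_of_nonneg h0]
  exact (mul_le_of_le_one_left (norm_nonneg _) h1).trans_lt hx

/-- The inverse of the Euler operator does not increase the sup norm. -/
theorem norm_eulerInv_le {s : ℂ} (hs : 2 ≤ s.re) {H : ℂ → ℂ} {δ C : ℝ}
    (hH : ∀ x, ‖x‖ < δ → ‖H x‖ ≤ C) {x : ℂ} (hx : ‖x‖ < δ) : ‖eulerInv s H x‖ ≤ C := by
  have := intervalIntegral.norm_integral_le_of_norm_le_const (a := 0) (b := 1) (C := C)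
    (f := fun τ : ℝ => (τ : ℂ) ^ (s - 1) * H (τ * x)) (by
      intro τ hτ
      rw [uIoc_of_le zero_le_one] at hτ
      rw [norm_mul]
      have h1 := norm_ofReal_cpow_le_one hs hτ.1 hτ.2
      have h2 : ‖H (τ * x)‖ ≤ C :=
        hH _ (mem_ball_zero_iff.1 (ofReal_mul_mem_ball hx hτ.1.le hτ.2))
      exact (mul_le_of_le_one_left (norm_nonneg _) h1).trans h2)
  simpa [eulerInv] using this

theorem continuousOn_eulerInv_integrand {s : ℂ} (hs : 2 ≤ s.re) {H : ℂ → ℂ} {δ : ℝ}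
    (hH : ContinuousOn H (Metric.ball 0 δ)) {x : ℂ} (hx : ‖x‖ < δ) :
    ContinuousOn (fun τ : ℝ => (τ : ℂ) ^ (s - 1) * H (τ * x)) (Icc 0 1) := by
  refine (continuous_cpow hs).continuousOn.mul (hH.comp (by fun_prop) fun τ hτ => ?_)
  exact ofReal_mul_mem_ball hx hτ.1 hτ.2

theorem eulerInv_sub {s : ℂ} (hs : 2 ≤ s.re) {H H' : ℂ → ℂ} {δ : ℝ}
    (hH : ContinuousOn H (Metric.ball 0 δ)) (hH' : ContinuousOn H' (Metric.ball 0 δ)) {x : ℂ}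
    (hx : ‖x‖ < δ) : eulerInv s (fun x => H x - H' x) x = eulerInv s H x - eulerInv s H' x := by
  rw [eulerInv, eulerInv, eulerInv, ← intervalIntegral.integral_sub]
  · simp only [mul_sub]
  · exact (continuousOn_eulerInv_integrand hs hH hx).intervalIntegrable_of_Icc zero_le_one
  · exact (continuousOn_eulerInv_integrand hs hH' hx).intervalIntegrable_of_Icc zero_le_one

/-- The function `eulerInv s H` solves `x k' + s k = H`: differentiate under the integral sign, and
integrate the derivative of `τ ^ s * H (τ * x)`. -/
theorem hasDerivAt_eulerInv {s : ℂ} (hs : 2 ≤ s.re) {H : ℂ → ℂ} {δ : ℝ}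
    (hH : DifferentiableOn ℂ H (Metric.ball 0 δ)) {x : ℂ} (hx : ‖x‖ < δ) :
    ∃ d, HasDerivAt (eulerInv s H) d x ∧ x * d = H x - s * eulerInv s H x := by
  have hcont := hH.continuousOn
  have hH' : ContinuousOn (deriv H) (Metric.ball 0 δ) :=
    (hH.analyticOnNhd Metric.isOpen_ball).deriv.continuousOn
  obtain ⟨r, hxr, hrδ⟩ := exists_between hx
  obtain ⟨C, hC⟩ := (isCompact_closedBall (0 : ℂ) r).exists_bound_of_continuousOn
    (hH'.mono (Metric.closedBall_subset_ball hrδ))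
  have hder : ∀ y : ℂ, ‖y‖ < δ → HasDerivAt H (deriv H y) y := fun y hy =>
    (hH.differentiableAt (Metric.isOpen_ball.mem_nhds (by simpa using hy))).hasDerivAt
  have hF'c : ContinuousOn (fun τ : ℝ => (τ : ℂ) ^ (s - 1) * (deriv H (τ * x) * τ)) (Icc 0 1) := by
    refine (continuous_cpow hs).continuousOn.mul
      ((hH'.comp (by fun_prop) fun τ hτ => ofReal_mul_mem_ball hx hτ.1 hτ.2).mul (by fun_prop))
  obtain ⟨hint, hd⟩ := intervalIntegral.hasDerivAt_integral_of_dominated_loc_of_deriv_le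
    (μ := MeasureTheory.volume) (a := 0) (b := 1) (x₀ := x) (s := Metric.ball 0 r)
    (F := fun y τ => (τ : ℂ) ^ (s - 1) * H (τ * y))
    (F' := fun y τ => (τ : ℂ) ^ (s - 1) * (deriv H (τ * y) * τ)) (bound := fun _ => C)
    (Metric.isOpen_ball.mem_nhds (by simpa using hxr)) (by
      filter_upwards [Metric.isOpen_ball.mem_nhds (show x ∈ Metric.ball 0 r by simpa using hxr)]
        with y hy
      rw [uIoc_of_le zero_le_one]
      refine (ContinuousOn.aestronglyMeasurable ?_ measurableSet_Ioc)
      exact (continuousOn_eulerInv_integrand hs hcont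
        ((mem_ball_zero_iff.1 hy).trans hrδ)).mono Ioc_subset_Icc_self)
    ((continuousOn_eulerInv_integrand hs hcont hx).intervalIntegrable_of_Icc zero_le_one) (by
      rw [uIoc_of_le zero_le_one]
      exact (hF'c.mono Ioc_subset_Icc_self).aestronglyMeasurable measurableSet_Ioc) (by
      refine Eventually.of_forall fun τ hτ y hy => ?_
      rw [uIoc_of_le zero_le_one] at hτ
      have h1 := norm_ofReal_cpow_le_one hs hτ.1 hτ.2
      have h2 := hC _ (Metric.ball_subset_closedBall
        (ofReal_mul_mem_ball (mem_ball_zero_iff.1 hy) hτ.1.le hτ.2))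
      have h3 : ‖(τ : ℂ)‖ ≤ 1 := by
        rw [Complex.norm_real, Real.norm_of_nonneg hτ.1.le]; exact hτ.2
      rw [norm_mul, norm_mul]
      calc _ ≤ 1 * (C * 1) := by
            gcongr
            exact (norm_nonneg _).trans h2
        _ = C := by ring)
    intervalIntegrable_const (by
      refine Eventually.of_forall fun τ hτ y hy => ?_
      rw [uIoc_of_le zero_le_one] at hτ
      have h1 : HasDerivAt (fun y : ℂ => (τ : ℂ) * y) τ y := by
        simpa using (hasDerivAt_id y).const_mul (τ : ℂ)
      have h2 := hder (τ * y) (by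
        simpa using ofReal_mul_mem_ball ((mem_ball_zero_iff.1 hy).trans hrδ) hτ.1.le hτ.2)
      exact (HasDerivAt.comp y h2 h1).const_mul _)
  refine ⟨_, hd, ?_⟩
  have hp : ∀ τ : ℝ, 0 ≤ τ → (τ : ℂ) ^ (s - 1) * τ = (τ : ℂ) ^ s := by
    intro τ hτ
    rcases hτ.eq_or_lt with rfl | hτ
    · have : s ≠ 0 := by rintro rfl; simp at hs; linarith
      simp [Complex.zero_cpow this]
    · have : (τ : ℂ) ≠ 0 := by exact_mod_cast hτ.ne'
      rw [Complex.cpow_sub _ _ this, Complex.cpow_one, div_mul_cancel₀ _ this]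
  have hFTC := intervalIntegral.integral_eq_sub_of_hasDerivAt_of_le (a := 0) (b := 1)
    (f := fun τ : ℝ => (τ : ℂ) ^ s * H (τ * x))
    (f' := fun τ : ℝ => s * ((τ : ℂ) ^ (s - 1) * H (τ * x)) +
      x * ((τ : ℂ) ^ (s - 1) * (deriv H (τ * x) * τ))) zero_le_one (by
      refine (Complex.continuous_ofReal_cpow_const (by linarith)).continuousOn.mul
        (hcont.comp (by fun_prop) fun τ hτ => ofReal_mul_mem_ball hx hτ.1 hτ.2)) (by
      intro τ hτ
      have h1 := hasDerivAt_ofReal_cpow_const hτ.1.ne' (r := s) (by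
        rintro rfl; simp at hs; linarith)
      have h2 : HasDerivAt (fun τ : ℝ => (τ : ℂ) * x) x τ := by
        simpa using (Complex.ofRealCLM.hasDerivAt (x := τ)).mul_const x
      have h3 := hder (τ * x) (by simpa using ofReal_mul_mem_ball hx hτ.1.le hτ.2.le)
      refine (h1.fun_mul (HasDerivAt.comp τ h3 h2)).congr_deriv ?_
      rw [← hp τ hτ.1.le]
      simp only [Function.comp_apply]
      ring)
    (((((continuousOn_eulerInv_integrand hs hcont hx)).const_smul s).add
      (hF'c.const_smul x)).intervalIntegrable_of_Icc zero_le_one)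
  rw [intervalIntegral.integral_add, intervalIntegral.integral_const_mul,
    intervalIntegral.integral_const_mul] at hFTC
  · have hs0 : s ≠ 0 := by rintro rfl; simp at hs; linarith
    simp only [Complex.ofReal_one, Complex.one_cpow, one_mul, Complex.ofReal_zero, zero_mul,
      Complex.zero_cpow hs0, sub_zero] at hFTC
    rw [eq_sub_iff_add_eq, ← hFTC, add_comm]
    rfl
  · exact ((continuousOn_eulerInv_integrand hs hcont hx).const_smul s).intervalIntegrable_of_Icc
      zero_le_one
  · exact (hF'c.const_smul x).intervalIntegrable_of_Icc zero_le_one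

/-- The equation `x k' = F(x, k)` with `Re ∂F/∂y ≤ -2`, by Picard iteration. With `s = -∂F/∂y(0)` and
`G = F + s y` it reads `x k' + s k = G(x, k)`, that is, `k = eulerInv s (G(x, k))`. As `∂G/∂y`
vanishes at the origin, the right-hand side contracts distances by the factor `1 / 2`. -/
theorem briotBouquet_of_re_le {F : ℂ × ℂ → ℂ} (hF : AnalyticAt ℂ F 0) (hF0 : F 0 = 0)
    (hρ : (fderiv ℂ F 0 (0, 1)).re ≤ -2) :
    ∃ k : ℂ → ℂ, AnalyticAt ℂ k 0 ∧ k 0 = 0 ∧ ∀ᶠ x in 𝓝 0, x * deriv k x = F (x, k x) := by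
  set s := -fderiv ℂ F 0 (0, 1) with hsdef
  have hs : 2 ≤ s.re := by simp [hsdef]; linarith
  set G : ℂ × ℂ → ℂ := fun z => F z + s * z.2 with hG
  have hGa : AnalyticAt ℂ G 0 := by fun_prop
  have hGd : HasStrictFDerivAt G (fderiv ℂ F 0 (1, 0) • ContinuousLinearMap.fst ℂ ℂ ℂ) 0 := by
    have h1 : HasFDerivAt G (fderiv ℂ F 0 + s • ContinuousLinearMap.snd ℂ ℂ ℂ) 0 :=
      hF.differentiableAt.hasFDerivAt.fun_add (hasFDerivAt_snd.const_mul s)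
    have h2 : fderiv ℂ F 0 + s • ContinuousLinearMap.snd ℂ ℂ ℂ =
        fderiv ℂ F 0 (1, 0) • ContinuousLinearMap.fst ℂ ℂ ℂ := by
      refine ContinuousLinearMap.ext fun v => ?_
      rw [add_apply, clm_apply_eq (fderiv ℂ F 0) v]
      simp [hsdef]; ring
    rw [h2] at h1
    rw [← h1.fderiv]
    exact hGa.hasStrictFDerivAt
  obtain ⟨U, hU, hUlip⟩ := hGd.approximates_deriv_on_nhds (c := 1 / 2) (Or.inr (by norm_num))
  obtain ⟨ε', hε', hball⟩ := Metric.eventually_nhds_iff_ball.1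
    (hGa.eventually_analyticAt.and (show ∀ᶠ z in 𝓝 0, z ∈ U from hU))
  set ε := ε' / 2 with hεdef
  have hε : 0 < ε := by positivity
  have hmem : ∀ x y : ℂ, ‖x‖ ≤ ε → ‖y‖ ≤ ε → (x, y) ∈ Metric.ball (0 : ℂ × ℂ) ε' := by
    intro x y hx hy
    rw [mem_ball_zero_iff, Prod.norm_def]
    exact max_lt (by linarith) (by linarith)
  have hlip : ∀ x y y' : ℂ, ‖x‖ ≤ ε → ‖y‖ ≤ ε → ‖y'‖ ≤ ε →
      ‖G (x, y) - G (x, y')‖ ≤ 1 / 2 * ‖y - y'‖ := by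
    intro x y y' hx hy hy'
    have := hUlip (x, y) (hball _ (hmem x y hx hy)).2 (x, y') (hball _ (hmem x y' hx hy')).2
    simpa [Prod.norm_def] using this
  have hG0 : ∀ᶠ x in 𝓝 (0 : ℂ), ‖G (x, 0)‖ ≤ ε / 4 := by
    have h1 : ContinuousAt (fun x : ℂ => G (x, 0)) 0 :=
      ContinuousAt.comp (f := fun x : ℂ => (x, (0 : ℂ))) (show ContinuousAt G (0, 0) from
        hGa.continuousAt) (by fun_prop)
    have h2 := h1.norm.tendsto
    have h3 : G (0, 0) = 0 := by
      have : F (0, 0) = 0 := hF0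
      simp [hG, this]
    rw [h3, norm_zero] at h2
    exact (h2.eventually (gt_mem_nhds (by positivity : (0 : ℝ) < ε / 4))).mono fun x h => h.le
  obtain ⟨δ', hδ', hδ1⟩ := Metric.eventually_nhds_iff_ball.1 hG0
  set δ := min δ' ε with hδdef
  have hδ : 0 < δ := lt_min hδ' hε
  have hδε : ∀ x : ℂ, ‖x‖ < δ → ‖x‖ ≤ ε := fun x hx => hx.le.trans (min_le_right _ _)
  -- functions bounded by `ε / 2` on the disc of radius `δ`
  let Q : (ℂ → ℂ) → Prop := fun k => DifferentiableOn ℂ k (Metric.ball 0 δ) ∧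
    ∀ x, ‖x‖ < δ → ‖k x‖ ≤ ε / 2
  let T : (ℂ → ℂ) → ℂ → ℂ := fun k => eulerInv s fun x => G (x, k x)
  have hdiff : ∀ k, Q k → DifferentiableOn ℂ (fun x => G (x, k x)) (Metric.ball 0 δ) := by
    intro k hk x hx
    have hx' := mem_ball_zero_iff.1 hx
    have h1 := (hball (x, k x) (hmem x (k x) (hδε x hx') (by linarith [hk.2 x hx']))).1
    have h2 : DifferentiableAt ℂ k x :=
      (hk.1 x hx).differentiableAt (Metric.isOpen_ball.mem_nhds hx)
    exact (DifferentiableAt.fun_comp' (f := fun x => (x, k x)) x h1.differentiableAt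
      (differentiableAt_id.prodMk h2)).differentiableWithinAt
  have hQT : ∀ k, Q k → Q (T k) := by
    intro k hk
    refine ⟨fun x hx => ?_, fun x hx => ?_⟩
    · obtain ⟨d, hd, -⟩ := hasDerivAt_eulerInv hs (hdiff k hk) (mem_ball_zero_iff.1 hx)
      exact hd.differentiableAt.differentiableWithinAt
    · refine norm_eulerInv_le hs (δ := δ) (fun y hy => ?_) hx
      have h1 := hlip y (k y) 0 (hδε y hy) (by linarith [hk.2 y hy]) (by simpa using hε.le)
      have h2 := hδ1 y (by simpa using hy.trans_le (min_le_left _ _))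
      have h3 := hk.2 y hy
      rw [sub_zero] at h1
      have h4 := norm_sub_norm_le (G (y, k y)) (G (y, 0))
      linarith
  have hTlip : ∀ k k', Q k → Q k' → ∀ C : ℝ, (∀ x, ‖x‖ < δ → ‖k x - k' x‖ ≤ C) →
      ∀ x, ‖x‖ < δ → ‖T k x - T k' x‖ ≤ C / 2 := by
    intro k k' hk hk' C hC x hx
    have := eulerInv_sub hs (hdiff k hk).continuousOn (hdiff k' hk').continuousOn hx
    rw [← this]
    refine norm_eulerInv_le hs (δ := δ) (fun y hy => ?_) hx
    have h1 := hlip y (k y) (k' y) (hδε y hy) (by linarith [hk.2 y hy]) (by linarith [hk'.2 y hy])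
    have h2 := hC y hy
    linarith
  let K : ℕ → ℂ → ℂ := fun n => T^[n] fun _ => 0
  have hKs : ∀ n, K (n + 1) = T (K n) := fun n => Function.iterate_succ_apply' _ _ _
  have hKQ : ∀ n, Q (K n) := by
    intro n
    induction n with
    | zero => exact ⟨differentiableOn_const _, fun x _ => by simpa [K] using (half_pos hε).le⟩
    | succ n ih => rw [hKs]; exact hQT _ ih
  have hKd : ∀ n x, ‖x‖ < δ → ‖K n x - K (n + 1) x‖ ≤ ε / 2 / 2 ^ n := by
    intro n
    induction n with
    | zero =>
      intro x hx
      have h1 := (hKQ 1).2 x hx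
      simpa [K] using h1
    | succ n ih =>
      intro x hx
      rw [hKs n, hKs (n + 1)]
      refine (hTlip _ _ (hKQ n) (hKQ (n + 1)) _ ih x hx).trans_eq ?_
      rw [pow_succ]; ring
  have hlim : ∀ x, ‖x‖ < δ → ∃ y, Tendsto (fun n => K n x) atTop (𝓝 y) := fun x hx =>
    cauchySeq_tendsto_of_complete (cauchySeq_of_le_geometric_two fun n => by
      rw [dist_eq_norm]; exact (hKd n x hx))
  choose! k hk using hlim
  have hkK : ∀ n x, ‖x‖ < δ → ‖K n x - k x‖ ≤ ε / 2 ^ n := by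
    intro n x hx
    rw [← dist_eq_norm]
    exact dist_le_of_le_geometric_two_of_tendsto (fun n => by
      rw [dist_eq_norm]; exact (hKd n x hx)) (hk x hx) n
  have hpow : Tendsto (fun n : ℕ => ε / 2 ^ n) atTop (𝓝 0) := by
    have := (tendsto_pow_atTop_nhds_zero_of_lt_one (r := (1 / 2 : ℝ)) (by norm_num)
      (by norm_num)).const_mul ε
    simpa [div_eq_mul_inv] using this
  have hunif : TendstoLocallyUniformlyOn K k atTop (Metric.ball 0 δ) := by
    refine TendstoUniformlyOn.tendstoLocallyUniformlyOn ?_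
    rw [Metric.tendstoUniformlyOn_iff]
    intro η hη
    filter_upwards [hpow.eventually (gt_mem_nhds hη)] with n hn x hx
    rw [dist_comm, dist_eq_norm]
    exact (hkK n x (mem_ball_zero_iff.1 hx)).trans_lt hn
  have hkQ : Q k := ⟨hunif.differentiableOn (Eventually.of_forall fun n => (hKQ n).1)
    Metric.isOpen_ball, fun x hx => le_of_tendsto (hk x hx).norm
      (Eventually.of_forall fun n => (hKQ n).2 x hx)⟩
  have hfix : ∀ x, ‖x‖ < δ → k x = T k x := by
    intro x hx
    have h1 : Tendsto (fun n => K (n + 1) x) atTop (𝓝 (T k x)) := by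
      rw [tendsto_iff_norm_sub_tendsto_zero]
      refine squeeze_zero (fun _ => norm_nonneg _) (g := fun n => ε / 2 ^ n / 2) (fun n => ?_)
        (by simpa using hpow.div_const 2)
      rw [hKs]
      exact hTlip _ _ (hKQ n) hkQ _ (hkK n) x hx
    exact tendsto_nhds_unique ((tendsto_add_atTop_iff_nat 1).2 (hk x hx)) h1
  have hode : ∀ x, ‖x‖ < δ → x * deriv k x = F (x, k x) := by
    intro x hx
    obtain ⟨d, hd, he⟩ := hasDerivAt_eulerInv hs (hdiff k hkQ) hx
    have h1 : HasDerivAt k d x := by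
      refine hd.congr_of_eventuallyEq ?_
      filter_upwards [Metric.isOpen_ball.mem_nhds (show x ∈ Metric.ball 0 δ by simpa using hx)]
        with y hy
      exact hfix y (mem_ball_zero_iff.1 hy)
    have h2 : eulerInv s (fun x => G (x, k x)) x = k x := (hfix x hx).symm
    rw [h1.deriv, he, h2]
    simp [hG]
  have hballδ : Metric.ball (0 : ℂ) δ ∈ 𝓝 (0 : ℂ) := Metric.ball_mem_nhds _ hδ
  refine ⟨k, hkQ.1.analyticAt hballδ, ?_, ?_⟩
  · have h0 := hode 0 (by simpa using hδ)
    have h1 := hlip 0 (k 0) 0 (by simpa using hε.le) (by linarith [hkQ.2 0 (by simpa using hδ)])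
      (by simpa using hε.le)
    have h2 : F (0, 0) = 0 := hF0
    simp only [hG, h2, ← h0] at h1
    have hs' : 2 ≤ ‖s‖ := hs.trans (Complex.re_le_norm s)
    have h3 : ‖s * k 0‖ ≤ 1 / 2 * ‖k 0‖ := by simpa using h1
    rw [norm_mul] at h3
    have : ‖k 0‖ = 0 := by nlinarith [norm_nonneg (k 0)]
    exact norm_eq_zero.1 this
  · filter_upwards [hballδ] with x hx
    exact hode x (mem_ball_zero_iff.1 hx)

/-- **Briot–Bouquet**: the equation `x k' = F(x, k)` has a holomorphic solution through the origin
if the derivative `∂F/∂y` at the origin is not a positive integer. The substitution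
`k = c x + x k₁` lowers this derivative by one. -/
theorem briotBouquet {F : ℂ × ℂ → ℂ} (hF : AnalyticAt ℂ F 0) (hF0 : F 0 = 0)
    (hρ : ∀ n : ℕ, fderiv ℂ F 0 (0, 1) ≠ n + 1) :
    ∃ k : ℂ → ℂ, AnalyticAt ℂ k 0 ∧ k 0 = 0 ∧ ∀ᶠ x in 𝓝 0, x * deriv k x = F (x, k x) := by
  obtain ⟨N, hN⟩ := exists_nat_ge ((fderiv ℂ F 0 (0, 1)).re + 2)
  induction N generalizing F with
  | zero => exact briotBouquet_of_re_le hF hF0 (by simp at hN; linarith)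
  | succ N ih =>
    set ρ := fderiv ℂ F 0 (0, 1) with hρdef
    set a := fderiv ℂ F 0 (1, 0) with hadef
    have hρ1 : (1 - ρ) ≠ 0 := fun h => hρ 0 (by rw [← sub_eq_zero.1 h]; simp)
    set c := a / (1 - ρ) with hc
    have hac : a + ρ * c = c := by rw [hc]; field_simp; ring
    have hlin := exists_linear hF
    rw [← hρdef, ← hadef] at hlin
    simp only [hF0, zero_add] at hlin
    obtain ⟨g, hg, hg1, hg2⟩ := exists_blowChart_eq hF (k := 1)
      (c := fun i => if i = 0 then ρ else a) ((OrdGE.one_iff hF).2 hF0)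
      (hlin.congr (Eventually.of_forall fun z => by simp [Finset.sum_range_succ]; ring)) c
    simp only [Finset.sum_range_succ, Finset.range_zero, Finset.sum_empty] at hg2
    norm_num at hg2
    have hF' : AnalyticAt ℂ (fun z : ℂ × ℂ => g z - (c + z.2)) 0 := by fun_prop
    have hF'0 : ∀ᶠ s in 𝓝 (0 : ℂ), g (0, s) - (c + s) = (ρ - 1) * s := by
      filter_upwards [hg2] with s hs
      rw [hs]
      linear_combination hac
    have hd1 : HasDerivAt (fun s : ℂ => g (0, s) - (c + s))
        (fderiv ℂ (fun z : ℂ × ℂ => g z - (c + z.2)) 0 (0, 1)) 0 :=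
      HasFDerivAt.comp_hasDerivAt (f := fun s : ℂ => ((0 : ℂ), s)) (0 : ℂ)
        hF'.differentiableAt.hasFDerivAt ((hasDerivAt_const _ _).prodMk (hasDerivAt_id _))
    have hd2 : HasDerivAt (fun s : ℂ => (ρ - 1) * s) (ρ - 1) 0 := by
      simpa using (hasDerivAt_id (0 : ℂ)).const_mul (ρ - 1)
    have hder : fderiv ℂ (fun z : ℂ × ℂ => g z - (c + z.2)) 0 (0, 1) = ρ - 1 :=
      (hd1.congr_of_eventuallyEq (hF'0.mono fun s h => h.symm)).unique hd2
    obtain ⟨k, hk, hk0, hk1⟩ := ih hF' (by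
        have h0 := hF'0.self_of_nhds
        simp only [add_zero, mul_zero] at h0
        simpa [show (0 : ℂ × ℂ) = (0, 0) from rfl] using h0) (by
        intro n hn
        rw [hder] at hn
        exact hρ (n + 1) (by push_cast; linear_combination hn)) (by
        rw [hder]; push_cast at hN; simp; linarith)
    refine ⟨fun x => (c + k x) * x, by fun_prop, by simp, ?_⟩
    have ht : Tendsto (fun x => (x, k x)) (𝓝 0) (𝓝 (0 : ℂ × ℂ)) := by
      have : ContinuousAt (fun x => (x, k x)) 0 := continuousAt_id.prodMk hk.continuousAt
      have h := this.tendsto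
      rwa [hk0] at h
    filter_upwards [hk1, ht.eventually hg1, hk.eventually_analyticAt] with x h1 h2 h3
    have h4 : HasDerivAt (fun x => (c + k x) * x) (deriv k x * x + (c + k x) * 1) x :=
      (h3.differentiableAt.hasDerivAt.const_add c).fun_mul (hasDerivAt_id x)
    have h5 : F (x, (c + k x) * x) = x * g (x, k x) := by simpa [blowChart] using h2
    rw [h4.deriv, h5]
    linear_combination x * h1

/-! ### Forms with a linear part that is not nilpotent -/

theorem one_le_order {f : ℂ × ℂ → ℂ} (h : f 0 = 0) : 1 ≤ order f := by
  refine le_iInf₂ fun n hn => ?_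
  rcases n with _ | n
  · refine absurd ?_ hn
    ext v
    simp [h]
  · exact_mod_cast Nat.succ_le_succ (Nat.zero_le n)

theorem two_le_order {f : ℂ × ℂ → ℂ} (h : f 0 = 0) (h' : fderiv ℂ f 0 = 0) : 2 ≤ order f := by
  refine le_iInf₂ fun n hn => ?_
  rcases n with _ | _ | n
  · refine absurd ?_ hn
    ext v
    simp [h]
  · refine absurd ?_ hn
    ext v
    simp [h']
  · exact_mod_cast Nat.succ_le_succ (Nat.succ_le_succ (Nat.zero_le n))

theorem two_le_order_of_ordGE {f : ℂ × ℂ → ℂ} (hf : AnalyticAt ℂ f 0) (h : OrdGE 2 f) :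
    2 ≤ order f :=
  two_le_order ((OrdGE.two_iff hf).1 h).1 ((OrdGE.two_iff hf).1 h).2

theorem exists_eq_snd_mul {f : ℂ × ℂ → ℂ} (hf : AnalyticAt ℂ f 0)
    (h0 : ∀ᶠ x in 𝓝 (0 : ℂ), f (x, 0) = 0) :
    ∃ g : ℂ × ℂ → ℂ, AnalyticAt ℂ g 0 ∧ ∀ᶠ z in 𝓝 0, f z = z.2 * g z := by
  obtain ⟨g, hg, h⟩ := exists_eq_fst_mul (analyticAt_comp_swap hf) h0
  refine ⟨fun z => g z.swap, analyticAt_comp_swap hg, ?_⟩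
  filter_upwards [tendsto_swap.eventually h] with z hz
  simpa using hz

theorem HasLinearPart.apply_zero_of_eq_fst_mul {A G : ℂ × ℂ → ℂ} {a b : ℂ}
    (h : HasLinearPart A a b) (hG : AnalyticAt ℂ G 0) (hA : ∀ᶠ z in 𝓝 0, A z = z.1 * G z) :
    G 0 = a := by
  have h1 := h.hasFDerivAt
  have h2 : HasFDerivAt A _ 0 := ((hasFDerivAt_fst (𝕜 := ℂ) (p := (0 : ℂ × ℂ))).fun_mul
    hG.differentiableAt.hasFDerivAt).congr_of_eventuallyEq hA
  have h3 := DFunLike.congr_fun (h1.unique h2) (1, 0)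
  simpa using h3.symm

theorem HasLinearPart.apply_zero_of_eq_snd_mul {A G : ℂ × ℂ → ℂ} {a b : ℂ}
    (h : HasLinearPart A a b) (hG : AnalyticAt ℂ G 0) (hA : ∀ᶠ z in 𝓝 0, A z = z.2 * G z) :
    G 0 = b :=
  h.swap.apply_zero_of_eq_fst_mul (G := fun z => G z.swap) (analyticAt_comp_swap hG)
    (tendsto_swap.eventually hA)

theorem tendsto_graph {k : ℂ → ℂ} (hk : AnalyticAt ℂ k 0) (hk0 : k 0 = 0) :
    Tendsto (fun x => (x, k x)) (𝓝 0) (𝓝 (0 : ℂ × ℂ)) := by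
  have : ContinuousAt (fun x => (x, k x)) 0 := continuousAt_id.prodMk hk.continuousAt
  have h := this.tendsto
  rwa [hk0] at h

/-- A non-resonant eigendirection is tangent to an invariant curve. The substitution `k = x s` turns
the equation of an invariant curve `y = k(x)` into a Briot–Bouquet equation for `s`, whose derivative
in `s` is `l₁ / l₂ - 1`. -/
theorem exists_invariant_curve {A B : ℂ × ℂ → ℂ} {l₁ l₂ : ℂ} (hA : HasLinearPart A 0 l₁)
    (hB : HasLinearPart B (-l₂) 0) (h2 : l₂ ≠ 0) (hn : ∀ n : ℕ, l₁ ≠ (n + 2) * l₂) :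
    ∃ k : ℂ → ℂ, AnalyticAt ℂ k 0 ∧ k 0 = 0 ∧ deriv k 0 = 0 ∧
      ∀ᶠ x in 𝓝 0, A (x, k x) + B (x, k x) * deriv k x = 0 := by
  obtain ⟨g, hg, hg1, hg2⟩ := exists_blowChart_eq hA.1 (c := fun i => if i = 0 then l₁ else 0)
    ((OrdGE.one_iff hA.1).2 hA.apply_zero)
    (hA.2.congr (Eventually.of_forall fun z => by simp)) 0
  obtain ⟨l, hl, hl1, hl2⟩ := exists_blowChart_eq hB.1 (c := fun i => if i = 0 then 0 else -l₂)
    ((OrdGE.one_iff hB.1).2 hB.apply_zero)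
    (hB.2.congr (Eventually.of_forall fun z => by simp [Finset.sum_range_succ])) 0
  simp only [Finset.sum_range_succ, Finset.range_zero, Finset.sum_empty] at hg2 hl2
  norm_num at hg2 hl2
  have hl0 : l 0 = -l₂ := hl2.self_of_nhds
  have hl0' : l 0 ≠ 0 := by rw [hl0]; exact neg_ne_zero.2 h2
  have hF : AnalyticAt ℂ (fun z : ℂ × ℂ => -(g z / l z) - z.2) 0 := by
    exact ((hg.div hl hl0').neg).sub analyticAt_snd
  have hF0 : ∀ᶠ s in 𝓝 (0 : ℂ), -(g (0, s) / l (0, s)) - s = (l₁ / l₂ - 1) * s := by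
    filter_upwards [hg2, hl2] with s h3 h4
    rw [h3, h4]; field_simp
  have hder : fderiv ℂ (fun z : ℂ × ℂ => -(g z / l z) - z.2) 0 (0, 1) = l₁ / l₂ - 1 := by
    have hd1 : HasDerivAt (fun s : ℂ => -(g (0, s) / l (0, s)) - s)
        (fderiv ℂ (fun z : ℂ × ℂ => -(g z / l z) - z.2) 0 (0, 1)) 0 :=
      HasFDerivAt.comp_hasDerivAt (f := fun s : ℂ => ((0 : ℂ), s)) (0 : ℂ)
        hF.differentiableAt.hasFDerivAt ((hasDerivAt_const _ _).prodMk (hasDerivAt_id _))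
    have hd2 : HasDerivAt (fun s : ℂ => (l₁ / l₂ - 1) * s) (l₁ / l₂ - 1) 0 := by
      simpa using (hasDerivAt_id (0 : ℂ)).const_mul (l₁ / l₂ - 1)
    exact (hd1.congr_of_eventuallyEq (hF0.mono fun s h => h.symm)).unique hd2
  obtain ⟨s, hs, hs0, hs1⟩ := briotBouquet hF (by
    have h0 := hF0.self_of_nhds
    simp only [mul_zero] at h0
    exact h0) (by
    intro n hn'
    rw [hder] at hn'
    apply hn n
    have : l₁ / l₂ = n + 2 := by linear_combination hn'
    field_simp at this
    linear_combination this)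
  have hkd : ∀ᶠ x in 𝓝 (0 : ℂ), HasDerivAt (fun x => s x * x) (deriv s x * x + s x) x := by
    filter_upwards [hs.eventually_analyticAt] with x h3
    simpa using h3.differentiableAt.hasDerivAt.fun_mul (hasDerivAt_id x)
  have ht := tendsto_graph hs hs0
  refine ⟨fun x => s x * x, by fun_prop, by simp, ?_, ?_⟩
  · rw [hkd.self_of_nhds.deriv]; simp [hs0]
  · filter_upwards [hkd, ht.eventually hg1, ht.eventually hl1, hs1,
      ht.eventually (hl.continuousAt.eventually_ne hl0')] with x h3 h4 h5 h6 h7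
    have h4' : A (x, s x * x) = x * g (x, s x) := by simpa [blowChart] using h4
    have h5' : B (x, s x * x) = x * l (x, s x) := by simpa [blowChart] using h5
    rw [h3.deriv, h4', h5']
    have h6' : l (x, s x) * (x * deriv s x) = -g (x, s x) - l (x, s x) * s x := by
      rw [h6]; field_simp
    linear_combination x * h6'

/-- Straightening of the invariant curve tangent to a non-resonant eigendirection. -/
theorem IsolatedForm.straighten {A B : ℂ × ℂ → ℂ} (h : IsolatedForm A B) {l₁ l₂ : ℂ}
    (hA : HasLinearPart A 0 l₁) (hB : HasLinearPart B (-l₂) 0) (h2 : l₂ ≠ 0)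
    (hn : ∀ n : ℕ, l₁ ≠ (n + 2) * l₂) :
    ∃ A' B' G, HasLinearPart A' 0 l₁ ∧ HasLinearPart B' (-l₂) 0 ∧ IsolatedForm A' B' ∧
      (Resolvable A' B' → Resolvable A B) ∧ AnalyticAt ℂ G 0 ∧ (∀ᶠ z in 𝓝 0, A' z = z.2 * G z) ∧
      ∀ H, AnalyticAt ℂ H 0 → (∀ᶠ z in 𝓝 0, B z = z.1 * H z) →
        ∃ H', AnalyticAt ℂ H' 0 ∧ ∀ᶠ z in 𝓝 0, B' z = z.1 * H' z := by
  obtain ⟨k, hk, hk0, hk1, hk2⟩ := exists_invariant_curve hA hB h2 hn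
  obtain ⟨h3, h4, h5, h6⟩ := h.shear hk hk0 hA hB
  simp only [hk1, mul_zero, zero_pow two_ne_zero, add_zero] at h3 h4
  obtain ⟨G, hG, hG1⟩ := exists_eq_snd_mul h3.1 (by
    filter_upwards [hk2] with x hx
    simpa using hx)
  refine ⟨_, _, G, h3, h4, h5, h6, hG, hG1, fun H hH hB' => ?_⟩
  have hk1 : AnalyticAt ℂ (fun z : ℂ × ℂ => k z.1) 0 :=
    AnalyticAt.fun_comp (f := fun z : ℂ × ℂ => z.1) hk analyticAt_fst
  have hΦ0 : ((0 : ℂ × ℂ).1, (0 : ℂ × ℂ).2 + k (0 : ℂ × ℂ).1) = 0 := by simp [hk0]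
  have hΦ : AnalyticAt ℂ (fun z : ℂ × ℂ => (z.1, z.2 + k z.1)) 0 := by fun_prop
  refine ⟨fun z => H (z.1, z.2 + k z.1), AnalyticAt.fun_comp (hΦ0.symm ▸ hH) hΦ, ?_⟩
  have ht := hΦ.continuousAt.tendsto
  rw [hΦ0] at ht
  exact ht.eventually hB'

/-- Division of a form by a unit. -/
theorem IsolatedForm.change_unit {A B A' B' u : ℂ × ℂ → ℂ} (h : IsolatedForm A B)
    (hu : AnalyticAt ℂ u 0) (hu0 : u 0 ≠ 0) (hA' : AnalyticAt ℂ A' 0) (hB' : AnalyticAt ℂ B' 0)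
    (h1 : ∀ᶠ z in 𝓝 0, A z = u z * A' z) (h2 : ∀ᶠ z in 𝓝 0, B z = u z * B' z) :
    IsolatedForm A' B' ∧ (Resolvable A' B' → Resolvable A B) := by
  have hd : ∀ z, fderiv ℂ (fun z : ℂ × ℂ => z.2) z = ContinuousLinearMap.snd ℂ ℂ ℂ :=
    fun z => hasFDerivAt_snd.fderiv
  refine h.change_snd (q := fun z => z.2) analyticAt_snd rfl (by rw [hd]; simp) hu hu0 hA' hB' ?_ ?_
  · filter_upwards [h1] with z hz
    rw [hd]; simpa using hz
  · filter_upwards [h2] with z hz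
    rw [hd]; simpa using hz

/-- A diagonal linear part with two nonzero eigenvalues and no resonance: both eigendirections are
tangent to invariant curves, which are straightened one after the other. -/
theorem IsolatedForm.resolvable_of_diagonal {A B : ℂ × ℂ → ℂ} (h : IsolatedForm A B) {l₁ l₂ : ℂ}
    (hA : HasLinearPart A 0 l₁) (hB : HasLinearPart B (-l₂) 0) (h1 : l₁ ≠ 0) (h2 : l₂ ≠ 0)
    (hn : ∀ n : ℕ, l₁ ≠ (n + 1) * l₂) (hn' : ∀ n : ℕ, l₂ ≠ (n + 1) * l₁) : Resolvable A B := by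
  obtain ⟨A₁, B₁, G, hA₁, hB₁, hi₁, hr₁, hG, hG1, -⟩ := h.straighten hA hB h2
    (fun n => by have := hn (n + 1); push_cast at this; rwa [add_assoc, one_add_one_eq_two] at this)
  refine hr₁ (.of_swap hi₁ ?_)
  obtain ⟨A₂, B₂, F, hA₂, hB₂, hi₂, hr₂, hF, hF1, hH⟩ := hi₁.swap.straighten hB₁.swap
    (l₂ := -l₁) (by simpa using hA₁.swap) (neg_ne_zero.2 h1) (fun n => by
      have := hn' (n + 1)
      push_cast at this
      intro h3
      apply this
      linear_combination -h3)
  obtain ⟨H, hH, hH1⟩ := hH _ (analyticAt_comp_swap hG) (by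
    filter_upwards [tendsto_swap.eventually hG1] with z hz
    simpa using hz)
  refine hr₂ (.final (.inl ⟨-l₂, -l₁, by simp [h1, h2], fun n hn3 => ?_, fun n hn3 => ?_,
    fun z => F z - F 0, fun z => H 0 - H z, hF.fun_sub analyticAt_const,
    analyticAt_const.fun_sub hH, one_le_order (by simp), one_le_order (by simp), ?_⟩))
  · rcases n with _ | n
    · simp [h1, h2] at hn3
    · apply hn' n
      push_cast at hn3
      field_simp at hn3
      linear_combination hn3
  · rcases n with _ | n
    · simp [h1, h2] at hn3
    · apply hn n
      push_cast at hn3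
      field_simp at hn3
      linear_combination hn3
  · have hF0 := hA₂.apply_zero_of_eq_snd_mul hF hF1
    have hH0 := hB₂.apply_zero_of_eq_fst_mul hH hH1
    filter_upwards [hF1, hH1] with z h3 h4
    simp only [oneForm, h3, h4, hF0, hH0]
    congr 2 <;> ring

/-- A diagonal linear part with exactly one nonzero eigenvalue. The invariant curve tangent to its
eigendirection is straightened to `x = 0`, which makes the coefficient of `dy` divisible by `x`. -/
theorem IsolatedForm.resolvable_of_saddleNode {A B : ℂ × ℂ → ℂ} (h : IsolatedForm A B) {l : ℂ}
    (hA : HasLinearPart A 0 l) (hB : HasLinearPart B 0 0) (h1 : l ≠ 0) : Resolvable A B := by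
  refine .of_swap h ?_
  obtain ⟨A₁, B₁, G, hA₁, hB₁, hi₁, hr₁, hG, hG1, -⟩ := h.swap.straighten hB.swap
    (l₂ := -l) (by simpa using hA.swap) (neg_ne_zero.2 h1) (fun n => by
      exact fun h3 =>
        mul_ne_zero (by exact_mod_cast (n + 1).succ_ne_zero) (neg_ne_zero.2 h1) h3.symm)
  refine hr₁ (.of_swap hi₁ ?_)
  have hG0 := hA₁.apply_zero_of_eq_snd_mul hG hG1
  have hA₂ : HasLinearPart (fun z => B₁ z.swap) 0 l := by simpa using hB₁.swap
  have hf : AnalyticAt ℂ (fun z : ℂ × ℂ => l⁻¹ * B₁ z.swap - z.2) 0 :=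
    (analyticAt_const.mul hA₂.1).fun_sub analyticAt_snd
  have hG' := analyticAt_comp_swap hG
  have hg : AnalyticAt ℂ (fun z : ℂ × ℂ => l⁻¹ * G z.swap) 0 := analyticAt_const.mul hG'
  obtain ⟨-, hr₃⟩ := hi₁.swap.change_unit (u := fun _ => l)
    (A' := fun z => z.2 + (l⁻¹ * B₁ z.swap - z.2)) (B' := fun z => (l⁻¹ * G z.swap) * z.1)
    analyticAt_const h1 (by fun_prop) (by fun_prop)
    (Eventually.of_forall fun z => by field_simp; ring) (by
      filter_upwards [tendsto_swap.eventually hG1] with z hz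
      rw [hz]; simp; field_simp)
  refine hr₃ (.final (.inr ⟨_, _, hf, hg, two_le_order_of_ordGE hf ?_, one_le_order ?_,
    Eventually.of_forall fun z => rfl⟩))
  · have := (OrdGE.of_continuousAt (f := fun _ => l⁻¹) continuousAt_const).mul hA₂.2
    rw [zero_add] at this
    refine this.congr (Eventually.of_forall fun z => ?_)
    field_simp; simp
  · simp [hG0]

/-- A triangular linear part with different eigenvalues becomes diagonal after the shear
`y ↦ y - a / (l₁ - l₂) * x`. -/
theorem IsolatedForm.diagonalize {A B : ℂ × ℂ → ℂ} (h : IsolatedForm A B) {a l₁ l₂ : ℂ}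
    (hA : HasLinearPart A a l₁) (hB : HasLinearPart B (-l₂) 0) (h1 : l₁ ≠ l₂) :
    ∃ A' B', HasLinearPart A' 0 l₁ ∧ HasLinearPart B' (-l₂) 0 ∧ IsolatedForm A' B' ∧
      (Resolvable A' B' → Resolvable A B) := by
  have hk : AnalyticAt ℂ (fun x : ℂ => -a / (l₁ - l₂) * x) 0 := by fun_prop
  have hd : deriv (fun x : ℂ => -a / (l₁ - l₂) * x) 0 = -a / (l₁ - l₂) := by
    simp
  obtain ⟨h3, h4, h5, h6⟩ := h.shear hk (by simp) hA hB
  have h7 : l₁ - l₂ ≠ 0 := sub_ne_zero.2 h1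
  refine ⟨_, _, ?_, ?_, h5, h6⟩
  · convert h3 using 1
    · rw [hd]; field_simp; ring
    · simp
  · simpa using h4

theorem IsolatedForm.resolvable_of_nonresonant {A B : ℂ × ℂ → ℂ} (h : IsolatedForm A B)
    {a l₁ l₂ : ℂ} (hA : HasLinearPart A a l₁) (hB : HasLinearPart B (-l₂) 0)
    (h0 : l₁ ≠ 0 ∨ l₂ ≠ 0) (hn : ∀ n : ℕ, l₁ ≠ (n + 1) * l₂) (hn' : ∀ n : ℕ, l₂ ≠ (n + 1) * l₁) :
    Resolvable A B := by
  obtain ⟨A', B', hA', hB', hi, hr⟩ := h.diagonalize hA hB (by simpa using hn 0)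
  refine hr ?_
  rcases eq_or_ne l₁ 0 with rfl | h1
  · refine .of_swap hi (hi.swap.resolvable_of_saddleNode hB'.swap hA'.swap ?_)
    simpa using h0
  · rcases eq_or_ne l₂ 0 with rfl | h2
    · exact hi.resolvable_of_saddleNode hA' (by simpa using hB') h1
    · exact hi.resolvable_of_diagonal hA' hB' h1 h2 hn hn'

/-- The blow-up of a node with linear part `l (y dx - x dy)` is dicritical and has no singular
point. -/
theorem exists_blowUp_dicritical {A B : ℂ × ℂ → ℂ} (h : IsolatedForm A B) {l : ℂ}
    (hA : HasLinearPart A 0 l) (hB : HasLinearPart B (-l) 0) (hl : l ≠ 0) (t : ℂ) :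
    ∃ A' B', IsBlowUpForm 2 t A B A' B' ∧ B' 0 ≠ 0 := by
  obtain ⟨g, hg, hg1, hg2⟩ := exists_blowChart_eq hA.1 (c := fun i => if i = 0 then l else 0)
    ((OrdGE.one_iff hA.1).2 hA.apply_zero)
    (hA.2.congr (Eventually.of_forall fun z => by simp)) t
  obtain ⟨m, hm, hm1, hm2⟩ := exists_blowChart_eq hB.1 (c := fun i => if i = 0 then 0 else -l)
    ((OrdGE.one_iff hB.1).2 hB.apply_zero)
    (hB.2.congr (Eventually.of_forall fun z => by simp [Finset.sum_range_succ])) t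
  simp only [Finset.sum_range_succ, Finset.range_zero, Finset.sum_empty] at hg2 hm2
  norm_num at hg2 hm2
  have hm0 : m 0 = -l := hm2.self_of_nhds
  obtain ⟨G, hG, hG1⟩ := exists_eq_fst_mul (f := fun z : ℂ × ℂ => g z + (t + z.2) * m z)
    (by fun_prop) (by
      filter_upwards [hg2, hm2] with s h1 h2
      simp only [h1, h2]; ring)
  refine ⟨G, m, isBlowUpForm_of_not_eventually h hG hm (fun hcon => ?_) ?_, ?_⟩
  · have h2 : m 0 = 0 := hcon.self_of_nhds.2
    rw [hm0] at h2
    exact hl (neg_eq_zero.1 h2)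
  · filter_upwards [hg1, hm1, hG1] with z h1 h2 h3
    rw [h1, h2]
    exact ⟨by linear_combination z.1 * h3, by ring⟩
  · rw [hm0]; exact neg_ne_zero.2 hl

/-- A resonant node with eigenvalues in the ratio `n + 1`: each blow-up lowers the ratio by one. -/
theorem IsolatedForm.resolvable_of_resonant (n : ℕ) {A B : ℂ × ℂ → ℂ} (h : IsolatedForm A B)
    {a l : ℂ} (hA : HasLinearPart A a ((n + 1) * l)) (hB : HasLinearPart B (-l) 0) (hl : l ≠ 0) :
    Resolvable A B := by
  induction n generalizing A B a with
  | zero =>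
    simp only [Nat.cast_zero, zero_add, one_mul] at hA
    rcases eq_or_ne a 0 with rfl | ha
    · -- a multiple of the radial foliation, to first order: the blow-up is dicritical
      refine .of_blowUp (fun t => ?_) ?_
      · obtain ⟨A', B', h1, h2⟩ := exists_blowUp_dicritical h hA hB hl t
        exact ⟨_, _, _, h1, .regular (.inr h2)⟩
      · obtain ⟨A', B', h1, h2⟩ := exists_blowUp_dicritical h.swap (l := -l) hB.swap
          (by simpa using hA.swap) (neg_ne_zero.2 hl) 0
        exact ⟨_, _, _, h1, .regular (.inr h2)⟩
    · -- a Jordan block: the only singular point of the blow-up is a saddle-node at infinity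
      refine .of_blowUp (fun t => ?_) ?_
      · obtain ⟨A', B', h1, h2, -, -⟩ := exists_blowUp_linear h hA hB (.inl ha) t
        exact ⟨_, _, _, h1, .regular (.inl (by rw [h2]; simpa using ha))⟩
      · obtain ⟨A', B', h1, h2, h3, h4⟩ := exists_blowUp_linear h.swap hB.swap hA.swap
          (.inr (.inr ha)) 0
        obtain ⟨e, he⟩ := h3 (by rw [h2]; ring)
        refine ⟨_, _, _, h1, h1.isolatedForm.resolvable_of_nonresonant (l₁ := 0) (l₂ := -l) (a := e)
          (by simpa using he) (by simpa using h4) (.inr (neg_ne_zero.2 hl)) (fun n hn => ?_)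
          (fun n => by simpa using hl)⟩
        exact mul_ne_zero (by exact_mod_cast n.succ_ne_zero) (neg_ne_zero.2 hl) hn.symm
  | succ n ih =>
    push_cast at hA
    have hn1 : ((n : ℂ) + 1) ≠ 0 := by exact_mod_cast n.succ_ne_zero
    have hn2 : ((n : ℂ) + 1 + 1) ≠ 0 := by exact_mod_cast (n + 1).succ_ne_zero
    have hP : (n + 1 + 1) * l + -l ≠ 0 := by
      have : (n + 1 + 1) * l + -l = (n + 1) * l := by ring
      rw [this]; exact mul_ne_zero hn1 hl
    refine .of_blowUp (fun t => ?_) ?_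
    · obtain ⟨A', B', h1, h2, h3, h4⟩ := exists_blowUp_linear h hA hB (.inr (.inl hP)) t
      refine ⟨_, _, _, h1, ?_⟩
      by_cases h0 : A' 0 = 0
      · obtain ⟨e, he⟩ := h3 h0
        refine ih h1.isolatedForm (a := e) ?_ (by simpa using h4)
        convert he using 1
        ring
      · exact .regular (.inl h0)
    · -- at infinity, the eigenvalues have a negative ratio
      obtain ⟨A', B', h1, h2, h3, h4⟩ := exists_blowUp_linear h.swap hB.swap hA.swap
          (.inr (.inl (by rwa [add_comm]))) 0
      obtain ⟨e, he⟩ := h3 (by rw [h2]; ring)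
      refine ⟨_, _, _, h1, h1.isolatedForm.resolvable_of_nonresonant (l₁ := (n + 1) * l)
        (l₂ := -((n + 1 + 1) * l)) (a := e) ?_ (by simpa using h4)
        (.inl (mul_ne_zero hn1 hl)) (fun j hj => ?_) (fun j hj => ?_)⟩
      · convert he using 1
        ring
      · have h5 : ((n + 1 : ℕ) + (j + 1) * (n + 1 + 1 : ℕ) : ℂ) * l = 0 := by
          push_cast; linear_combination hj
        exact mul_ne_zero (by norm_cast) hl h5
      · have h5 : ((n + 1 + 1 : ℕ) + (j + 1) * (n + 1 : ℕ) : ℂ) * l = 0 := by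
          push_cast; linear_combination -hj
        exact mul_ne_zero (by norm_cast) hl h5

theorem IsolatedForm.resolvable_of_triangular {A B : ℂ × ℂ → ℂ} (h : IsolatedForm A B)
    {a l₁ l₂ : ℂ} (hA : HasLinearPart A a l₁) (hB : HasLinearPart B (-l₂) 0)
    (h0 : l₁ ≠ 0 ∨ l₂ ≠ 0) : Resolvable A B := by
  by_cases h1 : ∃ n : ℕ, l₁ = (n + 1) * l₂
  · obtain ⟨n, rfl⟩ := h1
    exact h.resolvable_of_resonant n hA hB fun h2 => by simp [h2] at h0
  · by_cases h2 : ∃ n : ℕ, l₂ = (n + 1) * l₁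
    · obtain ⟨n, rfl⟩ := h2
      obtain ⟨A', B', hA', hB', hi, hr⟩ := h.diagonalize hA hB fun h3 => h1 ⟨0, by simpa using h3⟩
      refine hr (.of_swap hi (hi.swap.resolvable_of_resonant n (l := -l₁) (a := 0) ?_
        (by simpa using hA'.swap) ?_))
      · convert hB'.swap using 1
        ring
      · exact neg_ne_zero.2 fun h2 => by simp [h2] at h0
    · push Not at h1 h2
      exact h.resolvable_of_nonresonant hA hB h0 h1 h2

/-- A form whose linear part is not nilpotent. The hypothesis `h0` says that the linear part of the
dual vector field `B ∂/∂x - A ∂/∂y` has a nonzero trace or a nonzero determinant. -/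
theorem IsolatedForm.resolvable_of_not_nilpotent {A B : ℂ × ℂ → ℂ} (h : IsolatedForm A B)
    {a₁ a₂ b₁ b₂ : ℂ} (hA : HasLinearPart A a₁ a₂) (hB : HasLinearPart B b₁ b₂)
    (h0 : b₁ ≠ a₂ ∨ a₁ * b₂ ≠ a₂ * b₁) : Resolvable A B := by
  rcases eq_or_ne b₂ 0 with rfl | hb
  · refine h.resolvable_of_triangular (l₂ := -b₁) hA (by simpa using hB) ?_
    by_contra! h1
    obtain ⟨h1, h2⟩ := h1
    rw [neg_eq_zero] at h2
    simp [h1, h2] at h0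
  · -- an eigendirection of the linear part
    obtain ⟨c, hc⟩ : ∃ c : ℂ, a₁ + (a₂ + b₁) * c + b₂ * c ^ 2 = 0 := by
      obtain ⟨s, hs⟩ := IsAlgClosed.exists_pow_nat_eq (discrim b₂ (a₂ + b₁) a₁) two_pos
      obtain ⟨c, hc⟩ := exists_quadratic_eq_zero hb ⟨s, by rw [← hs, sq]⟩
      exact ⟨c, by linear_combination hc⟩
    have hk : AnalyticAt ℂ (fun x : ℂ => c * x) 0 := by fun_prop
    have hd : deriv (fun x : ℂ => c * x) 0 = c := by
      simp
    obtain ⟨h3, h4, h5, h6⟩ := h.shear hk (by simp) hA hB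
    simp only [hd] at h3 h4
    rw [hc] at h3
    refine h6 (.of_swap h5 (h5.swap.resolvable_of_triangular (l₂ := -(a₂ + b₂ * c)) h4.swap
      (by simpa using h3.swap) ?_))
    by_contra! h1
    obtain ⟨h1, h2⟩ := h1
    rw [neg_eq_zero] at h2
    have h7 : b₁ = a₂ := by linear_combination h1 - h2
    rcases h0 with h0 | h0
    · exact h0 h7
    · apply h0
      linear_combination b₂ * hc - (a₂ + b₂ * c) * h1

/-! ### Forms with a nilpotent nonzero linear part -/

/-- The implicit function theorem, for one equation in the plane. -/
theorem exists_implicit {F : ℂ × ℂ → ℂ} (hF : AnalyticAt ℂ F 0) (h0 : F 0 = 0)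
    (h1 : fderiv ℂ F 0 (0, 1) ≠ 0) :
    ∃ k : ℂ → ℂ, AnalyticAt ℂ k 0 ∧ k 0 = 0 ∧ ∀ᶠ x in 𝓝 0, F (x, k x) = 0 := by
  set Φ : ℂ × ℂ → ℂ × ℂ := fun z => (z.1, F z) with hΦdef
  have hΦ : ContDiffAt ℂ ω Φ 0 := (analyticAt_fst.prod hF).contDiffAt
  have hL : HasFDerivAt Φ (shear (fderiv ℂ F 0 (1, 0)) (fderiv ℂ F 0 (0, 1)) h1 :
      ℂ × ℂ →L[ℂ] ℂ × ℂ) 0 := by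
    have h2 : ((ContinuousLinearMap.fst ℂ ℂ ℂ).prod (fderiv ℂ F 0)) =
        (shear (fderiv ℂ F 0 (1, 0)) (fderiv ℂ F 0 (0, 1)) h1 : ℂ × ℂ →L[ℂ] ℂ × ℂ) := by
      refine ContinuousLinearMap.ext fun v => ?_
      have := clm_apply_eq (fderiv ℂ F 0) v
      ext
      · simp [shear]
      · simp only [ContinuousLinearMap.prod_apply, this]
        simp [shear, mul_comm]
    rw [← h2]
    exact hasFDerivAt_fst.prodMk hF.differentiableAt.hasFDerivAt
  have hΦ0 : Φ 0 = 0 := by simp [hΦdef, h0]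
  have hs := hΦ.hasStrictFDerivAt' hL (by simp)
  have hΨ : AnalyticAt ℂ (hΦ.localInverse hL (by simp)) (Φ 0) :=
    (hΦ.to_localInverse hL (by simp)).analyticAt
  have hinv := hs.eventually_right_inverse
  set Ψ := hs.localInverse with hΨdef
  have hΨ0 : Ψ 0 = 0 := by
    have := hs.localInverse_apply_image
    rwa [hΦ0] at this
  rw [hΦ0] at hΨ hinv
  have ht : Tendsto (fun x : ℂ => (x, (0 : ℂ))) (𝓝 0) (𝓝 (0 : ℂ × ℂ)) :=
    (by fun_prop : Continuous fun x : ℂ => (x, (0 : ℂ))).tendsto' _ _ rfl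
  refine ⟨fun x => (Ψ (x, 0)).2, ?_, ?_, ?_⟩
  · have h3 : AnalyticAt ℂ (fun x : ℂ => Ψ (x, 0)) 0 :=
      AnalyticAt.fun_comp (g := Ψ) (f := fun x : ℂ => (x, (0 : ℂ))) (x := 0) hΨ (by fun_prop)
    exact AnalyticAt.fun_comp (f := fun x : ℂ => Ψ (x, 0)) analyticAt_snd h3
  · have : (Ψ (0, 0)).2 = 0 := by
      change (Ψ (0 : ℂ × ℂ)).2 = 0
      rw [hΨ0]; rfl
    exact this
  · filter_upwards [ht.eventually hinv] with x hx
    have h3 : (Ψ (x, 0)).1 = x := congrArg Prod.fst hx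
    have h4 : F (Ψ (x, 0)) = 0 := congrArg Prod.snd hx
    rwa [show Ψ (x, 0) = (x, (Ψ (x, 0)).2) from Prod.ext h3 rfl] at h4

theorem analyticOrderAt_pow_mul {g : ℂ → ℂ} (hg : AnalyticAt ℂ g 0) (k : ℕ) :
    analyticOrderAt (fun x => x ^ k * g x) 0 = k + analyticOrderAt g 0 := by
  have h1 : AnalyticAt ℂ (fun x : ℂ => x ^ k) 0 := by fun_prop
  have h2 : analyticOrderAt (fun x : ℂ => x ^ k) 0 = k :=
    (h1.analyticOrderAt_eq_natCast).2 ⟨fun _ => 1, analyticAt_const, one_ne_zero,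
      Eventually.of_forall fun z => by simp⟩
  rw [← h2]
  exact analyticOrderAt_mul h1 hg

theorem not_eventually_quadratic {a b c : ℂ} (h : a ≠ 0 ∨ b ≠ 0 ∨ c ≠ 0) (t : ℂ) :
    ¬ ∀ᶠ s in 𝓝 (0 : ℂ), a + b * (t + s) + c * (t + s) ^ 2 = 0 := by
  intro h1
  have h2 := analyticOrderAt_sum_le (k := 2)
    (c := fun i => if i = 0 then c else if i = 1 then b else a) t (by
      rcases h with h | h | h
      · exact ⟨2, le_rfl, by simpa using h⟩
      · exact ⟨1, by norm_num, by simpa using h⟩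
      · exact ⟨0, by norm_num, by simpa using h⟩) (g := fun _ => 0)
    (h1.mono fun s hs => by rw [← hs]; simp [Finset.sum_range_succ]; ring)
  rw [analyticOrderAt_eq_top.2 (by simp)] at h2
  exact absurd h2 (by simp)

namespace HasLinearPart

theorem congr {A B : ℂ × ℂ → ℂ} {a b : ℂ} (h : HasLinearPart A a b) (hAB : ∀ᶠ z in 𝓝 0, A z = B z) :
    HasLinearPart B a b :=
  ⟨h.1.congr hAB, h.2.congr (hAB.mono fun z hz => by rw [hz])⟩

theorem fst_mul {l : ℂ × ℂ → ℂ} (hl : AnalyticAt ℂ l 0) :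
    HasLinearPart (fun z => z.1 * l z) (l 0) 0 :=
  mk' (analyticAt_fst.mul hl) (by simp) (hasFDerivAt_fst.fun_mul hl.differentiableAt.hasFDerivAt)
    (by simp) (by simp)

theorem snd_mul {l : ℂ × ℂ → ℂ} (hl : AnalyticAt ℂ l 0) :
    HasLinearPart (fun z => z.2 * l z) 0 (l 0) :=
  mk' (analyticAt_snd.mul hl) (by simp) (hasFDerivAt_snd.fun_mul hl.differentiableAt.hasFDerivAt)
    (by simp) (by simp)

theorem exists_blowChart {f : ℂ × ℂ → ℂ} {a b : ℂ} (hf : HasLinearPart f a b) (t : ℂ) :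
    ∃ g, AnalyticAt ℂ g 0 ∧ (∀ᶠ z in 𝓝 0, f (blowChart t z) = z.1 * g z) ∧
      ∀ᶠ s in 𝓝 (0 : ℂ), g (0, s) = a + b * (t + s) := by
  obtain ⟨g, hg, hg1, hg2⟩ := exists_blowChart_eq hf.1 (c := fun i => if i = 0 then b else a)
    ((OrdGE.one_iff hf.1).2 hf.apply_zero)
    (hf.2.congr (Eventually.of_forall fun z => by simp [Finset.sum_range_succ]; ring)) t
  refine ⟨g, hg, by simpa using hg1, ?_⟩
  filter_upwards [hg2] with s hs
  rw [hs]
  simp [Finset.sum_range_succ]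
  ring

end HasLinearPart

theorem eq_zero_of_mul_sq_isBigO {C : ℂ} (h : (fun y : ℂ => C * y ^ 2) =O[𝓝 0] fun y => y ^ 3) :
    C = 0 := by
  by_contra hC
  have h2 := (Asymptotics.isBigO_const_mul_left_iff hC).1 h
  obtain ⟨c, hc⟩ := h2.bound
  have h3 : Tendsto (fun y : ℂ => c * ‖y‖) (𝓝 0) (𝓝 0) :=
    (by fun_prop : Continuous fun y : ℂ => c * ‖y‖).tendsto' _ _ (by simp)
  have h5 := ((hc.and (h3.eventually (gt_mem_nhds one_pos))).filter_mono
    (nhdsWithin_le_nhds (s := {0}ᶜ))).and eventually_mem_nhdsWithin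
  obtain ⟨y, ⟨hy, hy1⟩, hy0⟩ := h5.exists
  have hy2 : 0 < ‖y‖ := norm_pos_iff.2 hy0
  rw [norm_pow, norm_pow] at hy
  nlinarith [pow_pos hy2 2]

theorem OrdGE.isBigO_axis {k : ℕ} {f : ℂ × ℂ → ℂ} (h : OrdGE k f) :
    (fun y : ℂ => f (0, y)) =O[𝓝 0] fun y => y ^ k := by
  have h1 : (fun y : ℂ => f (0, y)) =O[𝓝 0] fun y : ℂ => ‖((0 : ℂ), y)‖ ^ k :=
    Asymptotics.IsBigO.comp_tendsto h tendsto_prodMk_zero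
  refine h1.trans (Asymptotics.IsBigO.of_bound 1 (Eventually.of_forall fun y => ?_))
  simp [Prod.norm_def]

/-- The blow-up of a function of order at least two, with the outer coefficients of its quadratic
part read off from its restrictions to the axes. -/
theorem exists_blowChart_sq {f : ℂ × ℂ → ℂ} (hf : AnalyticAt ℂ f 0) (h : OrdGE 2 f) :
    ∃ c₀ c₁ c₂ : ℂ, (∀ C, (∀ᶠ y in 𝓝 (0 : ℂ), f (0, y) = C * y ^ 2) → c₂ = C) ∧
      (∀ C, (∀ᶠ x in 𝓝 (0 : ℂ), f (x, 0) = C * x ^ 2) → c₀ = C) ∧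
      ∀ t, ∃ g, AnalyticAt ℂ g 0 ∧ (∀ᶠ z in 𝓝 0, f (blowChart t z) = z.1 ^ 2 * g z) ∧
        ∀ᶠ s in 𝓝 (0 : ℂ), g (0, s) = c₀ + c₁ * (t + s) + c₂ * (t + s) ^ 2 := by
  obtain ⟨c, hc⟩ := OrdGE.exists_leading hf h
  refine ⟨c 2, c 1, c 0, fun C hC => ?_, fun C hC => ?_, fun t => ?_⟩
  · have h1 : (fun y : ℂ => (C - c 0) * y ^ 2) =O[𝓝 0] fun y => y ^ 3 := by
      refine hc.isBigO_axis.congr' ?_ EventuallyEq.rfl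
      filter_upwards [hC] with y hy
      rw [hy]
      simp [Finset.sum_range_succ]; ring
    exact (sub_eq_zero.1 (eq_zero_of_mul_sq_isBigO h1)).symm
  · have h1 : (fun x : ℂ => (C - c 2) * x ^ 2) =O[𝓝 0] fun x => x ^ 3 := by
      refine hc.swap.isBigO_axis.congr' ?_ EventuallyEq.rfl
      filter_upwards [hC] with x hx
      simp only [Prod.swap_prod_mk, hx]
      simp [Finset.sum_range_succ]; ring
    exact (sub_eq_zero.1 (eq_zero_of_mul_sq_isBigO h1)).symm
  · obtain ⟨g, hg, hg1, hg2⟩ := exists_blowChart_eq hf h hc t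
    refine ⟨g, hg, hg1, ?_⟩
    filter_upwards [hg2] with s hs
    rw [hs]
    simp [Finset.sum_range_succ]; ring

/-- If the linear part of `B` is a nonzero multiple of `x`, the linear part of the form is not
nilpotent. -/
theorem IsolatedForm.resolvable_of_right_linear {A B : ℂ × ℂ → ℂ} (h : IsolatedForm A B) {b : ℂ}
    (hB : HasLinearPart B b 0) (hb : b ≠ 0) : Resolvable A B := by
  by_cases h0 : A 0 = 0
  · obtain ⟨e, f, hA⟩ := HasLinearPart.exists_of h.left h0
    refine h.resolvable_of_not_nilpotent hA hB ?_
    rcases eq_or_ne b f with rfl | hf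
    · exact .inr (by simpa using hb)
    · exact .inl hf
  · exact .regular (.inl h0)

/-- The form `y a dx + x b dy` at a corner, when `a` and `b` do not both vanish. -/
theorem IsolatedForm.resolvable_of_corner {A B a b : ℂ × ℂ → ℂ} (h : IsolatedForm A B)
    (ha : AnalyticAt ℂ a 0) (hb : AnalyticAt ℂ b 0) (hA : ∀ᶠ z in 𝓝 0, A z = z.2 * a z)
    (hB : ∀ᶠ z in 𝓝 0, B z = z.1 * b z) (h0 : a 0 ≠ 0 ∨ b 0 ≠ 0) : Resolvable A B := by
  have hA1 := (HasLinearPart.snd_mul ha).congr (hA.mono fun _ h => h.symm)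
  have hB1 := (HasLinearPart.fst_mul hb).congr (hB.mono fun _ h => h.symm)
  by_cases h1 : b 0 = 0
  · refine h.resolvable_of_not_nilpotent hA1 hB1 (.inl ?_)
    rw [h1]
    rcases h0 with h0 | h0
    · exact h0.symm
    · exact absurd h1 h0
  · exact h.resolvable_of_right_linear hB1 h1

/-- The blow-up of a corner `y a dx + x b dy`, where `a = b = 0` is a transversal intersection, is
`(t + y) (a' + b') dx + x b' dy` with `a'` and `b'` affine on the divisor. By transversality
`a' + b'` is not zero, and no point of the divisor has a nilpotent linear part. -/
theorem corner_blowUp {a b : ℂ × ℂ → ℂ} {a₁ a₂ b₁ b₂ : ℂ} (ha : HasLinearPart a a₁ a₂)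
    (hb : HasLinearPart b b₁ b₂) {A B : ℂ × ℂ → ℂ} (h : IsolatedForm A B)
    (hA : ∀ᶠ z in 𝓝 0, A z = z.2 * a z) (hB : ∀ᶠ z in 𝓝 0, B z = z.1 * b z)
    (h0 : a₁ * b₂ ≠ a₂ * b₁) (t : ℂ) :
    ∃ K A' B', IsBlowUpForm K t A B A' B' ∧ Resolvable A' B' := by
  obtain ⟨g, hg, hg1, hg2⟩ := ha.exists_blowChart t
  obtain ⟨l, hl, hl1, hl2⟩ := hb.exists_blowChart t
  have hA' : AnalyticAt ℂ (fun z : ℂ × ℂ => (t + z.2) * (g z + l z)) 0 := by fun_prop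
  have hB' : AnalyticAt ℂ (fun z : ℂ × ℂ => z.1 * l z) 0 := by fun_prop
  have hg0 : g 0 = a₁ + a₂ * t := hg2.self_of_nhds.trans (by simp)
  have hl0 : l 0 = b₁ + b₂ * t := hl2.self_of_nhds.trans (by simp)
  have hbl : IsBlowUpForm 2 t A B (fun z => (t + z.2) * (g z + l z)) (fun z => z.1 * l z) := by
    refine isBlowUpForm_of_not_eventually h hA' hB' (fun hcon => ?_) ?_
    · refine not_eventually_quadratic (a := 0) (b := a₁ + b₁) (c := a₂ + b₂) ?_ t ?_
      · by_contra! h1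
        apply h0
        linear_combination (-a₂ : ℂ) * h1.2.1 + a₁ * h1.2.2
      · filter_upwards [hcon, hg2, hl2] with s h1 h2 h3
        have h4 := h1.1
        simp only [h2, h3] at h4
        linear_combination h4
    · have ht := tendsto_blowChart t
      filter_upwards [ht.eventually hA, ht.eventually hB, hg1, hl1] with z h1 h2 h3 h4
      rw [h1, h2, h3, h4]
      simp only [blowChart]
      constructor <;> ring
  refine ⟨_, _, _, hbl, ?_⟩
  have hBl := HasLinearPart.fst_mul hl
  rw [hl0] at hBl
  by_cases hb0 : b₁ + b₂ * t = 0
  · rcases eq_or_ne t 0 with rfl | ht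
    · refine hbl.isolatedForm.resolvable_of_corner (a := fun z => g z + l z) (hg.fun_add hl) hl
        (Eventually.of_forall fun z => by ring) (Eventually.of_forall fun z => rfl) (.inl ?_)
      simp only [mul_zero, add_zero] at hb0
      simp only [hg0, hl0, mul_zero, add_zero, hb0]
      intro h1
      exact h0 (by rw [h1, hb0]; ring)
    · refine .regular (.inl ?_)
      simp only [hg0, hl0, hb0, Prod.snd_zero, add_zero]
      refine mul_ne_zero ht fun h1 => h0 ?_
      linear_combination b₂ * h1 - a₂ * hb0
  · exact hbl.isolatedForm.resolvable_of_right_linear hBl hb0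

/-- The form `y a dx + x b dy` at a corner, when `a = b = 0` is a transversal intersection at the
origin. -/
theorem IsolatedForm.resolvable_of_transversal_corner {A B a b : ℂ × ℂ → ℂ} (h : IsolatedForm A B)
    {a₁ a₂ b₁ b₂ : ℂ} (ha : HasLinearPart a a₁ a₂)
    (hb : HasLinearPart b b₁ b₂) (hA : ∀ᶠ z in 𝓝 0, A z = z.2 * a z)
    (hB : ∀ᶠ z in 𝓝 0, B z = z.1 * b z) (h0 : a₁ * b₂ ≠ a₂ * b₁) : Resolvable A B :=
  .of_blowUp (corner_blowUp ha hb h hA hB h0)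
    (corner_blowUp hb.swap ha.swap h.swap (tendsto_swap.eventually hB) (tendsto_swap.eventually hA)
      (fun h1 => h0 (by linear_combination h1)) 0)

/-- The form `α dx + x y β dy` with `β` a unit. The order of `α` along the axis `y = 0` decreases
under blow-up. The coefficient of `y²` in `α(0, y)` is a positive multiple of `β(0)`, which rules
out dicritical components. -/
theorem IsolatedForm.resolvable_of_nilpotent_transform (m : ℕ) {A B β : ℂ × ℂ → ℂ}
    (h : IsolatedForm A B) (hβ : AnalyticAt ℂ β 0) (hβ0 : β 0 ≠ 0)
    (hB : ∀ᶠ z in 𝓝 0, B z = z.1 * z.2 * β z)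
    (hm : analyticOrderAt (fun x => A (x, 0)) 0 ≤ m) {n : ℕ} {c₀ c₁ : ℂ}
    (hc : ∀ᶠ y in 𝓝 (0 : ℂ), A (0, y) = c₀ + c₁ * y + (n + 1) * β 0 * y ^ 2) : Resolvable A B := by
  induction m using Nat.strong_induction_on generalizing A B β n c₀ c₁ with
  | _ m ih =>
  by_cases hA0 : A 0 = 0
  swap
  · exact .regular (.inl hA0)
  have hxβ : AnalyticAt ℂ (fun z : ℂ × ℂ => z.2 * β z) 0 := by fun_prop
  have hBl : HasLinearPart B 0 0 := by
    have := HasLinearPart.fst_mul hxβ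
    simp only [Prod.snd_zero, zero_mul] at this
    exact this.congr (hB.mono fun z hz => by rw [hz]; ring)
  obtain ⟨e, f, hAl⟩ := HasLinearPart.exists_of h.left hA0
  -- `e x + f y` is the linear part of `α`
  rcases ne_or_eq f 0 with hf | rfl
  · exact h.resolvable_of_not_nilpotent hAl hBl (.inl hf.symm)
  rcases ne_or_eq e 0 with he | rfl
  · refine .of_blowUp (fun t => ?_) ?_
    · obtain ⟨A', B', h1, h2, -, -⟩ := exists_blowUp_linear h hAl hBl (.inl he) t
      exact ⟨_, _, _, h1, .regular (.inl (by rw [h2]; simpa using he))⟩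
    · -- at infinity, a corner whose two branches are transversal
      have hq : AnalyticAt ℂ (fun z : ℂ × ℂ => A z.swap) 0 := analyticAt_comp_swap h.left
      obtain ⟨l, hl, hl1, hl2⟩ := hAl.swap.exists_blowChart 0
      have hl0 : l 0 = 0 := hl2.self_of_nhds.trans (by simp)
      obtain ⟨p, q, hlp⟩ := HasLinearPart.exists_of hl hl0
      have hq : q = e := by
        have hd1 : HasDerivAt (fun s : ℂ => l (0, s)) (fderiv ℂ l 0 (0, 1)) 0 :=
          HasFDerivAt.comp_hasDerivAt (f := fun s : ℂ => ((0 : ℂ), s)) (0 : ℂ)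
            hl.differentiableAt.hasFDerivAt ((hasDerivAt_const _ _).prodMk (hasDerivAt_id _))
        have hd2 : HasDerivAt (fun s : ℂ => e * s) e 0 := by
          simpa using (hasDerivAt_id (0 : ℂ)).const_mul e
        have h3 := (hd1.congr_of_eventuallyEq (hl2.mono fun s h => by
          simpa using h.symm)).unique hd2
        rw [← h3, hlp.hasFDerivAt.fderiv]; simp
      subst hq
      have hβ' : AnalyticAt ℂ (fun z : ℂ × ℂ => β (blowChart 0 z).swap) 0 :=
        analyticAt_comp_blowChart (A := fun z => β z.swap) (analyticAt_comp_swap hβ) 0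
      have ha : HasLinearPart (fun z => z.1 * β (blowChart 0 z).swap + l z) (β 0 + p) q := by
        have h3 := HasLinearPart.fst_mul hβ'
        refine ⟨h3.1.fun_add hlp.1, (h3.2.add hlp.2).congr (Eventually.of_forall fun z => ?_)⟩
        simp only [blowChart_zero, Prod.swap_zero]
        ring
      have hbl : IsBlowUpForm 1 0 (fun z => B z.swap) (fun z => A z.swap)
          (fun z => z.2 * (z.1 * β (blowChart 0 z).swap + l z)) (fun z => z.1 * l z) := by
        refine isBlowUpForm_of_not_eventually h.swap (analyticAt_snd.mul ha.1)
          (analyticAt_fst.mul hl) (fun hcon => ?_) ?_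
        · refine not_eventually_quadratic (a := 0) (b := 0) (c := q) (.inr (.inr he)) 0 ?_
          filter_upwards [hcon, hl2] with s h1 h2
          have h4 := h1.1
          simp only [h2] at h4
          linear_combination h4
        · have ht := tendsto_blowChart 0
          filter_upwards [ht.eventually (tendsto_swap.eventually hB), hl1] with z h1 h2
          rw [h1, h2]
          simp only [blowChart, Prod.fst_swap, Prod.snd_swap]
          constructor <;> ring
      refine ⟨_, _, _, hbl, hbl.isolatedForm.resolvable_of_transversal_corner ha hlp
        (Eventually.of_forall fun z => rfl) (Eventually.of_forall fun z => rfl) fun h3 => ?_⟩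
      exact mul_ne_zero hβ0 he (by linear_combination h3)
  · -- `α` has order at least two
    have hA2 : OrdGE 2 A := by simpa using hAl.2
    obtain ⟨d₀, d₁, d₂, hd, -, hbc⟩ := exists_blowChart_sq h.left hA2
    have hc₀ : c₀ = 0 := by
      have := hc.self_of_nhds
      simp only [mul_zero, add_zero, zero_pow two_ne_zero] at this
      rw [← this]; exact hA0
    have hc₁ : c₁ = 0 := by
      have hd1 : HasDerivAt (fun s : ℂ => A (0, s)) (fderiv ℂ A 0 (0, 1)) 0 :=
        HasFDerivAt.comp_hasDerivAt (f := fun s : ℂ => ((0 : ℂ), s)) (0 : ℂ)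
          h.left.differentiableAt.hasFDerivAt ((hasDerivAt_const _ _).prodMk (hasDerivAt_id _))
      have hd2 : HasDerivAt (fun y : ℂ => c₀ + c₁ * y + (n + 1) * β 0 * y ^ 2) c₁ 0 := by
        have h3 := (((hasDerivAt_id (0 : ℂ)).const_mul c₁).const_add c₀).fun_add
          (((hasDerivAt_id (0 : ℂ)).fun_pow 2).const_mul ((n + 1) * β 0))
        exact h3.congr_deriv (by simp)
      have h3 := (hd1.congr_of_eventuallyEq (hc.mono fun s h => h.symm)).unique hd2
      rw [← h3, hAl.hasFDerivAt.fderiv]; simp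
    have hd₂ : d₂ = (n + 1) * β 0 := hd _ (by
      filter_upwards [hc] with y hy
      rw [hy, hc₀, hc₁]; ring)
    have hn : ((n : ℂ) + 1 + 1) * β 0 ≠ 0 :=
      mul_ne_zero (by exact_mod_cast (n + 1).succ_ne_zero) hβ0
    have hb0 : ∀ t s : ℂ, blowChart t (0, s) = 0 := fun t s => by simp [blowChart]
    refine .of_blowUp (fun t => ?_) ?_
    · obtain ⟨g, hg, hg1, hg2⟩ := hbc t
      obtain ⟨b, hb, hbe⟩ : ∃ b : ℂ × ℂ → ℂ, AnalyticAt ℂ b 0 ∧ ∀ z, b z = β (blowChart t z) :=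
        ⟨_, analyticAt_comp_blowChart hβ t, fun z => rfl⟩
      have hbe0 : ∀ s, b (0, s) = β 0 := fun s => by rw [hbe, hb0]
      have hbl : IsBlowUpForm 2 t A B (fun z => g z + (t + z.2) ^ 2 * b z)
          (fun z => z.1 * ((t + z.2) * b z)) := by
        refine isBlowUpForm_of_not_eventually h (by fun_prop) (by fun_prop) (fun hcon => ?_) ?_
        · refine not_eventually_quadratic (a := d₀) (b := d₁) (c := (n + 1 + 1) * β 0)
            (.inr (.inr hn)) t ?_
          filter_upwards [hcon, hg2] with s h1 h2
          have h4 := h1.1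
          simp only [h2, hd₂, hbe0] at h4
          linear_combination h4
        · filter_upwards [(tendsto_blowChart t).eventually hB, hg1] with z h1 h2
          rw [h1, h2, hbe]
          simp only [blowChart]
          constructor <;> ring
      refine ⟨_, _, _, hbl, ?_⟩
      rcases ne_or_eq t 0 with ht | rfl
      · have h3 := HasLinearPart.fst_mul (l := fun z : ℂ × ℂ => (t + z.2) * b z) (by fun_prop)
        refine hbl.isolatedForm.resolvable_of_right_linear h3 ?_
        exact mul_ne_zero (by simpa using ht) ((hbe0 0).trans_ne hβ0)
      · -- at the slope `0` the shape of the form persists, and the order along the axis drops by two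
        have htx : Tendsto (fun x : ℂ => (x, (0 : ℂ))) (𝓝 0) (𝓝 (0 : ℂ × ℂ)) :=
          (by fun_prop : Continuous fun x : ℂ => (x, (0 : ℂ))).tendsto' _ _ rfl
        have hgx : AnalyticAt ℂ (fun x : ℂ => g (x, 0)) 0 :=
          AnalyticAt.fun_comp (g := g) (f := fun x : ℂ => (x, (0 : ℂ))) (x := 0) hg (by fun_prop)
        have h3 : analyticOrderAt (fun x => A (x, 0)) 0 =
            2 + analyticOrderAt (fun x => g (x, 0)) 0 := by
          have := analyticOrderAt_pow_mul hgx 2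
          push_cast at this
          rw [← this]
          refine analyticOrderAt_congr ?_
          filter_upwards [htx.eventually hg1] with x hx
          simpa [blowChart] using hx
        rw [h3] at hm
        have hne : analyticOrderAt (fun x => g (x, 0)) 0 ≠ ⊤ := by
          intro h4
          rw [h4] at hm
          simp at hm
        obtain ⟨j, hj⟩ := ENat.ne_top_iff_exists.1 hne
        rw [← hj] at hm
        have hj' : 2 + j ≤ m := by exact_mod_cast hm
        have hb00 : b 0 = β 0 := hbe0 0
        refine ih j (by omega) hbl.isolatedForm hb (hb00.trans_ne hβ0)
          (Eventually.of_forall fun z => by ring) ?_ (n := n + 1) (c₀ := d₀) (c₁ := d₁) ?_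
        · simpa using hj.ge
        · filter_upwards [hg2] with s hs
          simp only [hs, hd₂, hbe0, hb00]
          push_cast
          ring
    · -- at infinity, a corner
      obtain ⟨e₀, e₁, e₂, -, he, hbc'⟩ := exists_blowChart_sq (analyticAt_comp_swap h.left) hA2.swap
      have he₀ : e₀ = (n + 1) * β 0 := he _ (by
        filter_upwards [hc] with y hy
        simp only [Prod.swap_prod_mk]
        rw [hy, hc₀, hc₁]; ring)
      obtain ⟨g, hg, hg1, hg2⟩ := hbc' 0
      obtain ⟨b, hb, hbe⟩ : ∃ b : ℂ × ℂ → ℂ, AnalyticAt ℂ b 0 ∧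
          ∀ z, b z = β (blowChart 0 z).swap :=
        ⟨_, analyticAt_comp_blowChart (A := fun z => β z.swap) (analyticAt_comp_swap hβ) 0,
          fun z => rfl⟩
      have hg0 : g 0 = (n + 1) * β 0 := hg2.self_of_nhds.trans (by simp [he₀])
      have hn' : g 0 ≠ 0 := by
        rw [hg0]
        exact mul_ne_zero (by exact_mod_cast n.succ_ne_zero) hβ0
      have hbe0 : b 0 = β 0 := by rw [hbe]; simp
      have hs0 : b 0 + g 0 ≠ 0 := by
        rw [hg0, hbe0]
        intro h1
        exact hn (by linear_combination h1)
      have hbl : IsBlowUpForm 2 0 (fun z => B z.swap) (fun z => A z.swap)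
          (fun z => z.2 * (b z + g z)) (fun z => z.1 * g z) := by
        refine isBlowUpForm_of_not_eventually h.swap (by fun_prop) (by fun_prop) (fun hcon => ?_) ?_
        · have h1 : ∀ᶠ s in 𝓝 (0 : ℂ), b (0, s) + g (0, s) ≠ 0 :=
            tendsto_prodMk_zero.eventually ((hb.fun_add hg).continuousAt.eventually_ne hs0)
          have h2 := ((hcon.and h1).filter_mono (nhdsWithin_le_nhds (s := {0}ᶜ))).and
            eventually_mem_nhdsWithin
          obtain ⟨s, ⟨h3, h4⟩, h5⟩ := h2.exists
          exact mul_ne_zero h5 h4 h3.1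
        · filter_upwards [(tendsto_blowChart 0).eventually (tendsto_swap.eventually hB), hg1]
            with z h1 h2
          rw [h1, h2, hbe]
          simp only [blowChart, Prod.fst_swap, Prod.snd_swap]
          constructor <;> ring
      exact ⟨_, _, _, hbl, hbl.isolatedForm.resolvable_of_corner (hb.fun_add hg) hg
        (Eventually.of_forall fun z => rfl) (Eventually.of_forall fun z => rfl) (.inr hn')⟩

/-- The form `h dx + y β dy` with `h` of order at least two and `β` a unit. The only singular point
of the blow-up is at the slope `0`. -/
theorem IsolatedForm.resolvable_of_nilpotent_normal {A B β : ℂ × ℂ → ℂ} (h : IsolatedForm A B)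
    (hA : HasLinearPart A 0 0) (hβ : AnalyticAt ℂ β 0) (hβ0 : β 0 ≠ 0)
    (hB : ∀ᶠ z in 𝓝 0, B z = z.2 * β z) : Resolvable A B := by
  have hBl : HasLinearPart B 0 (β 0) :=
    (HasLinearPart.snd_mul hβ).congr (hB.mono fun z hz => hz.symm)
  refine .of_blowUp (fun t => ?_) ?_
  · obtain ⟨g, hg, hg1, hg2⟩ := hA.exists_blowChart t
    obtain ⟨b, hb, hbe⟩ : ∃ b : ℂ × ℂ → ℂ, AnalyticAt ℂ b 0 ∧ ∀ z, b z = β (blowChart t z) :=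
      ⟨_, analyticAt_comp_blowChart hβ t, fun z => rfl⟩
    have hbt : ∀ s : ℂ, blowChart t (0, s) = 0 := fun s => by simp [blowChart]
    have hbe0 : ∀ s, b (0, s) = β 0 := fun s => by rw [hbe, hbt]
    have hA0 : ∀ᶠ s in 𝓝 (0 : ℂ), g (0, s) + (t + s) ^ 2 * b (0, s) = β 0 * (t + s) ^ 2 := by
      filter_upwards [hg2] with s hs
      rw [hs, hbe0]; ring
    have hbl : IsBlowUpForm 1 t A B (fun z => g z + (t + z.2) ^ 2 * b z)
        (fun z => z.1 * ((t + z.2) * b z)) := by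
      refine isBlowUpForm_of_not_eventually h (by fun_prop) (by fun_prop) (fun hcon => ?_) ?_
      · refine not_eventually_quadratic (a := 0) (b := 0) (c := β 0) (.inr (.inr hβ0)) t ?_
        filter_upwards [hcon, hA0] with s h1 h2
        rw [zero_add, zero_mul, zero_add, ← h2]
        exact h1.1
      · filter_upwards [(tendsto_blowChart t).eventually hB, hg1] with z h1 h2
        rw [h1, h2, hbe]
        simp only [blowChart]
        constructor <;> ring
    refine ⟨_, _, _, hbl, ?_⟩
    rcases ne_or_eq t 0 with ht | rfl
    · refine .regular (.inl ?_)
      have h3 := hA0.self_of_nhds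
      rw [add_zero] at h3
      have h4 : g 0 + (t + (0 : ℂ × ℂ).2) ^ 2 * b 0 = β 0 * t ^ 2 := by
        rw [Prod.snd_zero, add_zero]; exact h3
      rw [h4]
      exact mul_ne_zero hβ0 (pow_ne_zero _ ht)
    · have hne : analyticOrderAt (fun x : ℂ => g (x, 0) + (0 + 0) ^ 2 * b (x, 0)) 0 ≠ ⊤ := by
        intro h1
        rw [analyticOrderAt_eq_top] at h1
        have htx : Tendsto (fun x : ℂ => (x, (0 : ℂ))) (𝓝 0) (𝓝 (0 : ℂ × ℂ)) :=
          (by fun_prop : Continuous fun x : ℂ => (x, (0 : ℂ))).tendsto' _ _ rfl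
        have h2 := ((h1.and (htx.eventually hbl.isolatedForm.isolated)).filter_mono
          (nhdsWithin_le_nhds (s := {0}ᶜ))).and eventually_mem_nhdsWithin
        obtain ⟨x, ⟨h3, h4⟩, h5⟩ := h2.exists
        exact h5 (Prod.mk_eq_zero.1 (h4 h3 (by simp))).1
      obtain ⟨j, hj⟩ := ENat.ne_top_iff_exists.1 hne
      have hb00 : b 0 = β 0 := hbe0 0
      refine hbl.isolatedForm.resolvable_of_nilpotent_transform j hb (hb00.trans_ne hβ0)
        (Eventually.of_forall fun z => by ring) hj.ge (n := 0) (c₀ := 0) (c₁ := 0) ?_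
      filter_upwards [hA0] with s hs
      rw [hs, hb00]
      simp
  · obtain ⟨A', B', h1, h2, -, -⟩ := exists_blowUp_linear h.swap hBl.swap hA.swap (.inl hβ0) 0
    exact ⟨_, _, _, h1, .regular (.inl (by rw [h2]; simpa using hβ0))⟩

/-- The nilpotent linear part `b y dy` with `b ≠ 0`: the smooth curve `B = 0` is straightened to
`y = 0`. -/
theorem IsolatedForm.resolvable_of_nilpotent_of_ne {A B : ℂ × ℂ → ℂ} (h : IsolatedForm A B)
    {b : ℂ} (hA : HasLinearPart A 0 0) (hB : HasLinearPart B 0 b) (hb : b ≠ 0) :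
    Resolvable A B := by
  have hd : fderiv ℂ B 0 (0, 1) ≠ 0 := by rw [hB.hasFDerivAt.fderiv]; simpa using hb
  obtain ⟨k, hk, hk0, hk1⟩ := exists_implicit h.right hB.apply_zero hd
  have hk' : deriv k 0 = 0 := by
    have h1 : HasFDerivAt B
        ((0 : ℂ) • ContinuousLinearMap.fst ℂ ℂ ℂ + b • ContinuousLinearMap.snd ℂ ℂ ℂ)
        ((0 : ℂ), k 0) := by
      rw [hk0]; exact hB.hasFDerivAt
    have h2 : HasDerivAt (fun x => B (x, k x)) _ 0 :=
      h1.comp_hasDerivAt (0 : ℂ) ((hasDerivAt_id (0 : ℂ)).prodMk hk.differentiableAt.hasDerivAt)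
    have h3 := h2.unique ((hasDerivAt_const (0 : ℂ) (0 : ℂ)).congr_of_eventuallyEq hk1)
    simpa [hb] using h3
  obtain ⟨h3, h4, h5, h6⟩ := h.shear hk hk0 hA hB
  simp only [hk', mul_zero, zero_pow two_ne_zero, add_zero] at h3 h4
  obtain ⟨β, hβ, hβ1⟩ := exists_eq_snd_mul h4.1 (by
    filter_upwards [hk1] with x hx
    simpa using hx)
  exact h6 (h5.resolvable_of_nilpotent_normal h3 hβ
    ((h4.apply_zero_of_eq_snd_mul hβ hβ1).trans_ne hb) hβ1)

/-- A form whose linear part is not zero. A nilpotent linear part is brought to the form `b y dy` by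
a shear or an exchange of the coordinates. -/
theorem IsolatedForm.resolvable_of_linear {A B : ℂ × ℂ → ℂ} (h : IsolatedForm A B)
    {a₁ a₂ b₁ b₂ : ℂ} (hA : HasLinearPart A a₁ a₂) (hB : HasLinearPart B b₁ b₂)
    (h0 : (a₁ ≠ 0 ∨ a₂ ≠ 0) ∨ b₁ ≠ 0 ∨ b₂ ≠ 0) : Resolvable A B := by
  by_cases hn : b₁ ≠ a₂ ∨ a₁ * b₂ ≠ a₂ * b₁
  · exact h.resolvable_of_not_nilpotent hA hB hn
  push Not at hn
  obtain ⟨rfl, hn⟩ := hn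
  rcases ne_or_eq b₂ 0 with hb | rfl
  · have hk : AnalyticAt ℂ (fun x : ℂ => -b₁ / b₂ * x) 0 := by fun_prop
    have hd : deriv (fun x : ℂ => -b₁ / b₂ * x) 0 = -b₁ / b₂ := by
      simpa only [mul_one, id] using ((hasDerivAt_id (0 : ℂ)).const_mul (-b₁ / b₂)).deriv
    obtain ⟨h3, h4, h5, h6⟩ := h.shear hk (by simp) hA hB
    refine h6 (h5.resolvable_of_nilpotent_of_ne (b := b₂) ?_ ?_ hb)
    · convert h3 using 1 <;> rw [hd] <;> field_simp
      · linear_combination -hn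
      · ring
    · convert h4 using 1
      rw [hd]; field_simp; ring
  · have hb : b₁ = 0 := by simpa using hn.symm
    subst hb
    exact .of_swap h (h.swap.resolvable_of_nilpotent_of_ne hB.swap hA.swap (by simpa using h0))

/-! ### Contact of smooth arcs with an isolated singularity -/

theorem isBigO_pow_iff {f : ℂ → ℂ} (hf : AnalyticAt ℂ f 0) {n : ℕ} :
    (f =O[𝓝 0] fun x => x ^ n) ↔ n ≤ analyticOrderAt f 0 := by
  constructor
  · intro h
    by_contra! hlt
    obtain ⟨m, hm⟩ := ENat.ne_top_iff_exists.1 (ne_top_of_lt hlt)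
    rw [← hm] at hlt
    have hmn : m < n := by exact_mod_cast hlt
    obtain ⟨g, hg, hg0, hfg⟩ := (hf.analyticOrderAt_eq_natCast).1 hm.symm
    obtain ⟨C, hC⟩ := h.bound
    have h1 : ∀ᶠ x in 𝓝[≠] (0 : ℂ), ‖g x‖ ≤ C * ‖x‖ ^ (n - m) := by
      filter_upwards [(hC.and hfg).filter_mono nhdsWithin_le_nhds, eventually_mem_nhdsWithin]
        with x hx hx0
      obtain ⟨h2, h3⟩ := hx
      have h4 : 0 < ‖x‖ ^ m := pow_pos (norm_pos_iff.2 hx0) _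
      rw [h3, sub_zero, smul_eq_mul, norm_mul, norm_pow, norm_pow,
        ← Nat.add_sub_of_le hmn.le, pow_add] at h2
      exact le_of_mul_le_mul_left (h2.trans_eq (by ring)) h4
    have h2 : Tendsto (fun x : ℂ => C * ‖x‖ ^ (n - m)) (𝓝[≠] 0) (𝓝 0) := by
      refine Tendsto.mono_left (Continuous.tendsto' (by fun_prop) _ _ ?_) nhdsWithin_le_nhds
      simp [Nat.sub_ne_zero_of_lt hmn]
    have h3 := le_of_tendsto_of_tendsto (hg.continuousAt.norm.mono_left nhdsWithin_le_nhds) h2 h1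
    exact hg0 (norm_le_zero_iff.1 h3)
  · intro h
    obtain ⟨g, hg, hfg⟩ := (natCast_le_analyticOrderAt hf).1 h
    have h1 : (fun x => x ^ n * g x) =O[𝓝 0] fun x => x ^ n * (1 : ℂ) :=
      (Asymptotics.isBigO_refl _ _).mul (hg.continuousAt.isBigO_one ℂ)
    refine (h1.congr' ?_ (Eventually.of_forall fun x => mul_one _))
    filter_upwards [hfg] with x hx
    rw [hx]; simp

theorem isBigO_of_pow_mul {f : ℂ → ℂ} (hf : AnalyticAt ℂ f 0) {e n : ℕ}
    (h : (fun x => x ^ e * f x) =O[𝓝 0] fun x => x ^ (e + n)) : f =O[𝓝 0] fun x => x ^ n := by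
  rw [isBigO_pow_iff (by fun_prop), analyticOrderAt_pow_mul hf] at h
  rw [isBigO_pow_iff hf]
  push_cast at h
  exact (ENat.add_le_add_iff_left (ENat.natCast_ne_top e)).1 h

theorem isBigO_pow_of_le {m n : ℕ} (h : m ≤ n) :
    (fun x : ℂ => x ^ n) =O[𝓝 0] fun x => x ^ m := by
  rw [isBigO_pow_iff (by fun_prop)]
  have := analyticOrderAt_pow_mul (g := fun _ => 1) analyticAt_const n
  simp only [mul_one] at this
  rw [this]
  exact le_add_right (by exact_mod_cast h)

theorem analyticAt_comp_graph {F : ℂ × ℂ → ℂ} {φ : ℂ → ℂ} (hF : AnalyticAt ℂ F 0)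
    (hφ : AnalyticAt ℂ φ 0) (h0 : φ 0 = 0) : AnalyticAt ℂ (fun x => F (x, φ x)) 0 :=
  AnalyticAt.fun_comp (g := F) (f := fun x => (x, φ x)) (x := 0)
    (by rw [h0]; exact hF) (analyticAt_id.prod hφ)

/-- No smooth arc `y = φ(x)` through the origin has contact of order greater than `N` with both
`F = 0` and `G = 0`. -/
def ContactBound (N : ℕ) (F G : ℂ × ℂ → ℂ) : Prop :=
  ∀ φ : ℂ → ℂ, AnalyticAt ℂ φ 0 → φ 0 = 0 →
    ¬ ((fun x => F (x, φ x)) =O[𝓝 0] (fun x => x ^ (N + 1)) ∧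
      (fun x => G (x, φ x)) =O[𝓝 0] fun x => x ^ (N + 1))

theorem ContactBound.symm {N : ℕ} {F G : ℂ × ℂ → ℂ} (h : ContactBound N F G) :
    ContactBound N G F := fun φ hφ hφ0 h1 => h φ hφ hφ0 h1.symm

/-- If the contact of smooth arcs is bounded at each point of the exceptional divisor, it is bounded:
only the finitely many points of the divisor on the strict transform of `F = 0` matter. -/
theorem exists_contactBound_of_blowChart {F G : ℂ × ℂ → ℂ} {F' : ℂ → ℂ × ℂ → ℂ} {e : ℕ}
    (hF' : ∀ t, AnalyticAt ℂ (F' t) 0)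
    (hFF' : ∀ t, ∀ᶠ z in 𝓝 0, F (blowChart t z) = z.1 ^ e * F' t z) {S : Set ℂ} (hS : S.Finite)
    (hS' : ∀ t, t ∉ S → F' t 0 ≠ 0)
    (h : ∀ t, ∃ N, ContactBound N (F' t) fun z => G (blowChart t z)) :
    ∃ N, ContactBound N F G := by
  choose N hN using h
  refine ⟨e + ∑ t ∈ hS.toFinset, N t, fun φ hφ hφ0 hcon => ?_⟩
  obtain ⟨φ₁, hφ₁, hφ₁'⟩ := (natCast_le_analyticOrderAt hφ (n := 1)).1
    (by simpa [Order.one_le_iff_ne_zero, analyticOrderAt_ne_zero] using ⟨hφ, hφ0⟩)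
  set t := φ₁ 0 with ht
  have hψ : AnalyticAt ℂ (fun x => φ₁ x - t) 0 := by fun_prop
  have hψ0 : φ₁ 0 - t = 0 := by simp [ht]
  have hbc : ∀ᶠ x in 𝓝 (0 : ℂ), blowChart t (x, φ₁ x - t) = (x, φ x) := by
    filter_upwards [hφ₁'] with x hx
    simp [blowChart, hx, mul_comm]
  have hFx : ∀ᶠ x in 𝓝 (0 : ℂ), F (x, φ x) = x ^ e * F' t (x, φ₁ x - t) := by
    filter_upwards [hbc, (tendsto_graph hψ hψ0).eventually (hFF' t)] with x h1 h2
    rw [← h1, h2]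
  have hF'x := analyticAt_comp_graph (hF' t) hψ hψ0
  by_cases hts : t ∈ S
  · have hle : N t ≤ ∑ t ∈ hS.toFinset, N t :=
      Finset.single_le_sum (fun _ _ => Nat.zero_le _) (hS.mem_toFinset.2 hts)
    refine hN t _ hψ hψ0 ⟨?_, ?_⟩
    · refine (isBigO_of_pow_mul hF'x (e := e) (n := (∑ t ∈ hS.toFinset, N t) + 1) ?_).trans
        (isBigO_pow_of_le (by omega))
      exact hcon.1.congr' hFx (by rw [add_assoc])
    · refine (hcon.2.congr' ?_ EventuallyEq.rfl).trans (isBigO_pow_of_le (by omega))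
      filter_upwards [hbc] with x hx
      rw [hx]
  · have h1 : (fun x => F' t (x, φ₁ x - t)) =O[𝓝 0] fun x => x ^ 1 :=
      (isBigO_of_pow_mul hF'x (e := e) (n := (∑ t ∈ hS.toFinset, N t) + 1)
        (hcon.1.congr' hFx (by rw [add_assoc]))).trans (isBigO_pow_of_le (by omega))
    rw [isBigO_pow_iff hF'x, Nat.cast_one, Order.one_le_iff_ne_zero, analyticOrderAt_ne_zero] at h1
    refine hS' t hts ?_
    have h2 := h1.2
    rw [hψ0] at h2
    exact h2

/-- The partial derivative with respect to the second variable. -/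
noncomputable def dSnd (F : ℂ × ℂ → ℂ) : ℂ × ℂ → ℂ := fun z => deriv (fun y => F (z.1, y)) z.2

theorem iterate_dSnd (j : ℕ) (F : ℂ × ℂ → ℂ) (x : ℂ) :
    (fun y => dSnd^[j] F (x, y)) = deriv^[j] fun y => F (x, y) := by
  induction j generalizing F with
  | zero => rfl
  | succ j ih => rw [Function.iterate_succ_apply, Function.iterate_succ_apply, ih]; rfl

theorem dSnd_eq {F : ℂ × ℂ → ℂ} {z : ℂ × ℂ} (hF : DifferentiableAt ℂ F z) :
    dSnd F z = fderiv ℂ F z (0, 1) := by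
  have h : HasDerivAt (fun y => F (z.1, y)) (fderiv ℂ F z (0, 1)) z.2 :=
    HasFDerivAt.comp_hasDerivAt (f := fun y : ℂ => (z.1, y)) z.2 hF.hasFDerivAt
      ((hasDerivAt_const _ _).prodMk (hasDerivAt_id _))
  exact h.deriv

theorem analyticAt_iterate_dSnd {F : ℂ × ℂ → ℂ} (hF : AnalyticAt ℂ F 0) (j : ℕ) :
    AnalyticAt ℂ (dSnd^[j] F) 0 := by
  induction j generalizing F with
  | zero => exact hF
  | succ j ih =>
    rw [Function.iterate_succ_apply]
    have h1 : AnalyticAt ℂ (fun z => fderiv ℂ F z (0, 1)) 0 :=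
      ((ContinuousLinearMap.apply ℂ ℂ ((0 : ℂ), (1 : ℂ))).analyticAt _).comp hF.fderiv
    refine ih (h1.congr ?_)
    filter_upwards [hF.eventually_analyticAt] with z hz
    exact (dSnd_eq hz.differentiableAt).symm

theorem iterate_dSnd_congr {F G : ℂ × ℂ → ℂ} (h : ∀ᶠ z in 𝓝 0, F z = G z) (j : ℕ) :
    ∀ᶠ z in 𝓝 0, dSnd^[j] F z = dSnd^[j] G z := by
  induction j generalizing F G with
  | zero => exact h
  | succ j ih =>
    simp only [Function.iterate_succ_apply]
    refine ih ?_
    filter_upwards [h.eventually_nhds] with z hz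
    have ht : Tendsto (fun y : ℂ => (z.1, y)) (𝓝 z.2) (𝓝 z) :=
      (by fun_prop : Continuous fun y : ℂ => (z.1, y)).tendsto' _ _ rfl
    exact EventuallyEq.deriv_eq (ht.eventually hz)

theorem iterate_dSnd_comp (F : ℂ × ℂ → ℂ) (c p q : ℂ → ℂ) (j : ℕ) (z : ℂ × ℂ) :
    dSnd^[j] (fun z => c z.1 * F (z.1, p z.1 + q z.1 * z.2)) z =
      c z.1 * (q z.1 ^ j * dSnd^[j] F (z.1, p z.1 + q z.1 * z.2)) := by
  induction j generalizing F c with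
  | zero => simp
  | succ j ih =>
    rw [Function.iterate_succ_apply, Function.iterate_succ_apply]
    have : dSnd (fun z => c z.1 * F (z.1, p z.1 + q z.1 * z.2)) =
        fun z => (c z.1 * q z.1) * dSnd F (z.1, p z.1 + q z.1 * z.2) := by
      funext z
      have h1 := deriv_comp_mul_left (q z.1) (fun y => F (z.1, p z.1 + y)) z.2
      have h2 := deriv_comp_const_add (f := fun y => F (z.1, y)) (p z.1) (q z.1 * z.2)
      simp only [dSnd]
      rw [deriv_const_mul_field, h1, h2]
      simp [mul_assoc]
    rw [this, ih (dSnd F) fun x => c x * q x]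
    ring

/-- The chain rule for the derivatives with respect to `y` in the chart of a blow-up. -/
theorem iterate_dSnd_blowChart {F F' : ℂ × ℂ → ℂ} {e : ℕ} {t : ℂ}
    (h : ∀ᶠ z in 𝓝 0, F (blowChart t z) = z.1 ^ e * F' z) (j : ℕ) :
    ∀ᶠ z in 𝓝 0, z.1 ^ j * dSnd^[j] F (blowChart t z) = z.1 ^ e * dSnd^[j] F' z := by
  have hb : ∀ z, blowChart t z = (z.1, t * z.1 + z.1 * z.2) := fun z => by
    simp only [blowChart]; ring_nf
  filter_upwards [iterate_dSnd_congr h j] with z hz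
  have h1 := iterate_dSnd_comp F (fun _ => 1) (fun x => t * x) (fun x => x) j z
  have h2 := iterate_dSnd_comp F' (fun x => x ^ e) (fun _ => 0) (fun _ => 1) j z
  simp only [one_mul, zero_add, one_pow] at h1 h2
  simp only [hb] at hz ⊢
  rw [← h1, ← h2, hz]

/-- A function whose derivatives with respect to `y` of order less than `d` vanish on the axis
`y = 0` is divisible by `y ^ d`. -/
theorem exists_eq_snd_pow_mul {F : ℂ × ℂ → ℂ} (hF : AnalyticAt ℂ F 0) (d : ℕ)
    (h : ∀ j < d, ∀ᶠ x in 𝓝 (0 : ℂ), dSnd^[j] F (x, 0) = 0) :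
    ∃ u, AnalyticAt ℂ u 0 ∧ ∀ᶠ z in 𝓝 0, F z = z.2 ^ d * u z := by
  induction d with
  | zero => exact ⟨F, hF, by simp⟩
  | succ d ih =>
    obtain ⟨u, hu, hu1⟩ := ih fun j hj => h j (by omega)
    have htx : Tendsto (fun x : ℂ => (x, (0 : ℂ))) (𝓝 0) (𝓝 (0 : ℂ × ℂ)) :=
      (by fun_prop : Continuous fun x : ℂ => (x, (0 : ℂ))).tendsto' _ _ rfl
    have hall : ∀ᶠ x in 𝓝 (0 : ℂ), ∀ j ∈ Finset.range (d + 1), dSnd^[j] F (x, 0) = 0 :=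
      (Finset.eventually_all _).2 fun j hj => h j (Finset.mem_range.1 hj)
    obtain ⟨u', hu', hu1'⟩ := exists_eq_snd_mul hu (by
      filter_upwards [hall, htx.eventually hu1.eventually_nhds,
        htx.eventually hF.eventually_analyticAt, htx.eventually hu.eventually_analyticAt]
        with x h1 h2 h3 h4
      have ht : Tendsto (fun y : ℂ => (x, y)) (𝓝 0) (𝓝 (x, 0)) :=
        (by fun_prop : Continuous fun y : ℂ => (x, y)).tendsto' _ _ rfl
      have h3' : AnalyticAt ℂ (fun y => F (x, y)) 0 :=
        AnalyticAt.fun_comp (g := F) (f := fun y : ℂ => (x, y)) h3 (by fun_prop)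
      have h4' : AnalyticAt ℂ (fun y => u (x, y)) 0 :=
        AnalyticAt.fun_comp (g := u) (f := fun y : ℂ => (x, y)) h4 (by fun_prop)
      have h5 : ((d + 1 : ℕ) : ℕ∞) ≤ analyticOrderAt (fun y => F (x, y)) 0 := by
        rw [natCast_le_analyticOrderAt_iff_iteratedDeriv_eq_zero h3']
        intro i hi
        rw [iteratedDeriv_eq_iterate, ← iterate_dSnd]
        exact h1 i (Finset.mem_range.2 hi)
      have h6 : analyticOrderAt (fun y => F (x, y)) 0 =
          d + analyticOrderAt (fun y => u (x, y)) 0 := by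
        rw [← analyticOrderAt_pow_mul h4']
        exact analyticOrderAt_congr (ht.eventually h2)
      rw [h6, Nat.cast_add, ENat.add_le_add_iff_left (ENat.natCast_ne_top d), Nat.cast_one,
        Order.one_le_iff_ne_zero, analyticOrderAt_ne_zero] at h5
      exact h5.2)
    refine ⟨u', hu', ?_⟩
    filter_upwards [hu1, hu1'] with z h1 h2
    rw [h1, h2]; ring

/-- The case in which `F` vanishes to order `d` along the whole axis `y = 0`. -/
theorem exists_contactBound_of_pow {F G u : ℂ × ℂ → ℂ} {d : ℕ} (hG : AnalyticAt ℂ G 0)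
    (hu : AnalyticAt ℂ u 0) (hu0 : u 0 ≠ 0) (hF : ∀ᶠ z in 𝓝 0, F z = z.2 ^ d * u z)
    (hd : d ≠ 0) (hZ : ∀ᶠ z in 𝓝 0, F z = 0 → G z = 0 → z.1 = 0) :
    ∃ N, ContactBound N F G := by
  have htx : Tendsto (fun x : ℂ => (x, (0 : ℂ))) (𝓝 0) (𝓝 (0 : ℂ × ℂ)) :=
    (by fun_prop : Continuous fun x : ℂ => (x, (0 : ℂ))).tendsto' _ _ rfl
  have hGx : AnalyticAt ℂ (fun x : ℂ => G (x, 0)) 0 :=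
    AnalyticAt.fun_comp (g := G) (f := fun x : ℂ => (x, (0 : ℂ))) (x := 0) hG (by fun_prop)
  have hne : analyticOrderAt (fun x : ℂ => G (x, 0)) 0 ≠ ⊤ := by
    intro h1
    rw [analyticOrderAt_eq_top] at h1
    have h2 := ((h1.and ((htx.eventually hZ).and (htx.eventually hF))).filter_mono
      (nhdsWithin_le_nhds (s := {0}ᶜ))).and eventually_mem_nhdsWithin
    obtain ⟨x, ⟨h3, h4, h5⟩, h6⟩ := h2.exists
    exact h6 (h4 (by rw [h5]; simp [hd]) h3)
  obtain ⟨M, hM⟩ := ENat.ne_top_iff_exists.1 hne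
  refine ⟨d * (M + 1), fun φ hφ hφ0 hcon => ?_⟩
  have hφM : φ =O[𝓝 0] fun x => x ^ (M + 1) := by
    have hux := analyticAt_comp_graph hu hφ hφ0
    have h1 : analyticOrderAt (fun x => F (x, φ x)) 0 = d • analyticOrderAt φ 0 := by
      have h2 : analyticOrderAt (fun x => u (x, φ x)) 0 = 0 := by
        rw [hux.analyticOrderAt_eq_zero, hφ0]
        exact hu0
      rw [← analyticOrderAt_pow hφ, ← add_zero (analyticOrderAt (φ ^ d) 0), ← h2,
        ← analyticOrderAt_mul (hφ.pow d) hux]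
      exact analyticOrderAt_congr ((tendsto_graph hφ hφ0).eventually hF)
    have hFx : AnalyticAt ℂ (fun x => F (x, φ x)) 0 :=
      ((hφ.pow d).mul hux).congr
        (((tendsto_graph hφ hφ0).eventually hF).mono fun x hx => hx.symm)
    have h2 := (isBigO_pow_iff hFx).1 hcon.1
    rw [h1] at h2
    rw [isBigO_pow_iff hφ]
    by_contra! hlt
    obtain ⟨m, hm⟩ := ENat.ne_top_iff_exists.1 (ne_top_of_lt hlt)
    rw [← hm] at hlt h2
    have h3 : m < M + 1 := by exact_mod_cast hlt
    have h4 : d * (M + 1) + 1 ≤ d * m := by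
      rw [nsmul_eq_mul] at h2
      exact_mod_cast h2
    have h5 : d * m ≤ d * (M + 1) := Nat.mul_le_mul_left _ h3.le
    omega
  have hG0 : AnalyticAt ℂ (fun z : ℂ × ℂ => G z - G (z.1, 0)) 0 :=
    hG.fun_sub (AnalyticAt.fun_comp (g := fun x : ℂ => G (x, 0)) (f := fun z : ℂ × ℂ => z.1)
      (x := 0) hGx analyticAt_fst)
  obtain ⟨g, hg, hg1⟩ := exists_eq_snd_mul hG0 (Eventually.of_forall fun x => by simp)
  have h1 : (fun x => G (x, φ x) - G (x, 0)) =O[𝓝 0] fun x => x ^ (M + 1) := by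
    have h2 : (fun x => φ x * g (x, φ x)) =O[𝓝 0] fun x => x ^ (M + 1) * (1 : ℂ) :=
      hφM.mul ((analyticAt_comp_graph hg hφ hφ0).continuousAt.isBigO_one ℂ)
    refine h2.congr' ?_ (Eventually.of_forall fun x => mul_one _)
    filter_upwards [(tendsto_graph hφ hφ0).eventually hg1] with x hx
    exact hx.symm
  have h2 : (fun x => G (x, 0)) =O[𝓝 0] fun x => x ^ (M + 1) := by
    have h3 := (hcon.2.trans (isBigO_pow_of_le (m := M + 1) (n := d * (M + 1) + 1) (by
      have := Nat.le_mul_of_pos_left (M + 1) (Nat.pos_of_ne_zero hd)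
      omega))).sub h1
    simpa using h3
  rw [isBigO_pow_iff hGx, ← hM] at h2
  have : M + 1 ≤ M := by exact_mod_cast h2
  omega

theorem HasLinearPart.fderiv_snd {F : ℂ × ℂ → ℂ} {a b : ℂ} (h : HasLinearPart F a b) :
    fderiv ℂ F 0 (0, 1) = b := by
  rw [h.hasFDerivAt.fderiv]; simp

/-- If `F (0, y)` has a zero of order `d`, its `d`-th derivative is the first one that does not
vanish at the origin. -/
theorem apply_zero_eq_zero_of_order {F : ℂ × ℂ → ℂ} (hF : AnalyticAt ℂ F 0) {d j : ℕ}
    (hd : analyticOrderAt (fun y => F (0, y)) 0 = d) (hj : j ≤ d) (hd0 : d ≠ 0) :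
    dSnd^[j] F 0 = 0 ↔ j < d := by
  have h1 := analyticOrderAt_iterated_deriv (analyticAt_comp_mk_zero hF) hd.symm hd0 hj
  rw [← iterate_dSnd] at h1
  have h2 : analyticOrderAt (fun y => dSnd^[j] F (0, y)) 0 ≠ 0 ↔ dSnd^[j] F 0 = 0 := by
    rw [analyticOrderAt_ne_zero]
    exact ⟨fun h => h.2, fun h => ⟨analyticAt_comp_mk_zero (analyticAt_iterate_dSnd hF j), h⟩⟩
  rw [← h2, h1]
  simp only [ne_eq, Nat.cast_eq_zero]
  omega

/-- Induction on the order of `F` along the axis `x = 0`. When this order does not drop under the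
blow-up, the curve `∂^{d-1}F/∂y^{d-1} = 0` has maximal contact with `F = 0`; once it is
straightened to `y = 0`, only the point of slope `0` matters, and there the order of some
coefficient `∂^jF/∂y^j (x, 0)` drops. -/
theorem exists_contactBound (d : ℕ) {F G : ℂ × ℂ → ℂ} (hF : AnalyticAt ℂ F 0)
    (hG : AnalyticAt ℂ G 0) (hd : analyticOrderAt (fun y => F (0, y)) 0 = d)
    (hZ : ∀ᶠ z in 𝓝 0, F z = 0 → G z = 0 → z.1 = 0) : ∃ N, ContactBound N F G := by
  induction d using Nat.strong_induction_on generalizing F G with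
  | _ d ih =>
  rcases eq_or_ne d 0 with rfl | hd0
  · refine ⟨0, fun φ hφ hφ0 hcon => ?_⟩
    have h1 := hcon.1
    rw [isBigO_pow_iff (analyticAt_comp_graph hF hφ hφ0)] at h1
    rw [Nat.cast_zero, (analyticAt_comp_mk_zero hF).analyticOrderAt_eq_zero] at hd
    rw [zero_add, Nat.cast_one, Order.one_le_iff_ne_zero, analyticOrderAt_ne_zero, hφ0] at h1
    exact hd h1.2
  have htx : Tendsto (fun x : ℂ => (x, (0 : ℂ))) (𝓝 0) (𝓝 (0 : ℂ × ℂ)) :=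
    (by fun_prop : Continuous fun x : ℂ => (x, (0 : ℂ))).tendsto' _ _ rfl
  -- the case of a straightened curve of maximal contact and a nonzero coefficient
  have inner : ∀ n j : ℕ, j < d → ∀ {F G : ℂ × ℂ → ℂ}, AnalyticAt ℂ F 0 → AnalyticAt ℂ G 0 →
      analyticOrderAt (fun y => F (0, y)) 0 = d →
      (∀ᶠ z in 𝓝 0, F z = 0 → G z = 0 → z.1 = 0) →
      (∀ᶠ x in 𝓝 (0 : ℂ), dSnd^[d - 1] F (x, 0) = 0) →
      analyticOrderAt (fun x => dSnd^[j] F (x, 0)) 0 = n → ∃ N, ContactBound N F G := by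
    intro n j hj
    induction n using Nat.strong_induction_on with
    | _ n ihn =>
    intro F G hF hG hd hZ hk hn
    -- `e` is the order of `F` at the origin
    obtain ⟨e, he, he'⟩ : ∃ e, OrdGE e F ∧ ¬ OrdGE (e + 1) F := by
      by_contra! hcon
      have hall : ∀ e, OrdGE e F := fun e => by
        induction e with
        | zero => exact OrdGE.of_continuousAt hF.continuousAt
        | succ e ihe => exact hcon e ihe
      have h1 := tendsto_prodMk_zero.eventually (OrdGE.eventually_eq_zero hF hall)
      rw [← analyticOrderAt_eq_top, hd] at h1
      exact ENat.natCast_ne_top d h1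
    have hed : e ≤ d := by
      have h1 := (isBigO_pow_iff (analyticAt_comp_mk_zero hF)).1 he.isBigO_axis
      rw [hd] at h1
      exact_mod_cast h1
    obtain ⟨c, hc⟩ := OrdGE.exists_leading hF he
    have hc0 : ∃ i ≤ e, c i ≠ 0 := by
      by_contra! hcon
      refine he' (hc.congr (Eventually.of_forall fun z => ?_))
      rw [Finset.sum_eq_zero fun i hi => by rw [hcon i (by simpa [Nat.lt_succ_iff] using hi)]; ring,
        sub_zero]
    choose F' hF' hFF' hFc using fun t => exists_blowChart_eq hF he hc t
    have hord : ∀ t, analyticOrderAt (fun s => F' t (0, s)) 0 ≤ e := fun t =>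
      analyticOrderAt_sum_le t hc0 (hFc t)
    refine exists_contactBound_of_blowChart hF' hFF' (S := {t | F' t 0 = 0}) ?_
      (fun t ht => ht) fun t => ?_
    · -- the points of the divisor on the strict transform are the roots of a polynomial
      have h1 : ∀ t, F' t 0 = ∑ i ∈ Finset.range (e + 1), c i * t ^ (e - i) := fun t =>
        (hFc t).self_of_nhds.trans (by simp)
      simp only [h1]
      have h2 : (∑ i ∈ Finset.range (e + 1),
          Polynomial.C (c i) * Polynomial.X ^ (e - i) : Polynomial ℂ) ≠ 0 := by
        intro h0
        have h3 := hord 0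
        rw [analyticOrderAt_eq_top.2] at h3
        · simp at h3
        · filter_upwards [hFc 0] with s hs
          have h4 := congrArg (Polynomial.eval s) h0
          rw [hs]
          simpa [Polynomial.eval_finsetSum] using h4
      refine (Polynomial.finite_setOfPred_isRoot h2).subset fun t ht => ?_
      simpa [Polynomial.IsRoot, Polynomial.eval_finsetSum] using ht
    · have hGb := analyticAt_comp_blowChart hG t
      have hZb : ∀ᶠ z in 𝓝 0, F' t z = 0 → G (blowChart t z) = 0 → z.1 = 0 := by
        filter_upwards [(tendsto_blowChart t).eventually hZ, hFF' t] with z h1 h2 h3 h4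
        exact h1 (by rw [h2, h3, mul_zero]) h4
      obtain ⟨d', hd'⟩ := ENat.ne_top_iff_exists.1 (ne_top_of_le_ne_top (ENat.natCast_ne_top e)
        (hord t))
      have hde : d' ≤ e := by
        have := hord t
        rw [← hd'] at this
        exact_mod_cast this
      rcases lt_or_eq_of_le (hde.trans hed) with hlt | rfl
      · exact ih d' hlt (hF' t) hGb hd'.symm hZb
      · obtain rfl : e = d' := le_antisymm hed hde
        -- maximal contact forces `t = 0`
        have hH := analyticAt_iterate_dSnd hF (e - 1)
        obtain ⟨h, hh, hh1⟩ := exists_eq_snd_mul hH hk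
        have hH' : ∀ᶠ z in 𝓝 0, dSnd^[e - 1] (F' t) z = (t + z.2) * h (blowChart t z) := by
          refine eventually_eq_of_mul (denseNe_fst_pow e) (analyticAt_iterate_dSnd (hF' t) _)
            ((analyticAt_const.add analyticAt_snd).mul (analyticAt_comp_blowChart hh t)) ?_
          filter_upwards [iterate_dSnd_blowChart (hFF' t) (e - 1),
            (tendsto_blowChart t).eventually hh1] with z h1 h2
          rw [← h1, h2]
          obtain ⟨m, rfl⟩ := Nat.exists_eq_succ_of_ne_zero hd0
          simp only [Nat.succ_eq_add_one, Nat.add_sub_cancel, blowChart]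
          ring
        have hh0 : h 0 ≠ 0 := by
          have h1 := ((HasLinearPart.snd_mul hh).congr (hh1.mono fun _ h => h.symm)).fderiv_snd
          rw [← h1, ← dSnd_eq hH.differentiableAt, ← Function.iterate_succ_apply' dSnd,
            Nat.succ_eq_add_one, Nat.sub_add_cancel (Nat.pos_of_ne_zero hd0), ne_eq,
            apply_zero_eq_zero_of_order hF hd le_rfl hd0]
          exact lt_irrefl _
        have ht0 : t = 0 := by
          have h1 := (apply_zero_eq_zero_of_order (hF' t) hd'.symm (j := e - 1) (by omega) hd0).2
            (by omega)
          rw [hH'.self_of_nhds] at h1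
          simpa [hh0] using h1
        subst ht0
        have hkey : ∀ᶠ x in 𝓝 (0 : ℂ),
            dSnd^[j] F (x, 0) = x ^ (e - j) * dSnd^[j] (F' 0) (x, 0) := by
          have hax : ∀ (P : ℂ × ℂ → ℂ), AnalyticAt ℂ P 0 →
              AnalyticAt ℂ (fun z : ℂ × ℂ => P (z.1, 0)) 0 := fun P hP =>
            AnalyticAt.fun_comp (g := P) (f := fun z : ℂ × ℂ => (z.1, (0 : ℂ))) (x := 0) hP
              (by fun_prop)
          have hFj := hax _ (analyticAt_iterate_dSnd hF j)
          have hFj' := hax _ (analyticAt_iterate_dSnd (hF' 0) j)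
          have hfst : Tendsto (fun z : ℂ × ℂ => (z.1, (0 : ℂ))) (𝓝 0) (𝓝 0) :=
            (by fun_prop : Continuous fun z : ℂ × ℂ => (z.1, (0 : ℂ))).tendsto' _ _ rfl
          have h1 := eventually_eq_of_mul (denseNe_fst_pow j) hFj
            (g := fun z => z.1 ^ (e - j) * dSnd^[j] (F' 0) (z.1, 0)) (by fun_prop) (by
              filter_upwards [hfst.eventually (iterate_dSnd_blowChart (hFF' 0) j)] with z h1
              have h2 : blowChart 0 (z.1, 0) = (z.1, 0) := by simp [blowChart]
              rw [h2] at h1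
              rw [h1, ← mul_assoc, ← pow_add, Nat.add_sub_of_le hj.le])
          exact htx.eventually h1
        have hF'x : AnalyticAt ℂ (fun x : ℂ => dSnd^[j] (F' 0) (x, 0)) 0 :=
          AnalyticAt.fun_comp (g := dSnd^[j] (F' 0)) (f := fun x : ℂ => (x, (0 : ℂ))) (x := 0)
            (analyticAt_iterate_dSnd (hF' 0) j) (by fun_prop)
        have hn' := hn
        rw [analyticOrderAt_congr hkey, analyticOrderAt_pow_mul hF'x] at hn'
        have hne : analyticOrderAt (fun x => dSnd^[j] (F' 0) (x, 0)) 0 ≠ ⊤ := by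
          intro h1
          rw [h1] at hn'
          simp at hn'
        obtain ⟨n', hn1⟩ := ENat.ne_top_iff_exists.1 hne
        rw [← hn1] at hn'
        have hn2 : (e - j) + n' = n := by exact_mod_cast hn'
        refine ihn n' (by omega) (hF' 0) hGb hd'.symm hZb ?_ hn1.symm
        filter_upwards [htx.eventually hH'] with x hx
        simpa using hx
  -- straightening of the curve of maximal contact
  have hH := analyticAt_iterate_dSnd hF (d - 1)
  have hH0 : dSnd^[d - 1] F 0 = 0 :=
    (apply_zero_eq_zero_of_order hF hd (by omega) hd0).2 (by omega)
  have hH1 : fderiv ℂ (dSnd^[d - 1] F) 0 (0, 1) ≠ 0 := by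
    rw [← dSnd_eq hH.differentiableAt, ← Function.iterate_succ_apply' dSnd,
      Nat.succ_eq_add_one, Nat.sub_add_cancel (Nat.pos_of_ne_zero hd0), ne_eq,
      apply_zero_eq_zero_of_order hF hd le_rfl hd0]
    exact lt_irrefl _
  obtain ⟨k, hk, hk0, hk1⟩ := exists_implicit hH hH0 hH1
  have hkz : AnalyticAt ℂ (fun z : ℂ × ℂ => k z.1) 0 :=
    AnalyticAt.fun_comp (f := fun z : ℂ × ℂ => z.1) hk analyticAt_fst
  have hΦ0 : ((0 : ℂ × ℂ).1, k (0 : ℂ × ℂ).1 + (0 : ℂ × ℂ).2) = 0 := by simp [hk0]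
  have hΦ : AnalyticAt ℂ (fun z : ℂ × ℂ => (z.1, k z.1 + z.2)) 0 := by fun_prop
  have hΦt : Tendsto (fun z : ℂ × ℂ => (z.1, k z.1 + z.2)) (𝓝 0) (𝓝 0) := by
    have := hΦ.continuousAt.tendsto
    rwa [hΦ0] at this
  have hF₁ : AnalyticAt ℂ (fun z : ℂ × ℂ => F (z.1, k z.1 + z.2)) 0 :=
    AnalyticAt.fun_comp (hΦ0.symm ▸ hF) hΦ
  have hG₁ : AnalyticAt ℂ (fun z : ℂ × ℂ => G (z.1, k z.1 + z.2)) 0 :=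
    AnalyticAt.fun_comp (hΦ0.symm ▸ hG) hΦ
  have hd₁ : analyticOrderAt (fun y : ℂ => F (0, k 0 + y)) 0 = d := by simpa [hk0] using hd
  have hZ₁ : ∀ᶠ z : ℂ × ℂ in 𝓝 0, F (z.1, k z.1 + z.2) = 0 → G (z.1, k z.1 + z.2) = 0 →
      z.1 = 0 := hΦt.eventually hZ
  have hiter : ∀ j, dSnd^[j] (fun z : ℂ × ℂ => F (z.1, k z.1 + z.2)) =
      fun z => dSnd^[j] F (z.1, k z.1 + z.2) := fun j => by
    funext z
    have := iterate_dSnd_comp F (fun _ => 1) k (fun _ => 1) j z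
    simpa only [one_mul, one_pow] using this
  have hk₁ : ∀ᶠ x in 𝓝 (0 : ℂ),
      dSnd^[d - 1] (fun z : ℂ × ℂ => F (z.1, k z.1 + z.2)) (x, 0) = 0 := by
    rw [hiter]
    simpa using hk1
  obtain ⟨N, hN⟩ : ∃ N, ContactBound N (fun z : ℂ × ℂ => F (z.1, k z.1 + z.2))
      (fun z => G (z.1, k z.1 + z.2)) := by
    by_cases hall : ∀ j < d, ∀ᶠ x in 𝓝 (0 : ℂ),
        dSnd^[j] (fun z : ℂ × ℂ => F (z.1, k z.1 + z.2)) (x, 0) = 0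
    · obtain ⟨u, hu, hu1⟩ := exists_eq_snd_pow_mul hF₁ d hall
      refine exists_contactBound_of_pow hG₁ hu ?_ hu1 hd0 hZ₁
      have h0 : ∀ᶠ y in 𝓝 (0 : ℂ), F (0, k 0 + y) = y ^ d * u (0, y) :=
        tendsto_prodMk_zero.eventually hu1
      have h1 := analyticOrderAt_congr h0
      have h2 : analyticOrderAt (fun y : ℂ => F (0, k 0 + y)) 0 =
          d + analyticOrderAt (fun y => u (0, y)) 0 := by
        rw [← analyticOrderAt_pow_mul (analyticAt_comp_mk_zero hu)]
        exact h1
      rw [hd₁] at h2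
      have h3 : analyticOrderAt (fun y => u (0, y)) 0 = 0 := by
        have h4 : (d : ℕ∞) + 0 = d + analyticOrderAt (fun y => u (0, y)) 0 := by
          rw [add_zero]; exact h2
        exact le_antisymm ((ENat.add_le_add_iff_left (ENat.natCast_ne_top d)).1 h4.ge) zero_le
      exact ((analyticAt_comp_mk_zero hu).analyticOrderAt_eq_zero).1 h3
    · obtain ⟨j, hall⟩ := not_forall.1 hall
      obtain ⟨hj, hj1⟩ := Classical.not_imp.1 hall
      rw [← analyticOrderAt_eq_top] at hj1
      obtain ⟨n, hn⟩ := ENat.ne_top_iff_exists.1 hj1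
      exact inner n j hj hF₁ hG₁ hd₁ hZ₁ hk₁ hn.symm
  refine ⟨N, fun φ hφ hφ0 hcon => hN (fun x => φ x - k x) (by fun_prop) (by simp [hφ0, hk0]) ?_⟩
  simpa using hcon

/-- The contact of smooth arcs transversal to `x = 0` with an isolated zero is bounded. -/
theorem IsolatedForm.exists_contactBound {A B : ℂ × ℂ → ℂ} (h : IsolatedForm A B) :
    ∃ N, ContactBound N A B := by
  have hZ : ∀ᶠ z in 𝓝 0, A z = 0 → B z = 0 → z.1 = 0 := by
    filter_upwards [h.isolated] with z hz h1 h2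
    rw [hz h1 h2]; rfl
  by_cases hA : analyticOrderAt (fun y => A (0, y)) 0 = ⊤
  · by_cases hB : analyticOrderAt (fun y => B (0, y)) 0 = ⊤
    · rw [analyticOrderAt_eq_top] at hA hB
      exact absurd (hA.and hB) h.not_eventually
    · obtain ⟨d, hd⟩ := ENat.ne_top_iff_exists.1 hB
      obtain ⟨N, hN⟩ := PlaneFoliation.exists_contactBound d h.right h.left hd.symm
        (hZ.mono fun z hz h1 h2 => hz h2 h1)
      exact ⟨N, hN.symm⟩
  · obtain ⟨d, hd⟩ := ENat.ne_top_iff_exists.1 hA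
    exact PlaneFoliation.exists_contactBound d h.left h.right hd.symm hZ

/-! ### Reduction of the order along the exceptional divisor -/

/-- A presentation of the germ of `A dx + B dy`, up to a common factor, as a logarithmic form
`y ^ e a dx + x b dy`, for `e = 0` or `e = 1`. The line `x = 0` stands for the last exceptional
divisor, and for `e = 1` the line `y = 0` is another component of the divisor. -/
structure LogPresentation (e : ℕ) (A B a b : ℂ × ℂ → ℂ) : Prop where
  isolatedForm : IsolatedForm A B
  left : AnalyticAt ℂ a 0
  right : AnalyticAt ℂ b 0
  exists_factor : ∃ m, AnalyticAt ℂ m 0 ∧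
    ∀ᶠ z in 𝓝 0, m z * A z = z.2 ^ e * a z ∧ m z * B z = z.1 * b z

/-- The restrictions of `a` and `b` to `x = 0` do not both vanish to order greater than `r`. -/
def AxisOrderLE (r : ℕ) (a b : ℂ × ℂ → ℂ) : Prop :=
  ¬ ((fun y : ℂ => a (0, y)) =O[𝓝 0] (fun y => y ^ (r + 1)) ∧
    (fun y : ℂ => b (0, y)) =O[𝓝 0] fun y => y ^ (r + 1))

theorem AxisOrderLE.not_ordGE {r : ℕ} {a b : ℂ × ℂ → ℂ} (h : AxisOrderLE r a b) :
    ¬ (OrdGE (r + 1) a ∧ OrdGE (r + 1) b) := fun h1 => h ⟨h1.1.isBigO_axis, h1.2.isBigO_axis⟩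

/-- A factor of both components of a multiple of the form that vanishes on `x = 0` is due to the
multiplier, as the components of the form do not both vanish there. -/
theorem IsolatedForm.axis_ne {A B : ℂ × ℂ → ℂ} (h : IsolatedForm A B) {M : ℂ × ℂ → ℂ}
    (hM : AnalyticAt ℂ M 0) (h1 : ∀ᶠ y in 𝓝 (0 : ℂ), M (0, y) * A (0, y) = 0)
    (h2 : ∀ᶠ y in 𝓝 (0 : ℂ), M (0, y) * B (0, y) = 0) : ∀ᶠ y in 𝓝 (0 : ℂ), M (0, y) = 0 := by
  rcases (analyticAt_comp_mk_zero hM).eventually_eq_zero_or_eventually_ne_zero with h3 | h3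
  · exact h3
  · have h0 : ∀ {P : ℂ × ℂ → ℂ}, AnalyticAt ℂ P 0 → (∀ᶠ y in 𝓝 (0 : ℂ), M (0, y) * P (0, y) = 0) →
        ∀ᶠ y in 𝓝 (0 : ℂ), P (0, y) = 0 := by
      intro P hP hMP
      rcases (analyticAt_comp_mk_zero hP).eventually_eq_zero_or_eventually_ne_zero with h4 | h4
      · exact h4
      · have h5 := (h3.and h4).and (hMP.filter_mono (nhdsWithin_le_nhds (s := {0}ᶜ)))
        obtain ⟨y, ⟨h6, h7⟩, h8⟩ := h5.exists
        exact absurd h8 (mul_ne_zero h6 h7)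
    exact absurd ((h0 h.left h1).and (h0 h.right h2)) h.not_eventually

/-- A power of `x` can be cancelled from a logarithmic presentation. -/
theorem IsolatedForm.logPresentation {A B : ℂ × ℂ → ℂ} (h : IsolatedForm A B) (s : ℕ) {e : ℕ}
    {a b M : ℂ × ℂ → ℂ} (ha : AnalyticAt ℂ a 0) (hb : AnalyticAt ℂ b 0) (hM : AnalyticAt ℂ M 0)
    (hMA : ∀ᶠ z in 𝓝 0, M z * A z = z.1 ^ s * (z.2 ^ e * a z) ∧
      M z * B z = z.1 ^ s * (z.1 * b z)) : LogPresentation e A B a b := by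
  induction s generalizing M with
  | zero => exact ⟨h, ha, hb, M, hM, hMA.mono fun z hz => by simpa using hz⟩
  | succ s ih =>
    have h1 := tendsto_prodMk_zero.eventually hMA
    obtain ⟨M', hM', hM1⟩ := exists_eq_fst_mul hM (h.axis_ne hM
      (h1.mono fun y hy => by simpa using hy.1) (h1.mono fun y hy => by simpa using hy.2))
    have hA := h.left
    have hB := h.right
    refine ih hM' ?_
    have h2 := eventually_eq_of_mul (denseNe_fst_pow 1) (f := fun z => M' z * A z)
      (g := fun z => z.1 ^ s * (z.2 ^ e * a z)) (by fun_prop) (by fun_prop) (by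
        filter_upwards [hMA, hM1] with z h3 h4
        linear_combination h3.1 - A z * h4)
    have h3 := eventually_eq_of_mul (denseNe_fst_pow 1) (f := fun z => M' z * B z)
      (g := fun z => z.1 ^ s * (z.1 * b z)) (by fun_prop) (by fun_prop) (by
        filter_upwards [hMA, hM1] with z h3 h4
        linear_combination h3.2 - B z * h4)
    exact h2.and h3

/-- The quotient by `x ^ r` of the pull-back of a function of order exactly `r` vanishes to order at
most `r` at each point of the exceptional divisor. -/
theorem exists_blowChart_of_ordGE {f : ℂ × ℂ → ℂ} (hf : AnalyticAt ℂ f 0) {r : ℕ} (h : OrdGE r f)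
    (t : ℂ) : ∃ g, AnalyticAt ℂ g 0 ∧ (∀ᶠ z in 𝓝 0, f (blowChart t z) = z.1 ^ r * g z) ∧
      (¬ OrdGE (r + 1) f → ¬ (fun s : ℂ => g (0, s)) =O[𝓝 0] fun s => s ^ (r + 1)) := by
  obtain ⟨c, hc⟩ := OrdGE.exists_leading hf h
  obtain ⟨g, hg, hg1, hg2⟩ := exists_blowChart_eq hf h hc t
  refine ⟨g, hg, hg1, fun h1 h2 => ?_⟩
  have h3 : ∃ i ≤ r, c i ≠ 0 := by
    by_contra! hcon
    refine h1 (hc.congr (Eventually.of_forall fun z => ?_))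
    rw [Finset.sum_eq_zero fun i hi => by rw [hcon i (by simpa [Nat.lt_succ_iff] using hi)]; ring,
      sub_zero]
  have h4 := analyticOrderAt_sum_le t h3 hg2
  rw [isBigO_pow_iff (analyticAt_comp_mk_zero hg)] at h2
  have h5 : r + 1 ≤ r := by exact_mod_cast h2.trans h4
  omega

/-- If the strict transform passes through the point of slope `0`, the restriction to the axis
`y = 0` has larger order. -/
theorem isBigO_axis_of_blowChart {f g : ℂ × ℂ → ℂ} {r : ℕ} (hg : AnalyticAt ℂ g 0)
    (h : ∀ᶠ z in 𝓝 0, f (blowChart 0 z) = z.1 ^ r * g z) (h0 : g 0 = 0) :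
    (fun x : ℂ => f (x, 0)) =O[𝓝 0] fun x => x ^ (r + 1) := by
  have htx : Tendsto (fun x : ℂ => (x, (0 : ℂ))) (𝓝 0) (𝓝 (0 : ℂ × ℂ)) :=
    (by fun_prop : Continuous fun x : ℂ => (x, (0 : ℂ))).tendsto' _ _ rfl
  have h1 : (fun x : ℂ => g (x, 0)) =O[𝓝 0] fun x => x ^ 1 := by
    have := ((OrdGE.one_iff hg).2 h0).swap.isBigO_axis
    exact this
  have h2 : (fun x : ℂ => x ^ r * g (x, 0)) =O[𝓝 0] fun x => x ^ r * x ^ 1 :=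
    (Asymptotics.isBigO_refl _ _).mul h1
  refine h2.congr' ?_ (Eventually.of_forall fun x => by ring)
  filter_upwards [htx.eventually h] with x hx
  simpa [blowChart] using hx.symm

/-- The relation between the logarithmic presentations before and after a blow-up. -/
theorem LogPresentation.of_blowUp {e e' : ℕ} {A B a b A' B' a' b' : ℂ × ℂ → ℂ} {K : ℕ} {t : ℂ}
    (h : LogPresentation e A B a b) (hbl : IsBlowUpForm K t A B A' B') (ha' : AnalyticAt ℂ a' 0)
    (hb' : AnalyticAt ℂ b' 0) (s : ℕ)
    (h1 : ∀ᶠ z in 𝓝 0, (blowChart t z).2 ^ e * a (blowChart t z) +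
      (t + z.2) * (z.1 * b (blowChart t z)) = z.1 ^ s * (z.2 ^ e' * a' z))
    (h2 : ∀ᶠ z in 𝓝 0, z.1 * (z.1 * b (blowChart t z)) = z.1 ^ s * (z.1 * b' z)) :
    LogPresentation e' A' B' a' b' := by
  obtain ⟨m, hm, hm1⟩ := h.exists_factor
  have hmb := analyticAt_comp_blowChart hm t
  refine hbl.isolatedForm.logPresentation s (M := fun z => z.1 ^ K * m (blowChart t z)) ha' hb'
    ((analyticAt_fst.pow K).mul hmb) ?_
  filter_upwards [h1, h2, hbl.eq, (tendsto_blowChart t).eventually hm1] with z h3 h4 h5 h6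
  have h7 : (blowChart t z).1 = z.1 := rfl
  rw [← h3, ← h4, ← h7, ← h6.1, ← h6.2, h7]
  exact ⟨by linear_combination -m (blowChart t z) * h5.1,
    by linear_combination -m (blowChart t z) * h5.2⟩

theorem isBigO_of_unit_mul {f u : ℂ → ℂ} (hu : AnalyticAt ℂ u 0) (hu0 : u 0 ≠ 0) {n : ℕ}
    (h : (fun y => u y * f y) =O[𝓝 0] fun y => y ^ n) : f =O[𝓝 0] fun y => y ^ n := by
  have h1 : (fun y => (u y)⁻¹ * (u y * f y)) =O[𝓝 0] fun y => (1 : ℂ) * y ^ n :=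
    ((hu.inv hu0).continuousAt.isBigO_one ℂ).mul h
  refine h1.congr' ?_ (Eventually.of_forall fun y => one_mul _)
  filter_upwards [hu.continuousAt.eventually_ne hu0] with y hy
  field_simp

/-- Blow-up of a logarithmic presentation of order `r`, at a point other than `∞`. The line `y = 0`
remains a component of the divisor at the slope `0` only. -/
theorem LogPresentation.exists_blowUp {e : ℕ} {A B a b A' B' : ℂ × ℂ → ℂ} {K : ℕ} {t : ℂ} {r : ℕ}
    (h : LogPresentation e A B a b) (he : e = 0 ∨ e = 1) (ha : OrdGE r a) (hb : OrdGE r b)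
    (hr : ¬ (OrdGE (r + 1) a ∧ OrdGE (r + 1) b)) (hbl : IsBlowUpForm K t A B A' B') :
    ∃ e' a' b', (e' = 0 ∨ e' = 1) ∧ LogPresentation e' A' B' a' b' ∧ AxisOrderLE r a' b' := by
  obtain ⟨f, hf, hf1, hf2⟩ := exists_blowChart_of_ordGE h.left ha t
  obtain ⟨g, hg, hg1, hg2⟩ := exists_blowChart_of_ordGE h.right hb t
  rcases he with rfl | rfl
  · -- the form `a dx + x b dy` is divisible by `x ^ (r + 1)` or by `x ^ r` only
    by_cases ha' : OrdGE (r + 1) a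
    · obtain ⟨f', hf', hf1', -⟩ := exists_blowChart_of_ordGE h.left ha' t
      refine ⟨0, fun z => f' z + (t + z.2) * g z, g, .inl rfl,
        h.of_blowUp hbl (by fun_prop) hg (r + 1) ?_ ?_, fun h1 => hg2 (fun h2 => hr ⟨ha', h2⟩) h1.2⟩
      · filter_upwards [hf1', hg1] with z h1 h2
        rw [h1, h2]; ring
      · filter_upwards [hg1] with z h2
        rw [h2]; ring
    · refine ⟨0, fun z => f z + z.1 * ((t + z.2) * g z), fun z => z.1 * g z, .inl rfl,
        h.of_blowUp hbl (by fun_prop) (by fun_prop) r ?_ ?_, fun h1 => hf2 ha' ?_⟩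
      · filter_upwards [hf1, hg1] with z h1 h2
        rw [h1, h2]; ring
      · filter_upwards [hg1] with z h2
        rw [h2]; ring
      · simpa using h1.1
  · have hR : ¬ ((fun s : ℂ => f (0, s)) =O[𝓝 0] (fun s => s ^ (r + 1)) ∧
        (fun s : ℂ => g (0, s)) =O[𝓝 0] fun s => s ^ (r + 1)) := fun h1 =>
      hr ⟨not_not.1 fun h2 => hf2 h2 h1.1, not_not.1 fun h2 => hg2 h2 h1.2⟩
    rcases eq_or_ne t 0 with rfl | ht
    · refine ⟨1, fun z => f z + g z, g, .inr rfl,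
        h.of_blowUp hbl (by fun_prop) hg (r + 1) ?_ ?_, fun h1 => hR ⟨?_, h1.2⟩⟩
      · filter_upwards [hf1, hg1] with z h1 h2
        rw [h1, h2]; simp only [blowChart]; ring
      · filter_upwards [hg1] with z h2
        rw [h2]; ring
      · simpa using h1.1.sub h1.2
    · refine ⟨0, fun z => (t + z.2) * (f z + g z), g, .inl rfl,
        h.of_blowUp hbl (by fun_prop) hg (r + 1) ?_ ?_, fun h1 => hR ⟨?_, h1.2⟩⟩
      · filter_upwards [hf1, hg1] with z h1 h2
        rw [h1, h2]; simp only [blowChart]; ring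
      · filter_upwards [hg1] with z h2
        rw [h2]; ring
      · have h2 := isBigO_of_unit_mul (u := fun s => t + s) (f := fun s => f (0, s) + g (0, s))
          (by fun_prop) (by simpa using ht) h1.1
        simpa using h2.sub h1.2

/-- Blow-up of a logarithmic presentation of order `r`, at the point `∞`. If the restrictions to the
divisor have order `r`, the order drops, unless the form has order one. -/
theorem LogPresentation.exists_blowUp_infty {e : ℕ} {A B a b A' B' : ℂ × ℂ → ℂ} {K : ℕ} {r : ℕ}
    (h : LogPresentation e A B a b) (he : e = 0 ∨ e = 1) (ha : OrdGE r a) (hb : OrdGE r b)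
    (hr : ¬ (OrdGE (r + 1) a ∧ OrdGE (r + 1) b))
    (hbl : IsBlowUpForm K 0 (fun z => B z.swap) (fun z => A z.swap) A' B') :
    ∃ e' a' b', (e' = 0 ∨ e' = 1) ∧ LogPresentation e' A' B' a' b' ∧ AxisOrderLE r a' b' ∧
      (AxisOrderLE r a b → OrdGE 2 A → r ≠ 0 → ¬ (OrdGE r a' ∧ OrdGE r b')) := by
  have has := analyticAt_comp_swap h.left
  have hbs := analyticAt_comp_swap h.right
  obtain ⟨f, hf, hf1, hf2⟩ := exists_blowChart_of_ordGE has ha.swap 0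
  obtain ⟨g, hg, hg1, hg2⟩ := exists_blowChart_of_ordGE hbs hb.swap 0
  have hswap : ∀ {k : ℕ} {p : ℂ × ℂ → ℂ}, ¬ OrdGE k p → ¬ OrdGE k fun z => p z.swap :=
    fun h1 h2 => h1 (by simpa using h2.swap)
  obtain ⟨m, hm, hm1⟩ := h.exists_factor
  have hm1' := (tendsto_blowChart 0).eventually (tendsto_swap.eventually hm1)
  have hmb : AnalyticAt ℂ (fun z : ℂ × ℂ => z.1 ^ K * m (blowChart 0 z).swap) 0 :=
    (analyticAt_fst.pow K).mul
      (analyticAt_comp_blowChart (A := fun z => m z.swap) (analyticAt_comp_swap hm) 0)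
  have hord : ∀ {p : ℂ × ℂ → ℂ}, AnalyticAt ℂ p 0 → OrdGE r p → r ≠ 0 → p 0 = 0 :=
    fun hp h1 h2 => (OrdGE.one_iff hp).1 (h1.mono (by omega))
  -- the shape of the new presentation, from the equations of the blow-up
  have key : ∀ {s : ℕ} {a' b' : ℂ × ℂ → ℂ}, AnalyticAt ℂ a' 0 → AnalyticAt ℂ b' 0 →
      (∀ᶠ z in 𝓝 0, z.2 * z.1 * b (blowChart 0 z).swap + z.2 * (z.1 ^ e * a (blowChart 0 z).swap) =
        z.1 ^ s * (z.2 * a' z)) →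
      (∀ᶠ z in 𝓝 0, z.1 * (z.1 ^ e * a (blowChart 0 z).swap) = z.1 ^ s * (z.1 * b' z)) →
      LogPresentation 1 A' B' a' b' := by
    intro s a' b' ha' hb' h1 h2
    refine hbl.isolatedForm.logPresentation s ha' hb' hmb ?_
    filter_upwards [h1, h2, hbl.eq, hm1'] with z h3 h4 h5 h6
    rw [pow_one, ← h3, ← h4]
    simp only [blowChart, Prod.swap_prod_mk, zero_add] at h5 h6 ⊢
    exact ⟨by linear_combination -m (z.2 * z.1, z.1) * h5.1 + h6.2 + z.2 * h6.1,
      by linear_combination -m (z.2 * z.1, z.1) * h5.2 + z.1 * h6.1⟩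
  rcases he with rfl | rfl
  · by_cases ha' : OrdGE (r + 1) a
    · obtain ⟨f', hf', hf1', -⟩ := exists_blowChart_of_ordGE has ha'.swap 0
      refine ⟨1, fun z => f' z + g z, f', .inr rfl, key (s := r + 1) (by fun_prop) hf' ?_ ?_,
        fun h1 => hg2 (hswap fun h2 => hr ⟨ha', h2⟩) ?_, fun h1 _ h3 h4 => h1 ⟨ha'.isBigO_axis, ?_⟩⟩
      · filter_upwards [hf1', hg1] with z h1 h2
        rw [h1, h2]; ring
      · filter_upwards [hf1'] with z h2
        rw [h2]; ring
      · simpa using h1.1.sub h1.2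
      · refine isBigO_axis_of_blowChart (f := fun z => b z.swap) hg hg1 ?_
        have h5 := hord (hf'.fun_add hg) h4.1 h3
        simpa [hord hf' h4.2 h3] using h5
    · refine ⟨1, fun z => f z + z.1 * g z, f, .inr rfl, key (s := r) (by fun_prop) hf ?_ ?_,
        fun h1 => hf2 (hswap ha') h1.2, fun h1 h2 h3 h4 => ?_⟩
      · filter_upwards [hf1, hg1] with z h1 h2
        rw [h1, h2]; ring
      · filter_upwards [hf1] with z h2
        rw [h2]; ring
      · refine h1 ⟨isBigO_axis_of_blowChart (f := fun z => a z.swap) hf hf1 (hord hf h4.2 h3),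
          isBigO_axis_of_blowChart (f := fun z => b z.swap) hg hg1 ?_⟩
        by_cases hr1 : r = 1
        · -- here `a = m A` has order one
          subst hr1
          refine absurd ?_ ha'
          have h5 := (OrdGE.of_continuousAt hm.continuousAt).mul h2
          rw [zero_add] at h5
          exact h5.congr (hm1.mono fun z hz => by simpa using hz.1)
        · have h5 : OrdGE 2 fun z => z.1 * g z :=
            ((h4.1.sub h4.2).mono (by omega)).congr (Eventually.of_forall fun z => by ring)
          have h6 := ((OrdGE.two_iff (analyticAt_fst.mul hg)).1 h5).2
          have h7 := (HasLinearPart.fst_mul hg).hasFDerivAt.fderiv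
          have h8 := DFunLike.congr_fun (h7.symm.trans h6) (1, 0)
          simpa using h8
  · refine ⟨1, fun z => g z + f z, f, .inr rfl, key (s := r + 1) (by fun_prop) hf ?_ ?_,
      fun h1 => hr ⟨not_not.1 fun h2 => hf2 (hswap h2) h1.2,
        not_not.1 fun h2 => hg2 (hswap h2) ?_⟩,
      fun h1 _ h3 h4 => h1
        ⟨isBigO_axis_of_blowChart (f := fun z => a z.swap) hf hf1 (hord hf h4.2 h3),
        isBigO_axis_of_blowChart (f := fun z => b z.swap) hg hg1 ?_⟩⟩
    · filter_upwards [hf1, hg1] with z h1 h2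
      rw [h1, h2]; ring
    · filter_upwards [hf1] with z h2
      rw [h2]; ring
    · simpa using h1.1.sub h1.2
    · have h5 := hord (hg.fun_add hf) h4.1 h3
      simpa [hord hf h4.2 h3] using h5

/-- The blow-up of a form of order at least two is divided by `x ^ 2` at least: otherwise both
components of the transform would vanish on the exceptional divisor. -/
theorem IsBlowUpForm.two_le {K : ℕ} {t : ℂ} {A B A' B' : ℂ × ℂ → ℂ}
    (h : IsBlowUpForm K t A B A' B') (hA : AnalyticAt ℂ A 0) (hB : AnalyticAt ℂ B 0)
    (hA2 : OrdGE 2 A) (hB2 : OrdGE 2 B) : 2 ≤ K := by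
  by_contra! hK
  obtain ⟨f, hf, hf1, -⟩ := exists_blowChart_of_ordGE hA hA2 t
  obtain ⟨g, hg, hg1, -⟩ := exists_blowChart_of_ordGE hB hB2 t
  have hA' := h.isolatedForm.left
  have hB' := h.isolatedForm.right
  obtain ⟨j, hj⟩ := Nat.exists_eq_add_of_lt hK
  have h1 := eventually_eq_of_mul (denseNe_fst_pow K) hA'
    (g := fun z => z.1 ^ (j + 1) * (f z + (t + z.2) * g z)) (by fun_prop) (by
      filter_upwards [h.eq, hf1, hg1] with z h1 h2 h3
      rw [← h1.1, h2, h3, hj]; ring)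
  have h2 := eventually_eq_of_mul (denseNe_fst_pow K) hB'
    (g := fun z => z.1 ^ (j + 1) * (z.1 * g z)) (by fun_prop) (by
      filter_upwards [h.eq, hf1, hg1] with z h1 h2 h3
      rw [← h1.2, h3, hj]; ring)
  refine h.isolatedForm.not_eventually ((tendsto_prodMk_zero.eventually (h1.and h2)).mono ?_)
  rintro y ⟨h3, h4⟩
  exact ⟨by simpa using h3, by simpa using h4⟩

/-- The contact of smooth arcs decreases: an arc `y = φ(x)` at the point of slope `t` projects to the
arc `y = (t + φ(x)) x`, whose contact with the form is larger by at least `K - 1`. -/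
theorem IsBlowUpForm.contactBound {K : ℕ} {t : ℂ} {A B A' B' : ℂ × ℂ → ℂ}
    (h : IsBlowUpForm K t A B A' B') (hB : AnalyticAt ℂ B 0) (hK : 2 ≤ K)
    {N : ℕ} (hN : ContactBound (N + 1) A B) : ContactBound N A' B' := by
  intro φ hφ hφ0 hcon
  have hψ : AnalyticAt ℂ (fun x => (t + φ x) * x) 0 := by fun_prop
  have heq : ∀ᶠ x in 𝓝 0, A (x, (t + φ x) * x) + (t + φ x) * B (x, (t + φ x) * x) =
      x ^ K * A' (x, φ x) ∧ x * B (x, (t + φ x) * x) = x ^ K * B' (x, φ x) :=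
    (tendsto_graph hφ hφ0).eventually h.eq
  have hmul : ∀ {f : ℂ → ℂ}, f =O[𝓝 0] (fun x => x ^ (N + 1)) →
      (fun x => x ^ K * f x) =O[𝓝 0] fun x => x ^ (1 + (N + 1 + 1)) := fun hf => by
    have := (Asymptotics.isBigO_refl (fun x : ℂ => x ^ K) (𝓝 0)).mul hf
    refine (this.congr_right fun x => ?_).trans
      (isBigO_pow_of_le (m := 1 + (N + 1 + 1)) (n := K + (N + 1)) (by omega))
    ring
  have hBx := analyticAt_comp_graph hB hψ (by simp)
  have hB1 : (fun x => B (x, (t + φ x) * x)) =O[𝓝 0] fun x => x ^ (N + 1 + 1) := by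
    refine isBigO_of_pow_mul hBx (e := 1) ((hmul hcon.2).congr' ?_ EventuallyEq.rfl)
    filter_upwards [heq] with x hx
    rw [← hx.2, pow_one]
  refine hN _ hψ (by simp) ⟨?_, hB1⟩
  have h2 : (fun x => (t + φ x) * B (x, (t + φ x) * x)) =O[𝓝 0] fun x => x ^ (N + 1 + 1) := by
    have h3 : AnalyticAt ℂ (fun x => t + φ x) 0 := by fun_prop
    simpa using (h3.continuousAt.isBigO_one ℂ).mul hB1
  have h3 := ((hmul hcon.1).trans (isBigO_pow_of_le (m := N + 1 + 1) (by omega))).sub h2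
  refine h3.congr' ?_ EventuallyEq.rfl
  filter_upwards [heq] with x hx
  linear_combination -hx.1

theorem IsolatedForm.resolvable_of_not_ordGE_two {A B : ℂ × ℂ → ℂ} (h : IsolatedForm A B)
    (h2 : ¬ (OrdGE 2 A ∧ OrdGE 2 B)) : Resolvable A B := by
  by_cases hA0 : A 0 = 0
  swap
  · exact .regular (.inl hA0)
  by_cases hB0 : B 0 = 0
  swap
  · exact .regular (.inr hB0)
  obtain ⟨a₁, a₂, hA⟩ := HasLinearPart.exists_of h.left hA0
  obtain ⟨b₁, b₂, hB⟩ := HasLinearPart.exists_of h.right hB0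
  refine h.resolvable_of_linear hA hB ?_
  by_contra! hcon
  obtain ⟨⟨rfl, rfl⟩, rfl, rfl⟩ := hcon
  exact h2 ⟨by simpa using hA.2, by simpa using hB.2⟩

/-- A logarithmic presentation of order zero belongs to a form of order at most one. -/
theorem LogPresentation.not_ordGE_two {e : ℕ} {A B a b : ℂ × ℂ → ℂ}
    (h : LogPresentation e A B a b) (he : e = 0 ∨ e = 1) (h1 : ¬ (OrdGE 1 a ∧ OrdGE 1 b)) :
    ¬ (OrdGE 2 A ∧ OrdGE 2 B) := by
  rintro ⟨hA, hB⟩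
  obtain ⟨m, hm, hm1⟩ := h.exists_factor
  have hmul : ∀ {f : ℂ × ℂ → ℂ}, OrdGE 2 f → OrdGE 2 fun z => m z * f z := fun hf => by
    simpa using (OrdGE.of_continuousAt hm.continuousAt).mul hf
  have ha : OrdGE 2 fun z => z.2 ^ e * a z := (hmul hA).congr (hm1.mono fun z hz => hz.1)
  have hb : OrdGE 2 fun z => z.1 * b z := (hmul hB).congr (hm1.mono fun z hz => hz.2)
  refine h1 ⟨?_, ?_⟩
  · rcases he with rfl | rfl
    · exact OrdGE.mono (by simpa using ha) one_le_two
    · simp only [pow_one] at ha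
      have h6 := ((OrdGE.two_iff (analyticAt_snd.mul h.left)).1 ha).2
      have h7 := (HasLinearPart.snd_mul h.left).fderiv_snd
      rw [OrdGE.one_iff h.left, ← h7]
      exact DFunLike.congr_fun h6 (0, 1)
  · have h6 := ((OrdGE.two_iff (analyticAt_fst.mul h.right)).1 hb).2
    have h7 := (HasLinearPart.fst_mul h.right).hasFDerivAt.fderiv
    have h8 := DFunLike.congr_fun (h7.symm.trans h6) (1, 0)
    rw [OrdGE.one_iff h.right]
    simpa using h8

/-- The main induction: on the order `r` of the logarithmic presentation and, as long as `r` does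
not drop, on the contact of smooth arcs with the singularity. -/
theorem LogPresentation.resolvable (r : ℕ) {e : ℕ} {A B a b : ℂ × ℂ → ℂ}
    (h : LogPresentation e A B a b) (he : e = 0 ∨ e = 1)
    (hr : ¬ (OrdGE (r + 1) a ∧ OrdGE (r + 1) b)) : Resolvable A B := by
  induction r generalizing e A B a b with
  | zero => exact h.isolatedForm.resolvable_of_not_ordGE_two (h.not_ordGE_two he hr)
  | succ r ih =>
    -- if moreover the restrictions to the divisor have order at most `r + 1`, the order drops at
    -- infinity and the contact bound `N` decreases at the other points
    have inner : ∀ (N : ℕ) {e : ℕ} {A B a b : ℂ × ℂ → ℂ}, LogPresentation e A B a b →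
        (e = 0 ∨ e = 1) → AxisOrderLE (r + 1) a b → ContactBound N A B → Resolvable A B := by
      intro N
      induction N with
      | zero =>
        intro e A B a b h he hr hN
        refine h.isolatedForm.resolvable_of_not_ordGE_two fun h2 => ?_
        refine hN (fun _ => 0) analyticAt_const rfl ⟨?_, ?_⟩
        · exact (h2.1.mono one_le_two).swap.isBigO_axis
        · exact (h2.2.mono one_le_two).swap.isBigO_axis
      | succ N ihN =>
        intro e A B a b h he hR hN
        by_cases h1 : OrdGE (r + 1) a ∧ OrdGE (r + 1) b
        swap
        · exact ih h he h1
        by_cases h2 : OrdGE 2 A ∧ OrdGE 2 B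
        swap
        · exact h.isolatedForm.resolvable_of_not_ordGE_two h2
        have hA := h.isolatedForm.left
        have hB := h.isolatedForm.right
        refine .of_blowUp (fun t => ?_) ?_
        · obtain ⟨K, A', B', hbl⟩ := exists_isBlowUpForm h.isolatedForm t
          obtain ⟨e', a', b', he', h', hR'⟩ := h.exists_blowUp he h1.1 h1.2 hR.not_ordGE hbl
          exact ⟨K, A', B', hbl, ihN h' he' hR'
            (hbl.contactBound hB (hbl.two_le hA hB h2.1 h2.2) hN)⟩
        · obtain ⟨K, A', B', hbl⟩ := exists_isBlowUpForm h.isolatedForm.swap 0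
          obtain ⟨e', a', b', he', h', -, hr'⟩ :=
            h.exists_blowUp_infty he h1.1 h1.2 hR.not_ordGE hbl
          exact ⟨K, A', B', hbl, ih h' he' (hr' hR h2.1 r.succ_ne_zero)⟩
    by_cases h1 : OrdGE (r + 1) a ∧ OrdGE (r + 1) b
    swap
    · exact ih h he h1
    -- one blow-up achieves the additional hypothesis
    refine .of_blowUp (fun t => ?_) ?_
    · obtain ⟨K, A', B', hbl⟩ := exists_isBlowUpForm h.isolatedForm t
      obtain ⟨e', a', b', he', h', hR'⟩ := h.exists_blowUp he h1.1 h1.2 hr hbl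
      obtain ⟨N, hN⟩ := hbl.isolatedForm.exists_contactBound
      exact ⟨K, A', B', hbl, inner N h' he' hR' hN⟩
    · obtain ⟨K, A', B', hbl⟩ := exists_isBlowUpForm h.isolatedForm.swap 0
      obtain ⟨e', a', b', he', h', hR', -⟩ := h.exists_blowUp_infty he h1.1 h1.2 hr hbl
      obtain ⟨N, hN⟩ := hbl.isolatedForm.exists_contactBound
      exact ⟨K, A', B', hbl, inner N h' he' hR' hN⟩

/-- The transform of a form at a point of the exceptional divisor has a logarithmic presentation, the
pull-back of the form. Its order is finite, because the transform does not vanish identically. -/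
theorem IsBlowUpForm.resolvable {K : ℕ} {t : ℂ} {A B A' B' : ℂ × ℂ → ℂ} (h : IsolatedForm A B)
    (hbl : IsBlowUpForm K t A B A' B') : Resolvable A' B' := by
  have hA := analyticAt_comp_blowChart h.left t
  have hB := analyticAt_comp_blowChart h.right t
  have ha : AnalyticAt ℂ (fun z => A (blowChart t z) + (t + z.2) * B (blowChart t z)) 0 :=
    hA.fun_add ((analyticAt_const.add analyticAt_snd).mul hB)
  have hlog : LogPresentation 0 A' B'
      (fun z => A (blowChart t z) + (t + z.2) * B (blowChart t z)) fun z => B (blowChart t z) :=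
    ⟨hbl.isolatedForm, ha, hB, fun z => z.1 ^ K, analyticAt_fst.pow K,
      hbl.eq.mono fun z hz => ⟨by rw [← hz.1]; ring, hz.2.symm⟩⟩
  by_contra hcon
  have hall : ∀ r, OrdGE r (fun z => A (blowChart t z) + (t + z.2) * B (blowChart t z)) ∧
      OrdGE r fun z => B (blowChart t z) := fun r => by
    by_contra h1
    exact hcon (hlog.resolvable r (.inl rfl) fun h2 =>
      h1 ⟨h2.1.mono r.le_succ, h2.2.mono r.le_succ⟩)
  have h1 := OrdGE.eventually_eq_zero ha fun r => (hall r).1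
  have h2 := OrdGE.eventually_eq_zero hB fun r => (hall r).2
  have h3 := eventually_eq_of_mul (denseNe_fst_pow K) hbl.isolatedForm.left
    (g := fun _ => 0) analyticAt_const (by
      filter_upwards [h1, hbl.eq] with z h3 h4
      rw [← h4.1, h3, mul_zero])
  have h4 := eventually_eq_of_mul (denseNe_fst_pow K) hbl.isolatedForm.right
    (g := fun _ => 0) analyticAt_const (by
      filter_upwards [h2, hbl.eq] with z h3 h4
      rw [← h4.2, h3, mul_zero, mul_zero])
  exact hbl.isolatedForm.not_eventually (tendsto_prodMk_zero.eventually (h3.and h4))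

/-- Every isolated singularity of a germ of `1`-form is brought into final form by finitely many
point blow-ups. -/
theorem IsolatedForm.resolvable {A B : ℂ × ℂ → ℂ} (h : IsolatedForm A B) : Resolvable A B := by
  refine .of_blowUp (fun t => ?_) ?_
  · obtain ⟨K, A', B', hbl⟩ := exists_isBlowUpForm h t
    exact ⟨K, A', B', hbl, hbl.resolvable h⟩
  · obtain ⟨K, A', B', hbl⟩ := exists_isBlowUpForm h.swap 0
    exact ⟨K, A', B', hbl, hbl.resolvable h.swap⟩

/-! ### Pull-backs of germs of forms -/

theorem pullback_congr (θ : ℂ × ℂ → (ℂ × ℂ →L[ℂ] ℂ)) {g g' : ℂ × ℂ → ℂ × ℂ} {z : ℂ × ℂ}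
    (h : g =ᶠ[𝓝 z] g') : pullback θ g z = pullback θ g' z := by
  rw [pullback, pullback, h.fderiv_eq, h.eq_of_nhds]

theorem pullback_comp (θ : ℂ × ℂ → (ℂ × ℂ →L[ℂ] ℂ)) {g Φ : ℂ × ℂ → ℂ × ℂ} {z : ℂ × ℂ}
    (hg : DifferentiableAt ℂ g (Φ z)) (hΦ : DifferentiableAt ℂ Φ z) :
    pullback θ (fun z => g (Φ z)) z = (pullback θ g (Φ z)).comp (fderiv ℂ Φ z) := by
  rw [pullback, pullback, fderiv_fun_comp z hg hΦ]
  rfl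

theorem DenseNe.not_eventually {h : ℂ × ℂ → ℂ} (hh : DenseNe h) : ¬ ∀ᶠ z in 𝓝 0, h z = 0 :=
  fun h0 => hh.self_of_nhds (h0.mono fun _ h => not_not.2 h)

theorem DenseNe.mul {f g : ℂ × ℂ → ℂ} (hf : AnalyticAt ℂ f 0) (hfd : DenseNe f) (hgd : DenseNe g) :
    DenseNe fun z => f z * g z := by
  filter_upwards [hfd, hgd.eventually_nhds, hf.eventually_analyticAt.eventually_nhds]
    with z h1 h2 h3 h4
  refine h1 ?_
  simp only [not_not] at h4 ⊢
  filter_upwards [h2, h3, h4.eventually_nhds] with w h5 h6 h7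
  by_contra h8
  refine h5 ?_
  filter_upwards [h7, h6.continuousAt.eventually_ne h8] with v h9 h10
  exact not_not.2 ((mul_eq_zero.1 h9).resolve_left h10)

theorem denseNe_of_ne {u : ℂ × ℂ → ℂ} (hu : AnalyticAt ℂ u 0) (hu0 : u 0 ≠ 0) : DenseNe u :=
  denseNe_of_analyticAt hu fun h => hu0 h.self_of_nhds

/-- The hypothesis `ho` asks that `Φ` be open at points arbitrarily close to the origin. It holds for
local isomorphisms and for the charts of a blow-up. -/
theorem DenseNe.comp {h : ℂ × ℂ → ℂ} {Φ : ℂ × ℂ → ℂ × ℂ} (hh : DenseNe h) (ha : AnalyticAt ℂ h 0)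
    (hΦ : AnalyticAt ℂ Φ 0) (hΦ0 : Φ 0 = 0)
    (ho : ∃ᶠ w in 𝓝 0, 𝓝 (Φ w) ≤ map Φ (𝓝 w)) : DenseNe fun z => h (Φ z) := by
  refine denseNe_of_analyticAt (AnalyticAt.fun_comp (hΦ0.symm ▸ ha) hΦ) fun h0 => ?_
  have ht : Tendsto Φ (𝓝 0) (𝓝 0) := by
    have := hΦ.continuousAt.tendsto
    rwa [hΦ0] at this
  obtain ⟨w, hw, h1, h2⟩ := (ho.and_eventually (h0.eventually_nhds.and (ht.eventually hh))).exists
  exact h2 (hw (h1.mono fun _ h => not_not.2 h))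

/-- The germ at the origin of the pull-back of `θ` by `g` is a multiple of the form `A dx + B dy`,
which has at most an isolated zero. The factor does not vanish identically, which determines
`A dx + B dy` up to a unit. -/
def GermForm (θ : ℂ × ℂ → (ℂ × ℂ →L[ℂ] ℂ)) (g : ℂ × ℂ → ℂ × ℂ) (A B : ℂ × ℂ → ℂ) : Prop :=
  IsolatedForm A B ∧ ∃ h : ℂ × ℂ → ℂ, AnalyticAt ℂ h 0 ∧ DenseNe h ∧
    ∀ᶠ z in 𝓝 0, pullback θ g z = h z • oneForm A B z

namespace GermForm

variable {θ : ℂ × ℂ → (ℂ × ℂ →L[ℂ] ℂ)} {g : ℂ × ℂ → ℂ × ℂ} {A B : ℂ × ℂ → ℂ}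

theorem congr (h : GermForm θ g A B) {g' : ℂ × ℂ → ℂ × ℂ} (hg : ∀ᶠ z in 𝓝 0, g z = g' z) :
    GermForm θ g' A B := by
  obtain ⟨hi, u, hu, hud, h1⟩ := h
  refine ⟨hi, u, hu, hud, ?_⟩
  filter_upwards [h1, hg.eventually_nhds] with z h2 h3
  rw [← h2]
  exact (pullback_congr θ h3).symm

theorem comp (h : GermForm θ g A B) (hg : AnalyticAt ℂ g 0) {Φ : ℂ × ℂ → ℂ × ℂ}
    {u A' B' : ℂ × ℂ → ℂ} (hΦ : AnalyticAt ℂ Φ 0) (hΦ0 : Φ 0 = 0)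
    (ho : ∃ᶠ w in 𝓝 0, 𝓝 (Φ w) ≤ map Φ (𝓝 w)) (hi : IsolatedForm A' B')
    (hu : AnalyticAt ℂ u 0) (hud : DenseNe u)
    (h1 : ∀ᶠ z in 𝓝 0, pullback (oneForm A B) Φ z = u z • oneForm A' B' z) :
    GermForm θ (fun z => g (Φ z)) A' B' := by
  obtain ⟨-, v, hv, hvd, h2⟩ := h
  have ht : Tendsto Φ (𝓝 0) (𝓝 0) := by
    have := hΦ.continuousAt.tendsto
    rwa [hΦ0] at this
  have hvΦ : AnalyticAt ℂ (fun z => v (Φ z)) 0 := AnalyticAt.fun_comp (hΦ0.symm ▸ hv) hΦ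
  refine ⟨hi, fun z => v (Φ z) * u z, hvΦ.fun_mul hu, (hvd.comp hv hΦ hΦ0 ho).mul hvΦ hud, ?_⟩
  filter_upwards [h1, ht.eventually h2, ht.eventually hg.eventually_analyticAt,
    hΦ.eventually_analyticAt] with z h3 h4 h5 h6
  rw [pullback_comp θ h5.differentiableAt h6.differentiableAt, h4, mul_smul, ← h3]
  rfl

theorem open_of_equiv {Φ : ℂ × ℂ → ℂ × ℂ} {L : (ℂ × ℂ) ≃L[ℂ] (ℂ × ℂ)} (hΦ : AnalyticAt ℂ Φ 0)
    (hL : HasFDerivAt Φ (L : ℂ × ℂ →L[ℂ] ℂ × ℂ) 0) : ∃ᶠ w in 𝓝 0, 𝓝 (Φ w) ≤ map Φ (𝓝 w) := by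
  have hs : HasStrictFDerivAt Φ (L : ℂ × ℂ →L[ℂ] ℂ × ℂ) 0 := by
    rw [← hL.fderiv]; exact hΦ.hasStrictFDerivAt
  intro h
  exact h.self_of_nhds hs.map_nhds_eq_of_equiv.ge

/-- A change of coordinates and the division by a unit. -/
theorem change (h : GermForm θ g A B) (hg : AnalyticAt ℂ g 0) {Φ : ℂ × ℂ → ℂ × ℂ}
    {u A' B' : ℂ × ℂ → ℂ} {L : (ℂ × ℂ) ≃L[ℂ] (ℂ × ℂ)} (hΦ : AnalyticAt ℂ Φ 0) (hΦ0 : Φ 0 = 0)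
    (hL : HasFDerivAt Φ (L : ℂ × ℂ →L[ℂ] ℂ × ℂ) 0) (hu : AnalyticAt ℂ u 0) (hu0 : u 0 ≠ 0)
    (hi : IsolatedForm A' B')
    (h1 : ∀ᶠ z in 𝓝 0, pullback (oneForm A B) Φ z = u z • oneForm A' B' z) :
    GermForm θ (fun z => g (Φ z)) A' B' :=
  h.comp hg hΦ hΦ0 (open_of_equiv hΦ hL) hi hu (denseNe_of_ne hu hu0) h1

theorem oneForm_apply (η : ℂ × ℂ →L[ℂ] ℂ) :
    η = η (1, 0) • ContinuousLinearMap.fst ℂ ℂ ℂ + η (0, 1) • ContinuousLinearMap.snd ℂ ℂ ℂ := by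
  ext <;> simp

theorem eq_zero_of_apply {η : ℂ × ℂ →L[ℂ] ℂ} (h : η (1, 0) = 0) (h' : η (0, 1) = 0) : η = 0 := by
  ext <;> simp [h, h']

theorem oneForm_eq_zero {z : ℂ × ℂ} (h : oneForm A B z = 0) : A z = 0 ∧ B z = 0 :=
  ⟨by simpa [oneForm] using DFunLike.congr_fun h (1, 0),
    by simpa [oneForm] using DFunLike.congr_fun h (0, 1)⟩

/-- Any change of coordinates leads to a form with an isolated zero, and preserves regularity. -/
theorem exists_comp (h : GermForm θ g A B) (hg : AnalyticAt ℂ g 0) {Φ : ℂ × ℂ → ℂ × ℂ}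
    {L : (ℂ × ℂ) ≃L[ℂ] (ℂ × ℂ)} (hΦ : AnalyticAt ℂ Φ 0) (hΦ0 : Φ 0 = 0)
    (hL : HasFDerivAt Φ (L : ℂ × ℂ →L[ℂ] ℂ × ℂ) 0) :
    ∃ A' B', GermForm θ (fun z => g (Φ z)) A' B' ∧
      (A 0 ≠ 0 ∨ B 0 ≠ 0 → A' 0 ≠ 0 ∨ B' 0 ≠ 0) := by
  have hform : ∀ z, pullback (oneForm A B) Φ z = (1 : ℂ) • oneForm
      (fun z => pullback (oneForm A B) Φ z (1, 0)) (fun z => pullback (oneForm A B) Φ z (0, 1)) z :=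
    fun z => by rw [one_smul]; exact oneForm_apply _
  have ht : Tendsto Φ (𝓝 0) (𝓝 0) := by
    have := hΦ.continuousAt.tendsto
    rwa [hΦ0] at this
  have hA : AnalyticAt ℂ (fun z => A (Φ z)) 0 := AnalyticAt.fun_comp (hΦ0.symm ▸ h.1.left) hΦ
  have hB : AnalyticAt ℂ (fun z => B (Φ z)) 0 := AnalyticAt.fun_comp (hΦ0.symm ▸ h.1.right) hΦ
  have han : ∀ v : ℂ × ℂ, AnalyticAt ℂ (fun z => pullback (oneForm A B) Φ z v) 0 := by
    intro v
    have h1 : AnalyticAt ℂ (fun z => fderiv ℂ Φ z v) 0 :=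
      ((ContinuousLinearMap.apply ℂ (ℂ × ℂ) v).analyticAt _).comp hΦ.fderiv
    have h2 : AnalyticAt ℂ (fun z => (fderiv ℂ Φ z v).1) 0 :=
      AnalyticAt.fun_comp (g := fun p : ℂ × ℂ => p.1) (f := fun z => fderiv ℂ Φ z v)
        analyticAt_fst h1
    have h3 : AnalyticAt ℂ (fun z => (fderiv ℂ Φ z v).2) 0 :=
      AnalyticAt.fun_comp (g := fun p : ℂ × ℂ => p.2) (f := fun z => fderiv ℂ Φ z v)
        analyticAt_snd h1
    exact ((hA.fun_mul h2).fun_add (hB.fun_mul h3)).congr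
      (Eventually.of_forall fun z => by simp [pullback, oneForm])
  -- near the origin the derivative of `Φ` is invertible
  have hinv : ∀ᶠ z in 𝓝 0, pullback (oneForm A B) Φ z = 0 → A (Φ z) = 0 ∧ B (Φ z) = 0 := by
    have h1 : ContinuousAt (fderiv ℂ Φ) 0 := hΦ.fderiv.continuousAt
    have h2 := L.nhds
    rw [← hL.fderiv] at h2
    filter_upwards [h1 h2] with z hz h3
    obtain ⟨L', hL'⟩ := hz
    have h4 : (oneForm A B (Φ z)).comp (L' : ℂ × ℂ →L[ℂ] ℂ × ℂ) = 0 := by rw [hL']; exact h3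
    refine oneForm_eq_zero (ContinuousLinearMap.ext fun v => ?_)
    have := DFunLike.congr_fun h4 (L'.symm v)
    simpa using this
  have hs : HasStrictFDerivAt Φ (L : ℂ × ℂ →L[ℂ] ℂ × ℂ) 0 := by
    rw [← hL.fderiv]; exact hΦ.hasStrictFDerivAt
  have hi : IsolatedForm (fun z => pullback (oneForm A B) Φ z (1, 0))
      (fun z => pullback (oneForm A B) Φ z (0, 1)) := by
    refine ⟨han _, han _, ?_⟩
    filter_upwards [hinv, ht.eventually h.1.isolated, hs.eventually_left_inverse]
      with z h1 h2 h3 h4 h5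
    obtain ⟨h6, h7⟩ := h1 (eq_zero_of_apply h4 h5)
    have h8 := hs.eventually_left_inverse.self_of_nhds
    rw [hΦ0] at h8
    rw [← h3, h2 h6 h7, h8]
  refine ⟨_, _, h.change hg hΦ hΦ0 hL analyticAt_const one_ne_zero hi
    (Eventually.of_forall hform), fun h0 => ?_⟩
  by_contra! hcon
  obtain ⟨h6, h7⟩ := hinv.self_of_nhds (eq_zero_of_apply hcon.1 hcon.2)
  rw [hΦ0] at h6 h7
  simp [h6, h7] at h0

theorem hasFDerivAt_blowChart (t : ℂ) (z : ℂ × ℂ) : HasFDerivAt (blowChart t)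
    ((ContinuousLinearMap.fst ℂ ℂ ℂ).prod ((t + z.2) • ContinuousLinearMap.fst ℂ ℂ ℂ +
      z.1 • ContinuousLinearMap.snd ℂ ℂ ℂ)) z :=
  hasFDerivAt_fst.prodMk ((hasFDerivAt_snd.const_add t).fun_mul hasFDerivAt_fst)

theorem nhds_blowChart_le {t : ℂ} {w : ℂ × ℂ} (hw : w.1 ≠ 0) :
    𝓝 (blowChart t w) ≤ map (blowChart t) (𝓝 w) := by
  have hd : ContinuousAt (fun v : ℂ × ℂ => v.2 / v.1) (blowChart t w) :=
    continuousAt_snd.div continuousAt_fst (show (blowChart t w).1 ≠ 0 from hw)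
  have hc : ContinuousAt (fun v : ℂ × ℂ => (v.1, v.2 / v.1 - t)) (blowChart t w) :=
    continuousAt_fst.prodMk (hd.sub continuousAt_const)
  have ht : Tendsto (fun v : ℂ × ℂ => (v.1, v.2 / v.1 - t)) (𝓝 (blowChart t w)) (𝓝 w) := by
    have h1 : ((blowChart t w).1, (blowChart t w).2 / (blowChart t w).1 - t) = w := by
      ext
      · rfl
      · simp [blowChart, hw]
    have := hc.tendsto
    rwa [h1] at this
  have h2 : ∀ᶠ v : ℂ × ℂ in 𝓝 (blowChart t w), blowChart t (v.1, v.2 / v.1 - t) = v := by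
    filter_upwards [continuousAt_fst.eventually_ne (show (blowChart t w).1 ≠ 0 from hw)] with v hv
    ext
    · rfl
    · simp [blowChart, hv]
  calc 𝓝 (blowChart t w) = map (fun v => blowChart t (v.1, v.2 / v.1 - t)) (𝓝 (blowChart t w)) := by
        rw [Filter.map_congr (m₂ := id) h2, map_id]
    _ = map (blowChart t) (map (fun v : ℂ × ℂ => (v.1, v.2 / v.1 - t)) (𝓝 (blowChart t w))) := by
        rw [map_map]; rfl
    _ ≤ map (blowChart t) (𝓝 w) := map_mono ht

/-- The transform at the point of slope `t` of the exceptional divisor. -/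
theorem blowUp (h : GermForm θ g A B) (hg : AnalyticAt ℂ g 0) {K : ℕ} {t : ℂ} {A' B' : ℂ × ℂ → ℂ}
    (hbl : IsBlowUpForm K t A B A' B') : GermForm θ (fun z => g (blowChart t z)) A' B' := by
  refine h.comp hg (analyticAt_blowChart t 0) (blowChart_zero t)
    ((frequently_fst_ne 0 0).mono fun w hw => nhds_blowChart_le hw) hbl.isolatedForm
    (analyticAt_fst.pow K) (denseNe_fst_pow K) ?_
  filter_upwards [hbl.eq] with z hz
  rw [oneForm_smul]
  refine pullback_oneForm (hasFDerivAt_blowChart t z) ?_ ?_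
  · rw [Pi.pow_apply, ← hz.1]; simp; ring
  · rw [Pi.pow_apply, ← hz.2]; simp; ring

theorem swap (h : GermForm θ g A B) (hg : AnalyticAt ℂ g 0) :
    GermForm θ (fun z => g z.swap) (fun z => B z.swap) (fun z => A z.swap) := by
  refine h.change hg (Φ := Prod.swap) (u := fun _ => 1) (L := ContinuousLinearEquiv.prodComm ℂ ℂ ℂ)
    (analyticAt_swap 0) rfl (ContinuousLinearEquiv.prodComm ℂ ℂ ℂ).hasFDerivAt analyticAt_const
    one_ne_zero h.1.swap (Eventually.of_forall fun z => ?_)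
  rw [one_smul]
  exact pullback_oneForm (ContinuousLinearEquiv.prodComm ℂ ℂ ℂ).hasFDerivAt (by simp) (by simp)

/-- The points near an isolated zero are regular. -/
theorem eventually_regular (h : GermForm θ g A B) (hg : AnalyticAt ℂ g 0) :
    ∀ᶠ c in 𝓝[≠] (0 : ℂ × ℂ), GermForm θ (fun z => g (z + c)) (fun z => A (z + c))
      (fun z => B (z + c)) ∧ (A c ≠ 0 ∨ B c ≠ 0) := by
  obtain ⟨hi, u, hu, hud, h1⟩ := h
  have hev := (hi.isolated.and (hi.left.eventually_analyticAt.and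
    (hi.right.eventually_analyticAt.and (hu.eventually_analyticAt.and
      (hg.eventually_analyticAt.and (hud.eventually_nhds.and h1.eventually_nhds)))))).filter_mono
        (nhdsWithin_le_nhds (s := {0}ᶜ))
  filter_upwards [hev, eventually_mem_nhdsWithin] with c hc hc0
  obtain ⟨h2, h3, h4, h5, h6, h7, h8⟩ := hc
  have hne : A c ≠ 0 ∨ B c ≠ 0 := by
    by_contra! hcon
    exact hc0 (h2 hcon.1 hcon.2)
  have ht : Tendsto (fun z : ℂ × ℂ => z + c) (𝓝 0) (𝓝 c) :=
    (by fun_prop : Continuous fun z : ℂ × ℂ => z + c).tendsto' _ _ (zero_add c)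
  have hsh : AnalyticAt ℂ (fun z : ℂ × ℂ => z + c) 0 := analyticAt_id.add analyticAt_const
  have hsh0 : (0 : ℂ × ℂ) + c = c := zero_add c
  have hA : AnalyticAt ℂ (fun z => A (z + c)) 0 := AnalyticAt.fun_comp (hsh0.symm ▸ h3) hsh
  have hB : AnalyticAt ℂ (fun z => B (z + c)) 0 := AnalyticAt.fun_comp (hsh0.symm ▸ h4) hsh
  refine ⟨⟨⟨hA, hB, ?_⟩, fun z => u (z + c), AnalyticAt.fun_comp (hsh0.symm ▸ h5) hsh, ?_, ?_⟩, hne⟩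
  · rcases hne with hne | hne
    · filter_upwards [hA.continuousAt.eventually_ne (show A (0 + c) ≠ 0 by rwa [hsh0])]
        with z hz hz' using absurd hz' hz
    · filter_upwards [hB.continuousAt.eventually_ne (show B (0 + c) ≠ 0 by rwa [hsh0])]
        with z hz _ hz' using absurd hz' hz
  · filter_upwards [ht.eventually h7] with z hz hz'
    refine hz ?_
    have hb : Tendsto (fun w : ℂ × ℂ => w - c) (𝓝 (z + c)) (𝓝 z) :=
      (by fun_prop : Continuous fun w : ℂ × ℂ => w - c).tendsto' _ _ (add_sub_cancel_right z c)
    filter_upwards [hb.eventually hz'] with w hw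
    simpa using hw
  · filter_upwards [ht.eventually h8, ht.eventually h6.eventually_analyticAt] with z h9 h10
    rw [pullback_comp θ (Φ := fun z => z + c) h10.differentiableAt (by fun_prop), h9]
    have : fderiv ℂ (fun z : ℂ × ℂ => z + c) z = ContinuousLinearMap.id ℂ (ℂ × ℂ) :=
      ((hasFDerivAt_id z).add_const c).fderiv
    rw [this]
    rfl

/-- Every local generator of a regular germ is regular. -/
theorem ne_zero_of_regular (h : GermForm θ g A B) (h0 : A 0 ≠ 0 ∨ B 0 ≠ 0)
    {η : ℂ × ℂ → (ℂ × ℂ →L[ℂ] ℂ)} (hη : AnalyticAt ℂ η 0) (hη0 : ∀ᶠ z in 𝓝[≠] 0, η z ≠ 0)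
    {v : ℂ × ℂ → ℂ} (hv : AnalyticAt ℂ v 0) (hvη : ∀ᶠ z in 𝓝 0, pullback θ g z = v z • η z) :
    η 0 ≠ 0 := by
  intro hz
  obtain ⟨hi, u, hu, hud, h1⟩ := h
  have hP : ∀ w : ℂ × ℂ, AnalyticAt ℂ (fun z => η z w) 0 := fun w =>
    ((ContinuousLinearMap.apply ℂ ℂ w).analyticAt _).comp hη
  have hA := hi.left
  have hB := hi.right
  -- let `C` be the component that does not vanish at the origin, and `D` the other one; then
  -- `η = (η w / C) • (C, D)`, so that the zeros of the function `η w / C` are zeros of `η`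
  have key : ∀ {C D : ℂ × ℂ → ℂ} {w w' : ℂ × ℂ}, AnalyticAt ℂ C 0 → AnalyticAt ℂ D 0 → C 0 ≠ 0 →
      (∀ᶠ z in 𝓝 0, u z * C z = v z * η z w) → (∀ᶠ z in 𝓝 0, u z * D z = v z * η z w') →
      (∀ z, η z w = 0 → η z w' = 0 → η z = 0) → False := by
    intro C D w w' hC hD hC0 h2 h3 h4
    have hvd : DenseNe v := by
      refine denseNe_of_analyticAt hv fun hv0 =>
        (hud.mul hu (denseNe_of_ne hC hC0)).not_eventually ?_
      filter_upwards [h2, hv0] with z h5 h6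
      rw [h5, h6, zero_mul]
    have hq : AnalyticAt ℂ (fun z => η z w / C z) 0 := (hP w).div hC hC0
    have h5 := eventually_eq_of_mul hvd (hP w') (g := fun z => η z w / C z * D z)
      (hq.fun_mul hD) (by
      filter_upwards [h2, h3, hC.continuousAt.eventually_ne hC0] with z h5 h6 h7
      rw [← h6]
      field_simp
      linear_combination (D z) * h5)
    rw [eventually_nhdsWithin_iff] at hη0
    obtain ⟨z, ⟨h6, h7⟩, h8, h9, h10⟩ := ((frequently_eq_zero hq (by simp [hz])).and_eventually
      (h5.and (hη0.and (hC.continuousAt.eventually_ne hC0)))).exists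
    refine h9 h6 (h4 z ?_ ?_)
    · exact (div_eq_zero_iff.1 h7).resolve_right h10
    · rw [h8, h7, zero_mul]
  have h2 : ∀ᶠ z in 𝓝 0, u z * A z = v z * η z (1, 0) ∧ u z * B z = v z * η z (0, 1) := by
    filter_upwards [h1, hvη] with z h3 h4
    rw [h3] at h4
    have h5 := DFunLike.congr_fun h4 (1, 0)
    have h6 := DFunLike.congr_fun h4 (0, 1)
    simp [oneForm] at h5 h6
    exact ⟨h5, h6⟩
  rcases h0 with h0 | h0
  · exact key hA hB h0 (h2.mono fun z h => h.1) (h2.mono fun z h => h.2) fun z h5 h6 =>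
      eq_zero_of_apply h5 h6
  · exact key hB hA h0 (h2.mono fun z h => h.2) (h2.mono fun z h => h.1) fun z h5 h6 =>
      eq_zero_of_apply h6 h5

end GermForm

/-! ### Centered charts -/

open ComplexSurface

section Charts

variable {S S' : ComplexSurface} {φ φ' : OpenPartialHomeomorph S (ℂ × ℂ)} {p : S}

theorem zero_mem_target (h : IsChartCenteredAt φ p) : (0 : ℂ × ℂ) ∈ φ.target :=
  h.2.2 ▸ φ.map_source h.2.1

theorem symm_zero (h : IsChartCenteredAt φ p) : φ.symm 0 = p := by
  rw [← h.2.2, φ.left_inv h.2.1]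

theorem analyticAt_comp_symm {f : S → ℂ × ℂ} (hf : ContMDiff 𝓘(ℂ, ℂ × ℂ) 𝓘(ℂ, ℂ × ℂ) ω f)
    (h : IsChartCenteredAt φ p) : AnalyticAt ℂ (fun w => f (φ.symm w)) 0 :=
  (contMDiffAt_iff_contDiffAt.1 ((hf _).comp (0 : ℂ × ℂ)
    (contMDiffAt_symm_of_mem_maximalAtlas h.1 (zero_mem_target h)))).analyticAt

/-- The transition map between two centered charts. -/
theorem exists_transition (h : IsChartCenteredAt φ p) (h' : IsChartCenteredAt φ' p) :
    ∃ (Φ : ℂ × ℂ → ℂ × ℂ) (L : (ℂ × ℂ) ≃L[ℂ] (ℂ × ℂ)), AnalyticAt ℂ Φ 0 ∧ Φ 0 = 0 ∧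
      HasFDerivAt Φ (L : ℂ × ℂ →L[ℂ] ℂ × ℂ) 0 ∧ ∀ᶠ z in 𝓝 0, φ.symm (Φ z) = φ'.symm z := by
  have key : ∀ {φ φ' : OpenPartialHomeomorph S (ℂ × ℂ)}, IsChartCenteredAt φ p →
      IsChartCenteredAt φ' p → AnalyticAt ℂ (fun z => φ (φ'.symm z)) 0 ∧ φ (φ'.symm 0) = 0 ∧
      ∀ᶠ z in 𝓝 0, φ.symm (φ (φ'.symm z)) = φ'.symm z := by
    intro φ φ' h h'
    have h0 := symm_zero h'
    refine ⟨(contMDiffAt_iff_contDiffAt.1 (ContMDiffAt.comp (0 : ℂ × ℂ)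
      (h0.symm ▸ contMDiffAt_of_mem_maximalAtlas h.1 h.2.1)
      (contMDiffAt_symm_of_mem_maximalAtlas h'.1 (zero_mem_target h')))).analyticAt,
      by rw [h0, h.2.2], ?_⟩
    have hc := φ'.continuousAt_symm (zero_mem_target h')
    filter_upwards [hc (h0.symm ▸ φ.open_source.mem_nhds h.2.1)] with z hz
    exact φ.left_inv hz
  obtain ⟨h1, h2, h3⟩ := key h h'
  obtain ⟨h4, h5, h6⟩ := key h' h
  have h7 : ∀ᶠ z in 𝓝 0, φ (φ'.symm (φ' (φ.symm z))) = z := by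
    filter_upwards [h6, φ.open_target.mem_nhds (zero_mem_target h)] with z h8 h9
    rw [h8, φ.right_inv h9]
  have h8 : ∀ᶠ z in 𝓝 0, φ' (φ.symm (φ (φ'.symm z))) = z := by
    filter_upwards [h3, φ'.open_target.mem_nhds (zero_mem_target h')] with z h8 h9
    rw [h8, φ'.right_inv h9]
  have hd : ∀ {F G : ℂ × ℂ → ℂ × ℂ}, AnalyticAt ℂ F 0 → AnalyticAt ℂ G 0 → F 0 = 0 →
      (∀ᶠ z in 𝓝 0, G (F z) = z) →
      (fderiv ℂ G 0).comp (fderiv ℂ F 0) = ContinuousLinearMap.id ℂ (ℂ × ℂ) := by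
    intro F G hF hG hF0 hev
    have h9 : HasFDerivAt (fun z => G (F z)) ((fderiv ℂ G 0).comp (fderiv ℂ F 0)) 0 :=
      HasFDerivAt.comp (0 : ℂ × ℂ) (by rw [hF0]; exact hG.differentiableAt.hasFDerivAt)
        hF.differentiableAt.hasFDerivAt
    exact h9.unique ((hasFDerivAt_id (𝕜 := ℂ) (0 : ℂ × ℂ)).congr_of_eventuallyEq hev)
  refine ⟨fun z => φ (φ'.symm z), .equivOfInverse (fderiv ℂ (fun z => φ (φ'.symm z)) 0)
    (fderiv ℂ (fun z => φ' (φ.symm z)) 0) (fun v => DFunLike.congr_fun (hd h1 h4 h2 h8) v)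
    (fun v => DFunLike.congr_fun (hd h4 h1 h5 h7) v), h1, h2,
    h1.differentiableAt.hasFDerivAt, h3⟩

/-- A local diffeomorphism lifts charts. -/
theorem exists_chart_of_isLocalDiffeomorphAt {σ : S' → S} {q : S'}
    (hσ : IsLocalDiffeomorphAt 𝓘(ℂ, ℂ × ℂ) 𝓘(ℂ, ℂ × ℂ) ω σ q) (h : IsChartCenteredAt φ (σ q)) :
    ∃ χ : OpenPartialHomeomorph S' (ℂ × ℂ), IsChartCenteredAt χ q ∧
      ∀ᶠ z in 𝓝 0, σ (χ.symm z) = φ.symm z := by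
  obtain ⟨Ψ, hq, hΨ⟩ := hσ
  have hΨq : Ψ q ∈ φ.source := by rw [← hΨ hq]; exact h.2.1
  have hc : IsChartCenteredAt (Ψ.toOpenPartialHomeomorph ≫ₕ φ) q := by
    refine ⟨OpenPartialHomeomorph.mem_maximalAtlas_of_contMDiffOn _ ?_ ?_, ?_, ?_⟩
    · exact (contMDiffOn_of_mem_maximalAtlas h.1).comp (Ψ.contMDiffOn_toFun.mono inter_subset_left)
        inter_subset_right
    · exact Ψ.contMDiffOn_invFun.comp
        ((contMDiffOn_symm_of_mem_maximalAtlas h.1).mono inter_subset_left) inter_subset_right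
    · exact ⟨hq, hΨq⟩
    · change φ (Ψ q) = 0
      rw [← hΨ hq]
      exact h.2.2
  refine ⟨_, hc, ?_⟩
  filter_upwards [(Ψ.toOpenPartialHomeomorph ≫ₕ φ).open_target.mem_nhds (zero_mem_target hc)]
    with z hz
  change σ (Ψ.symm (φ.symm z)) = φ.symm z
  have h1 : φ.symm z ∈ Ψ.target := hz.2
  exact (hΨ (Ψ.map_target h1)).trans (Ψ.right_inv h1)

/-- The inverse function theorem, in the form of a local homeomorphism analytic in both
directions. -/
theorem exists_openPartialHomeomorph {Φ : ℂ × ℂ → ℂ × ℂ} {L : (ℂ × ℂ) ≃L[ℂ] (ℂ × ℂ)}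
    (hΦ : AnalyticAt ℂ Φ 0) (hL : HasFDerivAt Φ (L : ℂ × ℂ →L[ℂ] ℂ × ℂ) 0) :
    ∃ E : OpenPartialHomeomorph (ℂ × ℂ) (ℂ × ℂ), (0 : ℂ × ℂ) ∈ E.source ∧ (∀ z, E z = Φ z) ∧
      ContDiffOn ℂ ω E E.source ∧ ContDiffOn ℂ ω E.symm E.target := by
  have hC : ContDiffAt ℂ ω Φ 0 := hΦ.contDiffAt
  set E := hC.toOpenPartialHomeomorph Φ hL (by simp) with hE
  have hinv : ContDiffAt ℂ ω E.symm (Φ 0) := hC.to_localInverse hL (by simp)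
  have h0 : (0 : ℂ × ℂ) ∈ E.source := hC.mem_toOpenPartialHomeomorph_source hL (by simp)
  have ht : (0 : ℂ × ℂ) ∈ E.source ∩ E ⁻¹' {z | AnalyticAt ℂ E.symm z} := ⟨h0, hinv.analyticAt⟩
  have ho : IsOpen ({z | AnalyticAt ℂ Φ z} ∩ (E.source ∩ E ⁻¹' {z | AnalyticAt ℂ E.symm z})) :=
    (isOpen_analyticAt ℂ Φ).inter (E.isOpen_inter_preimage (isOpen_analyticAt ℂ E.symm))
  refine ⟨E.restrOpen _ ho, ⟨h0, hΦ, ht⟩, fun z => rfl, fun z hz => ?_, fun z hz => ?_⟩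
  · exact (show AnalyticAt ℂ Φ z from hz.2.1).contDiffAt.contDiffWithinAt
  · have h1 : AnalyticAt ℂ E.symm (E (E.symm z)) := hz.2.2.2
    rw [E.right_inv hz.1] at h1
    exact h1.contDiffAt.contDiffWithinAt

/-- Change of coordinates by an analytic map with invertible derivative. -/
theorem exists_chart_comp (h : IsChartCenteredAt φ p) {Φ : ℂ × ℂ → ℂ × ℂ}
    {L : (ℂ × ℂ) ≃L[ℂ] (ℂ × ℂ)} (hΦ : AnalyticAt ℂ Φ 0) (hΦ0 : Φ 0 = 0)
    (hL : HasFDerivAt Φ (L : ℂ × ℂ →L[ℂ] ℂ × ℂ) 0) :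
    ∃ χ : OpenPartialHomeomorph S (ℂ × ℂ), IsChartCenteredAt χ p ∧
      ∀ z, χ.symm z = φ.symm (Φ z) := by
  obtain ⟨E, h0, hE, hE1, hE2⟩ := exists_openPartialHomeomorph hΦ hL
  refine ⟨φ ≫ₕ E.symm, ⟨OpenPartialHomeomorph.mem_maximalAtlas_of_contMDiffOn _ ?_ ?_, ?_, ?_⟩,
    fun z => congrArg φ.symm (hE z)⟩
  · exact hE2.contMDiffOn.comp ((contMDiffOn_of_mem_maximalAtlas h.1).mono inter_subset_left)
      inter_subset_right
  · exact (contMDiffOn_symm_of_mem_maximalAtlas h.1).comp (hE1.contMDiffOn.mono inter_subset_left)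
      inter_subset_right
  · refine ⟨h.2.1, ?_⟩
    change φ p ∈ E.target
    rw [h.2.2, ← hΦ0, ← hE]
    exact E.map_source h0
  · change E.symm (φ p) = 0
    rw [h.2.2, show (0 : ℂ × ℂ) = E 0 by rw [hE, hΦ0], E.left_inv h0]
    exact ((hE 0).trans hΦ0).symm

theorem exists_chart_translate (h : φ ∈ IsManifold.maximalAtlas 𝓘(ℂ, ℂ × ℂ) ω S)
    (hp : p ∈ φ.source) : ∃ χ : OpenPartialHomeomorph S (ℂ × ℂ), IsChartCenteredAt χ p ∧
      ∀ z, χ.symm z = φ.symm (z + φ p) := by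
  have h1 : ContMDiff 𝓘(ℂ, ℂ × ℂ) 𝓘(ℂ, ℂ × ℂ) ω fun z : ℂ × ℂ => z + -φ p :=
    (contDiff_id.add contDiff_const).contMDiff
  have h2 : ContMDiff 𝓘(ℂ, ℂ × ℂ) 𝓘(ℂ, ℂ × ℂ) ω fun z : ℂ × ℂ => z + φ p :=
    (contDiff_id.add contDiff_const).contMDiff
  refine ⟨φ ≫ₕ (Homeomorph.addRight (-φ p)).toOpenPartialHomeomorph,
    ⟨OpenPartialHomeomorph.mem_maximalAtlas_of_contMDiffOn _ ?_ ?_, ⟨hp, mem_univ _⟩, ?_⟩,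
    fun z => ?_⟩
  · exact h1.comp_contMDiffOn ((contMDiffOn_of_mem_maximalAtlas h).mono inter_subset_left)
  · refine (contMDiffOn_symm_of_mem_maximalAtlas h).comp
      (f := fun z : ℂ × ℂ => z + - -φ p) ?_ inter_subset_right
    rw [neg_neg]
    exact h2.contMDiffOn
  · exact add_neg_cancel _
  · change φ.symm (z + - -φ p) = _
    rw [neg_neg]

end Charts

/-! ### Local forms of the transformed foliation -/

/-- In some chart centered on `p`, the transform by `f` of the foliation defined by `θ` is defined
by the `1`-form `A dx + B dy`. -/
def HasLocalForm (θ : ℂ × ℂ → (ℂ × ℂ →L[ℂ] ℂ)) {S : ComplexSurface} (f : S → ℂ × ℂ) (p : S)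
    (A B : ℂ × ℂ → ℂ) : Prop :=
  ∃ φ : OpenPartialHomeomorph S (ℂ × ℂ), IsChartCenteredAt φ p ∧
    GermForm θ (fun w => f (φ.symm w)) A B

/-- The transformed foliation is regular at `p`. -/
def IsRegularAt (θ : ℂ × ℂ → (ℂ × ℂ →L[ℂ] ℂ)) {S : ComplexSurface} (f : S → ℂ × ℂ) (p : S) : Prop :=
  ∃ A B, HasLocalForm θ f p A B ∧ (A 0 ≠ 0 ∨ B 0 ≠ 0)

/-- The transformed foliation is regular at `p` or has one of the two final forms. -/
def IsReducedAt (θ : ℂ × ℂ → (ℂ × ℂ →L[ℂ] ℂ)) {S : ComplexSurface} (f : S → ℂ × ℂ) (p : S) : Prop :=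
  ∃ A B, HasLocalForm θ f p A B ∧ ((A 0 ≠ 0 ∨ B 0 ≠ 0) ∨
    (IsNonresonantForm (oneForm A B) ∨ IsSaddleNodeForm (oneForm A B)))

section LocalForm

variable {θ : ℂ × ℂ → (ℂ × ℂ →L[ℂ] ℂ)} {S S' : ComplexSurface} {f : S → ℂ × ℂ} {p : S}
  {A B : ℂ × ℂ → ℂ}

/-- Local forms are preserved by maps that are biholomorphic at the point. -/
theorem HasLocalForm.comp {σ : S' → S} {q : S'}
    (hσ : IsLocalDiffeomorphAt 𝓘(ℂ, ℂ × ℂ) 𝓘(ℂ, ℂ × ℂ) ω σ q) (h : HasLocalForm θ f (σ q) A B) :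
    HasLocalForm θ (f ∘ σ) q A B := by
  obtain ⟨φ, hφ, h⟩ := h
  obtain ⟨χ, hχ, h1⟩ := exists_chart_of_isLocalDiffeomorphAt hσ hφ
  exact ⟨χ, hχ, h.congr (h1.mono fun z hz => congrArg f hz.symm)⟩

theorem IsRegularAt.comp {σ : S' → S} {q : S'}
    (hσ : IsLocalDiffeomorphAt 𝓘(ℂ, ℂ × ℂ) 𝓘(ℂ, ℂ × ℂ) ω σ q) (h : IsRegularAt θ f (σ q)) :
    IsRegularAt θ (f ∘ σ) q :=
  let ⟨A, B, h1, h2⟩ := h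
  ⟨A, B, h1.comp hσ, h2⟩

theorem IsReducedAt.comp {σ : S' → S} {q : S'}
    (hσ : IsLocalDiffeomorphAt 𝓘(ℂ, ℂ × ℂ) 𝓘(ℂ, ℂ × ℂ) ω σ q) (h : IsReducedAt θ f (σ q)) :
    IsReducedAt θ (f ∘ σ) q :=
  let ⟨A, B, h1, h2⟩ := h
  ⟨A, B, h1.comp hσ, h2⟩

theorem HasLocalForm.isolatedForm (h : HasLocalForm θ f p A B) : IsolatedForm A B :=
  let ⟨_, _, h⟩ := h
  h.1

theorem IsRegularAt.isReducedAt (h : IsRegularAt θ f p) : IsReducedAt θ f p :=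
  let ⟨A, B, h1, h2⟩ := h
  ⟨A, B, h1, .inl h2⟩

/-- A local form exists in every centered chart once it exists in one. -/
theorem HasLocalForm.exists_germForm (hf : ContMDiff 𝓘(ℂ, ℂ × ℂ) 𝓘(ℂ, ℂ × ℂ) ω f)
    (h : HasLocalForm θ f p A B)
    {φ : OpenPartialHomeomorph S (ℂ × ℂ)} (hφ : IsChartCenteredAt φ p) :
    ∃ A' B', GermForm θ (fun w => f (φ.symm w)) A' B' ∧
      (A 0 ≠ 0 ∨ B 0 ≠ 0 → A' 0 ≠ 0 ∨ B' 0 ≠ 0) := by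
  obtain ⟨φ', hφ', h⟩ := h
  obtain ⟨Φ, L, hΦ, hΦ0, hL, h1⟩ := exists_transition hφ' hφ
  obtain ⟨A', B', h2, h3⟩ := h.exists_comp (analyticAt_comp_symm hf hφ') hΦ hΦ0 hL
  exact ⟨A', B', h2.congr (h1.mono fun z hz => congrArg f hz), h3⟩

theorem HasLocalForm.change (hf : ContMDiff 𝓘(ℂ, ℂ × ℂ) 𝓘(ℂ, ℂ × ℂ) ω f)
    (h : HasLocalForm θ f p A B) {Φ : ℂ × ℂ → ℂ × ℂ}
    {u A' B' : ℂ × ℂ → ℂ} {L : (ℂ × ℂ) ≃L[ℂ] (ℂ × ℂ)} (hΦ : AnalyticAt ℂ Φ 0) (hΦ0 : Φ 0 = 0)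
    (hL : HasFDerivAt Φ (L : ℂ × ℂ →L[ℂ] ℂ × ℂ) 0) (hu : AnalyticAt ℂ u 0) (hu0 : u 0 ≠ 0)
    (hi : IsolatedForm A' B')
    (h1 : ∀ᶠ z in 𝓝 0, pullback (oneForm A B) Φ z = u z • oneForm A' B' z) :
    HasLocalForm θ f p A' B' := by
  obtain ⟨φ, hφ, h⟩ := h
  obtain ⟨χ, hχ, h2⟩ := exists_chart_comp hφ hΦ hΦ0 hL
  exact ⟨χ, hχ, (h.change (analyticAt_comp_symm hf hφ) hΦ hΦ0 hL hu hu0 hi h1).congr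
    (Eventually.of_forall fun z => congrArg f (h2 z).symm)⟩

/-- The singular points of the transformed foliation are isolated. -/
theorem HasLocalForm.eventually_isRegularAt (hf : ContMDiff 𝓘(ℂ, ℂ × ℂ) 𝓘(ℂ, ℂ × ℂ) ω f)
    (h : HasLocalForm θ f p A B) :
    ∀ᶠ q in 𝓝[≠] p, IsRegularAt θ f q := by
  obtain ⟨φ, hφ, h⟩ := h
  have h1 := h.eventually_regular (analyticAt_comp_symm hf hφ)
  have ht : Tendsto φ (𝓝[≠] p) (𝓝[≠] 0) := by
    refine tendsto_nhdsWithin_iff.2 ⟨?_, ?_⟩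
    · have := (φ.continuousAt hφ.2.1).tendsto
      rw [hφ.2.2] at this
      exact this.mono_left nhdsWithin_le_nhds
    · filter_upwards [eventually_mem_nhdsWithin, mem_nhdsWithin_of_mem_nhds
        (φ.open_source.mem_nhds hφ.2.1)] with q hq hq' h2
      exact hq (φ.injOn hq' hφ.2.1 (h2.trans hφ.2.2.symm))
  filter_upwards [ht.eventually h1, mem_nhdsWithin_of_mem_nhds (φ.open_source.mem_nhds hφ.2.1)]
    with q h2 h3
  obtain ⟨χ, hχ, h4⟩ := exists_chart_translate hφ.1 h3
  refine ⟨_, _, ⟨χ, hχ, h2.1.congr (Eventually.of_forall fun z => congrArg f (h4 z).symm)⟩, ?_⟩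
  simpa using h2.2

end LocalForm

theorem GermForm.isTransform {θ : ℂ × ℂ → (ℂ × ℂ →L[ℂ] ℂ)} {S : ComplexSurface} {f : S → ℂ × ℂ}
    {φ : OpenPartialHomeomorph S (ℂ × ℂ)} {A B : ℂ × ℂ → ℂ}
    (h : GermForm θ (fun w => f (φ.symm w)) A B) : IsTransform θ f φ (oneForm A B) := by
  obtain ⟨hi, u, hu, -, h1⟩ := h
  refine ⟨(hi.left.smul analyticAt_const).add (hi.right.smul analyticAt_const), ?_, u, hu, h1⟩
  rw [eventually_nhdsWithin_iff]
  filter_upwards [hi.isolated] with z hz h2 h3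
  exact h2 (hz (GermForm.oneForm_eq_zero h3).1 (GermForm.oneForm_eq_zero h3).2)

/-! ### The order of the transformed foliation -/

section Order

theorem order_le {E : Type*} [NormedAddCommGroup E] [NormedSpace ℂ E] {f : ℂ × ℂ → E} {n : ℕ}
    (h : iteratedFDeriv ℂ n f 0 ≠ 0) : order f ≤ n := iInf₂_le n h

theorem order_eq_zero {E : Type*} [NormedAddCommGroup E] [NormedSpace ℂ E] {f : ℂ × ℂ → E}
    (h : f 0 ≠ 0) : order f = 0 := by
  refine le_antisymm (order_le (n := 0) fun h0 => h ?_) zero_le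
  simpa using DFunLike.congr_fun h0 0

theorem eq_zero_of_one_le_order {f : ℂ × ℂ → ℂ} (h : 1 ≤ order f) : f 0 = 0 := by
  by_contra h0
  rw [order_eq_zero h0] at h
  exact absurd h (by simp)

theorem order_le_one {E : Type*} [NormedAddCommGroup E] [NormedSpace ℂ E] {f : ℂ × ℂ → E}
    (h : fderiv ℂ f 0 ≠ 0) : order f ≤ 1 := by
  refine order_le (n := 1) fun h0 => h ?_
  refine ContinuousLinearMap.ext fun v => ?_
  have h1 : iteratedFDeriv ℂ 1 f 0 (fun _ => v) = 0 := by rw [h0]; rfl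
  rwa [iteratedFDeriv_one_apply] at h1

theorem fderiv_eq_zero_of_two_le_order {f : ℂ × ℂ → ℂ} (h : 2 ≤ order f) : fderiv ℂ f 0 = 0 := by
  by_contra h0
  exact absurd (h.trans (order_le_one h0)) (by decide)

theorem order_le_one_of_final {η : ℂ × ℂ → (ℂ × ℂ →L[ℂ] ℂ)} (hη : AnalyticAt ℂ η 0)
    (h : IsNonresonantForm η ∨ IsSaddleNodeForm η) : order η ≤ 1 := by
  -- the coefficient of `du` has a nonzero linear part
  suffices hs : ∃ (F : ℂ × ℂ → ℂ) (F' : ℂ × ℂ →L[ℂ] ℂ), HasFDerivAt F F' 0 ∧ F' (0, 1) ≠ 0 ∧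
      ∀ᶠ z in 𝓝 0, η z (1, 0) = F z by
    obtain ⟨F, F', h1, h2, h3⟩ := hs
    refine order_le_one fun h0 => h2 ?_
    have h4 : HasFDerivAt η (0 : ℂ × ℂ →L[ℂ] (ℂ × ℂ →L[ℂ] ℂ)) 0 := by
      rw [← h0]; exact hη.differentiableAt.hasFDerivAt
    have h5 := (h4.clm_apply (hasFDerivAt_const ((1, 0) : ℂ × ℂ) (0 : ℂ × ℂ)))
    rw [h1.unique (h5.congr_of_eventuallyEq (h3.mono fun z hz => hz.symm))]
    simp
  rcases h with ⟨l₁, l₂, hl, -, -, f, g, hf, -, hf1, -, h⟩ | ⟨f, g, hf, -, hf2, -, h⟩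
  · refine ⟨fun w => (l₁ + f w) * w.2, _,
      (hf.differentiableAt.hasFDerivAt.const_add l₁).mul hasFDerivAt_snd, ?_, ?_⟩
    · simpa [eq_zero_of_one_le_order hf1] using (left_ne_zero_of_mul hl)
    · filter_upwards [h] with z hz
      simp [hz, oneForm]
  · refine ⟨fun w => w.2 + f w, _, hasFDerivAt_snd.add hf.differentiableAt.hasFDerivAt, ?_, ?_⟩
    · simp [fderiv_eq_zero_of_two_le_order hf2]
    · filter_upwards [h] with z hz
      simp [hz, oneForm]

variable {θ : ℂ × ℂ → (ℂ × ℂ →L[ℂ] ℂ)} {S : ComplexSurface} {f : S → ℂ × ℂ} {p : S}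

/-- The order one is the order of some local generator, in some chart; it is not attained at a
regular point. -/
theorem IsRegularAt.not_hasOrderAt_one (hf : ContMDiff 𝓘(ℂ, ℂ × ℂ) 𝓘(ℂ, ℂ × ℂ) ω f)
    (h : IsRegularAt θ f p) : ¬ HasOrderAt θ f p 1 := by
  rintro ⟨φ, hφ, η, ⟨h1, h2, u, hu, h3⟩, h4⟩
  obtain ⟨A, B, h5, h6⟩ := h
  obtain ⟨A', B', h7, h8⟩ := h5.exists_germForm hf hφ
  rw [order_eq_zero (h7.ne_zero_of_regular (h8 h6) h1 h2 hu h3)] at h4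
  exact absurd h4 (by simp)

theorem IsReducedAt.exists_hasOrderAt (h : IsReducedAt θ f p) : ∃ k ≤ 1, HasOrderAt θ f p k := by
  obtain ⟨A, B, ⟨φ, hφ, h1⟩, h2⟩ := h
  refine ⟨order (oneForm A B), ?_, φ, hφ, _, h1.isTransform, rfl⟩
  rcases h2 with h2 | h2
  · rw [order_eq_zero]
    · exact zero_le
    · intro h0
      obtain ⟨h3, h4⟩ := GermForm.oneForm_eq_zero h0
      simp [h3, h4] at h2
  · exact order_le_one_of_final h1.isTransform.1 h2

theorem IsReducedAt.hasFinalForm (hf : ContMDiff 𝓘(ℂ, ℂ × ℂ) 𝓘(ℂ, ℂ × ℂ) ω f)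
    (h : IsReducedAt θ f p) (h1 : HasOrderAt θ f p 1) : HasFinalForm θ f p := by
  obtain ⟨A, B, h2, h3⟩ := h
  rcases h3 with h3 | h3
  · exact absurd h1 (IsRegularAt.not_hasOrderAt_one hf ⟨A, B, h2, h3⟩)
  · obtain ⟨φ, hφ, h2⟩ := h2
    exact ⟨φ, hφ, _, h2.isTransform, h3⟩

end Order

/-! ### The exceptional divisor of a blow-up -/

open ComplexSurface

/-- `φ`, `ψ₀`, `ψ₁` are coordinate systems in which `σ` is the standard blow-up, as in the
definition of `IsBlowUpAt`. -/
structure IsBlowUpCharts {S' S : ComplexSurface} (p : S) (σ : S' → S)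
    (φ : OpenPartialHomeomorph S (ℂ × ℂ)) (ψ₀ ψ₁ : OpenPartialHomeomorph S' (ℂ × ℂ)) : Prop where
  centered : IsChartCenteredAt φ p
  mem_atlas₀ : ψ₀ ∈ IsManifold.maximalAtlas 𝓘(ℂ, ℂ × ℂ) ω S'
  mem_atlas₁ : ψ₁ ∈ IsManifold.maximalAtlas 𝓘(ℂ, ℂ × ℂ) ω S'
  source : ψ₀.source ∪ ψ₁.source = σ ⁻¹' φ.source
  target₀ : ψ₀.target = {z | (z.1, z.2 * z.1) ∈ φ.target}
  target₁ : ψ₁.target = {z | (z.1 * z.2, z.2) ∈ φ.target}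
  eq₀ : ∀ a ∈ ψ₀.source, φ (σ a) = ((ψ₀ a).1, (ψ₀ a).2 * (ψ₀ a).1)
  eq₁ : ∀ a ∈ ψ₁.source, φ (σ a) = ((ψ₁ a).1 * (ψ₁ a).2, (ψ₁ a).2)
  mem_iff₀ : ∀ a ∈ ψ₀.source, a ∈ ψ₁.source ↔ (ψ₀ a).2 ≠ 0
  mem_iff₁ : ∀ a ∈ ψ₁.source, a ∈ ψ₀.source ↔ (ψ₁ a).1 ≠ 0
  transition : ∀ a ∈ ψ₀.source ∩ ψ₁.source, ψ₁ a = ((ψ₀ a).2⁻¹, (ψ₀ a).2 * (ψ₀ a).1)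

/-- Off a set `Z` of centers, `σ` is bijective and a local diffeomorphism. -/
def IsIsoOff {S' S : ComplexSurface} (σ : S' → S) (Z : Set S) : Prop :=
  ∀ x ∉ Z, ∃ y, σ y = x ∧ (∀ y', σ y' = x → y' = y) ∧
    IsLocalDiffeomorphAt 𝓘(ℂ, ℂ × ℂ) 𝓘(ℂ, ℂ × ℂ) ω σ y

section

variable {S' S : ComplexSurface} {p : S} {σ : S' → S}

theorem IsIsoOff.isLocalDiffeomorphAt {Z : Set S} (h : IsIsoOff σ Z) {y : S'} (hy : σ y ∉ Z) :
    IsLocalDiffeomorphAt 𝓘(ℂ, ℂ × ℂ) 𝓘(ℂ, ℂ × ℂ) ω σ y := by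
  obtain ⟨y', -, h1, h2⟩ := h _ hy
  rwa [h1 y rfl]

theorem IsIsoOff.injOn {Z : Set S} (h : IsIsoOff σ Z) : InjOn σ (σ ⁻¹' Zᶜ) := by
  intro y hy y' hy' he
  obtain ⟨y₀, -, h1, -⟩ := h _ hy
  rw [h1 y rfl, h1 y' he.symm]

theorem isIsoOff_id (Z : Set S) : IsIsoOff (id : S → S) Z := fun x _ =>
  ⟨x, rfl, fun _ h => h, ⟨⟨PartialEquiv.refl _, isOpen_univ, isOpen_univ, contMDiffOn_id,
    contMDiffOn_id⟩, mem_univ _, fun _ _ => rfl⟩⟩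

theorem IsIsoOff.comp {S'' : ComplexSurface} {σ' : S'' → S'} {Z : Set S} {Z' : Set S'}
    (h : IsIsoOff σ Z) (h' : IsIsoOff σ' Z') (hZ : ∀ y ∈ Z', σ y ∈ Z) :
    IsIsoOff (σ ∘ σ') Z := by
  intro x hx
  obtain ⟨y, rfl, h1, h2⟩ := h x hx
  obtain ⟨z, rfl, h3, h4⟩ := h' y fun hy => hx (hZ y hy)
  exact ⟨z, rfl, fun z' hz' => h3 _ (h1 _ hz'), h4.comp _ _ h2⟩

theorem IsIsoOff.mono {Z Z' : Set S} (h : IsIsoOff σ Z) (hZ : Z ⊆ Z') : IsIsoOff σ Z' :=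
  fun x hx => h x fun hx' => hx (hZ hx')

theorem _root_.ComplexSurface.IsBlowUpAt.isIsoOff (h : IsBlowUpAt p σ) : IsIsoOff σ {p} := by
  intro x hx
  obtain ⟨y, hy, rfl⟩ := h.2.1.surjOn (show x ∈ ({p} : Set S)ᶜ from hx)
  exact ⟨y, rfl, fun y' hy' =>
    h.2.1.injOn (show σ y' ∈ ({p} : Set S)ᶜ by rw [hy']; exact hx) hx hy', h.2.2.1 ⟨y, hy⟩⟩

theorem _root_.ComplexSurface.IsBlowUpAt.exists_charts (h : IsBlowUpAt p σ) :
    ∃ φ ψ₀ ψ₁, IsBlowUpCharts p σ φ ψ₀ ψ₁ := by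
  obtain ⟨-, -, -, φ, h0, ψ₀, h1, ψ₁, h2, h3, h4, h5, h6, h7, h8, h9, h10⟩ := h
  exact ⟨φ, ψ₀, ψ₁, h0, h1, h2, h3, h4, h5, h6, h7, h8, h9, h10⟩

namespace IsBlowUpCharts

variable {φ : OpenPartialHomeomorph S (ℂ × ℂ)} {ψ₀ ψ₁ : OpenPartialHomeomorph S' (ℂ × ℂ)}
  {θ : ℂ × ℂ → (ℂ × ℂ →L[ℂ] ℂ)} {f : S → ℂ × ℂ} {A B : ℂ × ℂ → ℂ}

theorem source_subset₀ (h : IsBlowUpCharts p σ φ ψ₀ ψ₁) {a : S'} (ha : a ∈ ψ₀.source) :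
    σ a ∈ φ.source := by
  have := h.source.subset (.inl ha)
  exact this

theorem source_subset₁ (h : IsBlowUpCharts p σ φ ψ₀ ψ₁) {a : S'} (ha : a ∈ ψ₁.source) :
    σ a ∈ φ.source := by
  have := h.source.subset (.inr ha)
  exact this

theorem fst_eq_zero (h : IsBlowUpCharts p σ φ ψ₀ ψ₁) {q : S'} (hq : σ q = p) (h₀ : q ∈ ψ₀.source) :
    (ψ₀ q).1 = 0 := by
  have h1 := h.eq₀ q h₀
  rw [hq, h.centered.2.2] at h1
  exact (congrArg Prod.fst h1).symm

theorem snd_eq_zero (h : IsBlowUpCharts p σ φ ψ₀ ψ₁) {q : S'} (hq : σ q = p) (h₁ : q ∈ ψ₁.source) :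
    (ψ₁ q).2 = 0 := by
  have h1 := h.eq₁ q h₁
  rw [hq, h.centered.2.2] at h1
  exact (congrArg Prod.snd h1).symm

/-- A point of the exceptional divisor has a slope, or is the origin of the second coordinate
system. -/
theorem mem_source_or (h : IsBlowUpCharts p σ φ ψ₀ ψ₁) {q : S'} (hq : σ q = p) :
    q ∈ ψ₀.source ∨ q ∈ ψ₁.source ∧ ψ₁ q = 0 := by
  have hs : q ∈ ψ₀.source ∪ ψ₁.source := by
    rw [h.source, mem_preimage, hq]; exact h.centered.2.1
  by_cases h₀ : q ∈ ψ₀.source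
  · exact .inl h₀
  have h₁ := hs.resolve_left h₀
  rw [h.mem_iff₁ q h₁, not_not] at h₀
  exact .inr ⟨h₁, Prod.ext h₀ (h.snd_eq_zero hq h₁)⟩

/-- The transforms at the points of the exceptional divisor: the point of slope `t` and the point at
infinity. -/
theorem hasLocalForm (h : IsBlowUpCharts p σ φ ψ₀ ψ₁)
    (hf : ContMDiff 𝓘(ℂ, ℂ × ℂ) 𝓘(ℂ, ℂ × ℂ) ω f) (hg : GermForm θ (fun w => f (φ.symm w)) A B)
    {K : ℂ → ℕ} {A' B' : ℂ → ℂ × ℂ → ℂ} (h0 : ∀ t, IsBlowUpForm (K t) t A B (A' t) (B' t))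
    {K' : ℕ} {A'' B'' : ℂ × ℂ → ℂ}
    (h1 : IsBlowUpForm K' 0 (fun z => B z.swap) (fun z => A z.swap) A'' B'') {q : S'}
    (hq : σ q = p) :
    (∃ t, HasLocalForm θ (f ∘ σ) q (A' t) (B' t)) ∨ HasLocalForm θ (f ∘ σ) q A'' B'' := by
  have hfa := analyticAt_comp_symm hf h.centered
  rcases h.mem_source_or hq with h₀ | ⟨h₁, h2⟩
  · left
    obtain ⟨χ, hχ, h2⟩ := exists_chart_translate h.mem_atlas₀ h₀
    refine ⟨(ψ₀ q).2, χ, hχ, (hg.blowUp hfa (h0 _)).congr ?_⟩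
    have ht : Tendsto (fun z => z + ψ₀ q) (𝓝 0) (𝓝 (ψ₀ q)) :=
      (by fun_prop : Continuous fun z : ℂ × ℂ => z + ψ₀ q).tendsto' _ _ (zero_add _)
    filter_upwards [ht.eventually (ψ₀.open_target.mem_nhds (ψ₀.map_source h₀))] with z hz
    have h3 := ψ₀.map_target hz
    have h4 := h.eq₀ _ h3
    rw [ψ₀.right_inv hz] at h4
    have h5 : blowChart (ψ₀ q).2 z = φ (σ (ψ₀.symm (z + ψ₀ q))) := by
      rw [h4]
      simp [blowChart, h.fst_eq_zero hq h₀, add_comm]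
    rw [h5, φ.left_inv (h.source_subset₀ h3), ← h2]
    rfl
  · right
    obtain ⟨χ, hχ, h3⟩ := exists_chart_comp ⟨h.mem_atlas₁, h₁, h2⟩ (Φ := Prod.swap)
      (L := ContinuousLinearEquiv.prodComm ℂ ℂ ℂ) (analyticAt_swap 0) rfl
      (ContinuousLinearEquiv.prodComm ℂ ℂ ℂ).hasFDerivAt
    have hsw : AnalyticAt ℂ (fun z : ℂ × ℂ => f (φ.symm z.swap)) 0 :=
      AnalyticAt.fun_comp (g := fun w => f (φ.symm w)) (f := Prod.swap) hfa (analyticAt_swap 0)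
    refine ⟨χ, hχ, ((hg.swap hfa).blowUp hsw h1).congr ?_⟩
    have ht0 : (0 : ℂ × ℂ) ∈ ψ₁.target := h2 ▸ ψ₁.map_source h₁
    filter_upwards [tendsto_swap.eventually (ψ₁.open_target.mem_nhds ht0)] with z hz
    have h4 := ψ₁.map_target hz
    have h5 := h.eq₁ _ h4
    rw [ψ₁.right_inv hz] at h5
    have h6 : (blowChart 0 z).swap = φ (σ (ψ₁.symm z.swap)) := by
      rw [h5]
      simp [blowChart]
    rw [h6, φ.left_inv (h.source_subset₁ h4), ← h3]
    rfl

theorem exists_hasLocalForm (h : IsBlowUpCharts p σ φ ψ₀ ψ₁)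
    (hf : ContMDiff 𝓘(ℂ, ℂ × ℂ) 𝓘(ℂ, ℂ × ℂ) ω f) (hA : HasLocalForm θ f p A B) {q : S'}
    (hq : σ q = p) : ∃ A' B', HasLocalForm θ (f ∘ σ) q A' B' := by
  obtain ⟨A₁, B₁, hg, -⟩ := hA.exists_germForm hf h.centered
  choose K A' B' h0 using fun t => exists_isBlowUpForm hg.1 t
  obtain ⟨K', A'', B'', h1⟩ := exists_isBlowUpForm hg.1.swap 0
  rcases h.hasLocalForm hf hg h0 h1 hq with ⟨t, h2⟩ | h2
  exacts [⟨_, _, h2⟩, ⟨_, _, h2⟩]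

/-- The exceptional divisor is the union of two closed disks. -/
theorem isCompact_fiber (h : IsBlowUpCharts p σ φ ψ₀ ψ₁) : IsCompact {q | σ q = p} := by
  have hz := zero_mem_target h.centered
  have hz0 : ∀ t, ((0 : ℂ), t) ∈ ψ₀.target := fun t => by
    rw [h.target₀, mem_ofPred_eq, mul_zero]; exact hz
  have hz1 : ∀ t, (t, (0 : ℂ)) ∈ ψ₁.target := fun t => by
    rw [h.target₁, mem_ofPred_eq, mul_zero]; exact hz
  have hinj : ∀ {q}, σ q ∈ φ.source → φ (σ q) = 0 → σ q = p := fun h1 h2 =>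
    φ.injOn h1 h.centered.2.1 (h2.trans h.centered.2.2.symm)
  have hE : {q | σ q = p} = ψ₀.symm '' ({0} ×ˢ Metric.closedBall 0 1) ∪
      ψ₁.symm '' (Metric.closedBall 0 1 ×ˢ {0}) := by
    ext q
    constructor
    · intro hq
      rcases h.mem_source_or hq with h₀ | ⟨h₁, h2⟩
      · have h1 := h.fst_eq_zero hq h₀
        by_cases ht : ‖(ψ₀ q).2‖ ≤ 1
        · exact .inl ⟨ψ₀ q, ⟨h1, by simpa using ht⟩, ψ₀.left_inv h₀⟩
        · have ht0 : (ψ₀ q).2 ≠ 0 := by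
            intro h0
            simp [h0] at ht
          have h₁ := (h.mem_iff₀ q h₀).2 ht0
          refine .inr ⟨ψ₁ q, ⟨?_, h.snd_eq_zero hq h₁⟩, ψ₁.left_inv h₁⟩
          rw [h.transition q ⟨h₀, h₁⟩, mem_closedBall_zero_iff, norm_inv]
          exact inv_le_one_of_one_le₀ (not_le.1 ht).le
      · exact .inr ⟨ψ₁ q, by simp [h2], ψ₁.left_inv h₁⟩
    · rintro (⟨⟨x, t⟩, ⟨hx, -⟩, rfl⟩ | ⟨⟨s, y⟩, ⟨-, hy⟩, rfl⟩)
      · obtain rfl : x = 0 := hx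
        have h1 := ψ₀.map_target (hz0 t)
        refine hinj (h.source_subset₀ h1) ?_
        rw [h.eq₀ _ h1, ψ₀.right_inv (hz0 t), mul_zero]
        rfl
      · obtain rfl : y = 0 := hy
        have h1 := ψ₁.map_target (hz1 s)
        refine hinj (h.source_subset₁ h1) ?_
        rw [h.eq₁ _ h1, ψ₁.right_inv (hz1 s), mul_zero]
        rfl
  rw [hE]
  have hb : IsCompact (Metric.closedBall (0 : ℂ) 1) := isCompact_closedBall 0 1
  refine ((isCompact_singleton.prod hb).image_of_continuousOn (ψ₀.continuousOn_symm.mono ?_)).union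
    ((hb.prod isCompact_singleton).image_of_continuousOn (ψ₁.continuousOn_symm.mono ?_))
  · rintro ⟨x, t⟩ ⟨hx, -⟩
    obtain rfl : x = 0 := hx
    exact hz0 t
  · rintro ⟨s, y⟩ ⟨-, hy⟩
    obtain rfl : y = 0 := hy
    exact hz1 s

/-- The exceptional divisor is compact and singular points are isolated, so it carries finitely many
of them. -/
theorem finite_not_isRegularAt (h : IsBlowUpCharts p σ φ ψ₀ ψ₁)
    (hf : ContMDiff 𝓘(ℂ, ℂ × ℂ) 𝓘(ℂ, ℂ × ℂ) ω f)
    (hσ : ContMDiff 𝓘(ℂ, ℂ × ℂ) 𝓘(ℂ, ℂ × ℂ) ω σ) (hA : HasLocalForm θ f p A B) :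
    {q | σ q = p ∧ ¬ IsRegularAt θ (f ∘ σ) q}.Finite := by
  obtain ⟨t, -, ht⟩ := h.isCompact_fiber.elim_nhds_subcover
    (fun x => {y | y = x ∨ IsRegularAt θ (f ∘ σ) y}) fun x hx => by
      obtain ⟨A', B', h1⟩ := h.exists_hasLocalForm hf hA hx
      filter_upwards [eventually_nhdsWithin_iff.1 (h1.eventually_isRegularAt (hf.comp hσ))]
        with y hy
      exact or_iff_not_imp_left.2 hy
  refine t.finite_toSet.subset fun q hq => ?_
  obtain ⟨x, hx, h1⟩ := mem_iUnion₂.1 (ht hq.1)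
  rcases h1 with rfl | h1
  exacts [hx, absurd h1 hq.2]

end IsBlowUpCharts

end

/-! ### Existence of the blow-up of a point -/

open ComplexSurface

/-- The blow-up of `S` at `p`, as a set: `p` is replaced by a projective line, whose points are the
slopes in the chart `φ` and the vertical direction. -/
inductive BlowUpSpace {S : ComplexSurface} {p : S} {φ : OpenPartialHomeomorph S (ℂ × ℂ)}
    (h : IsChartCenteredAt φ p) : Type
  | off (q : S) (hq : q ≠ p)
  | slope (t : ℂ)
  | vertical

namespace BlowUpSpace

variable {S : ComplexSurface} {p : S} {φ : OpenPartialHomeomorph S (ℂ × ℂ)}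
  (h : IsChartCenteredAt φ p)

/-- The blow-down map. -/
def proj : BlowUpSpace h → S
  | .off q _ => q
  | .slope _ => p
  | .vertical => p

open Classical in
/-- The point over `q` outside of the center, and `a` over the center. -/
noncomputable def lift (q : S) (a : BlowUpSpace h) : BlowUpSpace h :=
  if hq : q = p then a else .off q hq

@[simp] theorem proj_off {q : S} (hq : q ≠ p) : proj h (.off q hq) = q := rfl

@[simp] theorem proj_slope (t : ℂ) : proj h (.slope t) = p := rfl

@[simp] theorem proj_vertical : proj h .vertical = p := rfl

theorem lift_of_ne {q : S} (hq : q ≠ p) (a : BlowUpSpace h) : lift h q a = .off q hq := dif_neg hq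

@[simp] theorem lift_self (a : BlowUpSpace h) : lift h p a = a := dif_pos rfl

theorem proj_lift (q : S) {a : BlowUpSpace h} (ha : proj h a = p) : proj h (lift h q a) = q := by
  by_cases hq : q = p
  · rw [hq, lift_self, ha]
  · rw [lift_of_ne h hq, proj_off]

theorem lift_proj {a : BlowUpSpace h} (ha : proj h a ≠ p) (b : BlowUpSpace h) :
    lift h (proj h a) b = a := by
  rcases a with ⟨q, hq⟩ | t | _
  · exact lift_of_ne h hq b
  · exact absurd rfl ha
  · exact absurd rfl ha

/-- A chart of `S`, outside of the center. -/
noncomputable def oldChart (e : OpenPartialHomeomorph S (ℂ × ℂ)) :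
    PartialEquiv (BlowUpSpace h) (ℂ × ℂ) where
  toFun a := e (proj h a)
  invFun z := lift h (e.symm z) .vertical
  source := {a | proj h a ∈ e.source ∧ proj h a ≠ p}
  target := {z | z ∈ e.target ∧ e.symm z ≠ p}
  map_source' a ha := ⟨e.map_source ha.1, by rw [e.left_inv ha.1]; exact ha.2⟩
  map_target' z hz := by
    rw [mem_ofPred_eq, proj_lift h _ rfl]
    exact ⟨e.map_target hz.1, hz.2⟩
  left_inv' a ha := by rw [e.left_inv ha.1, lift_proj h ha.2]
  right_inv' z hz := by rw [proj_lift h _ rfl, e.right_inv hz.1]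

theorem eq_zero_iff (h : IsChartCenteredAt φ p) {q : S} (hq : q ∈ φ.source) : φ q = 0 ↔ q = p :=
  ⟨fun h0 => φ.injOn hq h.2.1 (h0.trans h.2.2.symm), fun h0 => h0 ▸ h.2.2⟩

theorem symm_eq_iff (h : IsChartCenteredAt φ p) {z : ℂ × ℂ} (hz : z ∈ φ.target) :
    φ.symm z = p ↔ z = 0 := by
  rw [← eq_zero_iff h (φ.map_target hz), φ.right_inv hz]

/-- The coordinates `(x, y / x)`. -/
noncomputable def chart₀ : PartialEquiv (BlowUpSpace h) (ℂ × ℂ) where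
  toFun
    | .off q _ => ((φ q).1, (φ q).2 / (φ q).1)
    | .slope t => (0, t)
    | .vertical => 0
  invFun z := lift h (φ.symm (z.1, z.2 * z.1)) (.slope z.2)
  source := {a | proj h a ∈ φ.source ∧ ((φ (proj h a)).1 ≠ 0 ∨ ∃ t, a = .slope t)}
  target := {z | (z.1, z.2 * z.1) ∈ φ.target}
  map_source' := by
    rintro (⟨q, hq⟩ | t | _) ⟨h1, h2⟩
    · have h3 : (φ q).1 ≠ 0 := by simpa using h2
      simpa [div_mul_cancel₀ _ h3] using φ.map_source h1
    · simpa [← Prod.zero_eq_mk] using zero_mem_target h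
    · simp [h.2.2] at h2
  map_target' z hz := by
    rw [mem_ofPred_eq, proj_lift h _ rfl, φ.right_inv hz]
    refine ⟨φ.map_target hz, ?_⟩
    by_cases h0 : z.1 = 0
    · right
      rw [(symm_eq_iff h hz).2 (by simp [h0]), lift_self]
      exact ⟨_, rfl⟩
    · exact .inl h0
  left_inv' := by
    rintro (⟨q, hq⟩ | t | _) ⟨h1, h2⟩
    · have h3 : (φ q).1 ≠ 0 := by simpa using h2
      simp only [div_mul_cancel₀ _ h3, Prod.mk.eta]
      rw [φ.left_inv (show q ∈ φ.source from h1)]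
      exact lift_of_ne h hq _
    · simp only [mul_zero]
      rw [Prod.mk_zero_zero, symm_zero h, lift_self]
    · simp [h.2.2] at h2
  right_inv' z hz := by
    by_cases h0 : z.1 = 0
    · rw [(symm_eq_iff h hz).2 (by simp [h0]), lift_self]
      exact Prod.ext h0.symm rfl
    · rw [lift_of_ne h fun hp => h0 (congrArg Prod.fst ((symm_eq_iff h hz).1 hp))]
      simp only [φ.right_inv hz]
      rw [mul_div_cancel_right₀ _ h0]

open Classical in
/-- The coordinates `(x / y, y)`. -/
noncomputable def chart₁ : PartialEquiv (BlowUpSpace h) (ℂ × ℂ) where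
  toFun
    | .off q _ => ((φ q).1 / (φ q).2, (φ q).2)
    | .slope t => (t⁻¹, 0)
    | .vertical => 0
  invFun z := lift h (φ.symm (z.1 * z.2, z.2)) (if z.1 = 0 then .vertical else .slope z.1⁻¹)
  source := {a | proj h a ∈ φ.source ∧ ((φ (proj h a)).2 ≠ 0 ∨ a = .vertical ∨
    ∃ t ≠ 0, a = .slope t)}
  target := {z | (z.1 * z.2, z.2) ∈ φ.target}
  map_source' := by
    rintro (⟨q, hq⟩ | t | _) ⟨h1, h2⟩
    · have h3 : (φ q).2 ≠ 0 := by simpa using h2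
      simpa [div_mul_cancel₀ _ h3] using φ.map_source h1
    · simpa [← Prod.zero_eq_mk] using zero_mem_target h
    · simpa [← Prod.zero_eq_mk] using zero_mem_target h
  map_target' z hz := by
    rw [mem_ofPred_eq, proj_lift h _ (by split_ifs <;> rfl), φ.right_inv hz]
    refine ⟨φ.map_target hz, ?_⟩
    by_cases h0 : z.2 = 0
    · right
      rw [(symm_eq_iff h hz).2 (by simp [h0]), lift_self]
      by_cases h1 : z.1 = 0
      · exact .inl (if_pos h1)
      · exact .inr ⟨_, inv_ne_zero h1, if_neg h1⟩
    · exact .inl h0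
  left_inv' := by
    rintro (⟨q, hq⟩ | t | _) ⟨h1, h2⟩
    · have h3 : (φ q).2 ≠ 0 := by simpa using h2
      simp only [div_mul_cancel₀ _ h3, Prod.mk.eta]
      rw [φ.left_inv (show q ∈ φ.source from h1)]
      exact lift_of_ne h hq _
    · have ht : t ≠ 0 := by simpa [h.2.2] using h2
      simp only [mul_zero]
      rw [Prod.mk_zero_zero, symm_zero h, lift_self, if_neg (inv_ne_zero ht), inv_inv]
    · simp only [Prod.fst_zero, Prod.snd_zero, mul_zero]
      rw [Prod.mk_zero_zero, symm_zero h, lift_self]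
      exact if_pos trivial
  right_inv' z hz := by
    by_cases h0 : z.2 = 0
    · rw [(symm_eq_iff h hz).2 (by simp [h0]), lift_self]
      by_cases h1 : z.1 = 0
      · rw [if_pos h1]
        exact Prod.ext h1.symm h0.symm
      · rw [if_neg h1]
        exact Prod.ext (inv_inv _) h0.symm
    · rw [lift_of_ne h fun hp => h0 (congrArg Prod.snd ((symm_eq_iff h hz).1 hp))]
      simp only [φ.right_inv hz]
      rw [mul_div_cancel_right₀ _ h0]

theorem proj_chart₀ {a : BlowUpSpace h} (ha : a ∈ (chart₀ h).source) :
    φ (proj h a) = ((chart₀ h a).1, (chart₀ h a).2 * (chart₀ h a).1) := by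
  have h1 : proj h a = φ.symm ((chart₀ h a).1, (chart₀ h a).2 * (chart₀ h a).1) := by
    conv_lhs => rw [← (chart₀ h).left_inv ha]
    exact proj_lift h _ rfl
  rw [h1, φ.right_inv ((chart₀ h).map_source ha)]

theorem proj_chart₁ {a : BlowUpSpace h} (ha : a ∈ (chart₁ h).source) :
    φ (proj h a) = ((chart₁ h a).1 * (chart₁ h a).2, (chart₁ h a).2) := by
  have h1 : proj h a = φ.symm ((chart₁ h a).1 * (chart₁ h a).2, (chart₁ h a).2) := by
    conv_lhs => rw [← (chart₁ h).left_inv ha]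
    exact proj_lift h _ (by split_ifs <;> rfl)
  rw [h1, φ.right_inv ((chart₁ h).map_source ha)]

theorem source_union : (chart₀ h).source ∪ (chart₁ h).source = proj h ⁻¹' φ.source := by
  ext a
  refine ⟨fun ha => ha.elim (fun h => h.1) fun h => h.1, fun ha => ?_⟩
  rcases a with ⟨q, hq⟩ | t | _
  · by_cases h0 : (φ q).1 = 0
    · exact .inr ⟨ha, .inl fun h1 => hq ((eq_zero_iff h ha).1 (Prod.ext h0 h1))⟩
    · exact .inl ⟨ha, .inl h0⟩
  · exact .inl ⟨ha, .inr ⟨t, rfl⟩⟩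
  · exact .inr ⟨ha, .inr (.inl rfl)⟩

theorem mem_source₁_iff {a : BlowUpSpace h} (ha : a ∈ (chart₀ h).source) :
    a ∈ (chart₁ h).source ↔ (chart₀ h a).2 ≠ 0 := by
  obtain ⟨h1, h2⟩ := ha
  rcases a with ⟨q, hq⟩ | t | _
  · have h3 : (φ q).1 ≠ 0 := by simpa using h2
    change q ∈ _ ∧ ((φ q).2 ≠ 0 ∨ _) ↔ (φ q).2 / (φ q).1 ≠ 0
    simp [h3, show q ∈ φ.source from h1]
  · change p ∈ _ ∧ ((φ p).2 ≠ 0 ∨ _) ↔ t ≠ 0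
    simp [h.2.2, h.2.1]
  · simp [h.2.2] at h2

theorem mem_source₀_iff {a : BlowUpSpace h} (ha : a ∈ (chart₁ h).source) :
    a ∈ (chart₀ h).source ↔ (chart₁ h a).1 ≠ 0 := by
  obtain ⟨h1, h2⟩ := ha
  rcases a with ⟨q, hq⟩ | t | _
  · have h3 : (φ q).2 ≠ 0 := by simpa using h2
    change q ∈ _ ∧ ((φ q).1 ≠ 0 ∨ _) ↔ (φ q).1 / (φ q).2 ≠ 0
    simp [h3, show q ∈ φ.source from h1]
  · change p ∈ _ ∧ ((φ p).1 ≠ 0 ∨ _) ↔ t⁻¹ ≠ 0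
    simpa [h.2.2, h.2.1] using h2
  · change p ∈ _ ∧ ((φ p).1 ≠ 0 ∨ _) ↔ (0 : ℂ) ≠ 0
    simp [h.2.2]

theorem chart₁_eq {a : BlowUpSpace h} (ha : a ∈ (chart₀ h).source) :
    chart₁ h a = ((chart₀ h a).2⁻¹, (chart₀ h a).2 * (chart₀ h a).1) := by
  obtain ⟨h1, h2⟩ := ha
  rcases a with ⟨q, hq⟩ | t | _
  · have h3 : (φ q).1 ≠ 0 := by simpa using h2
    change ((φ q).1 / (φ q).2, (φ q).2) = (((φ q).2 / (φ q).1)⁻¹, (φ q).2 / (φ q).1 * (φ q).1)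
    rw [inv_div, div_mul_cancel₀ _ h3]
  · change (t⁻¹, (0 : ℂ)) = (t⁻¹, t * 0)
    rw [mul_zero]
  · simp [h.2.2] at h2

theorem chart₀_eq {a : BlowUpSpace h} (ha : a ∈ (chart₀ h).source) (ha' : a ∈ (chart₁ h).source) :
    chart₀ h a = ((chart₁ h a).1 * (chart₁ h a).2, (chart₁ h a).1⁻¹) := by
  have h1 := (mem_source₁_iff h ha).1 ha'
  rw [chart₁_eq h ha]
  ext
  · simp [h1]
  · simp

end BlowUpSpace

open ComplexSurface

/-! ### Topology and complex structure of the blow-up -/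

namespace BlowUpSpace

variable {S : ComplexSurface} {p : S} {φ : OpenPartialHomeomorph S (ℂ × ℂ)}
  (h : IsChartCenteredAt φ p)

/-- What makes a chart `c` of the blow-up compatible with the charts of `S`: outside of the center,
it comes from a smooth map `F` on an open subset `W` of `S`, and the blow-down map is smooth in
it. -/
structure IsCompatible (c : PartialEquiv (BlowUpSpace h) (ℂ × ℂ)) : Prop where
  isOpen_target : IsOpen c.target
  contMDiffOn : ContMDiffOn 𝓘(ℂ, ℂ × ℂ) 𝓘(ℂ, ℂ × ℂ) ω (fun z => proj h (c.symm z)) c.target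
  exists_map : ∃ (W : Set S) (F : S → ℂ × ℂ), IsOpen W ∧ p ∉ W ∧
    ContMDiffOn 𝓘(ℂ, ℂ × ℂ) 𝓘(ℂ, ℂ × ℂ) ω F W ∧
    ∀ a, proj h a ≠ p → (a ∈ c.source ↔ proj h a ∈ W) ∧ (a ∈ c.source → c a = F (proj h a))

theorem isCompatible_oldChart {e : OpenPartialHomeomorph S (ℂ × ℂ)}
    (he : e ∈ IsManifold.maximalAtlas 𝓘(ℂ, ℂ × ℂ) ω S) : IsCompatible h (oldChart h e) where
  isOpen_target := e.isOpen_inter_preimage_symm (isOpen_compl_singleton (x := p))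
  contMDiffOn := ((contMDiffOn_symm_of_mem_maximalAtlas he).mono fun _ hz => hz.1).congr
    fun _ _ => proj_lift h _ rfl
  exists_map := ⟨e.source ∩ {p}ᶜ, e, e.open_source.inter isOpen_compl_singleton, fun hp => hp.2 rfl,
    (contMDiffOn_of_mem_maximalAtlas he).mono inter_subset_left, fun _ _ => ⟨Iff.rfl, fun _ => rfl⟩⟩

theorem isCompatible_chart₀ : IsCompatible h (chart₀ h) where
  isOpen_target := φ.open_target.preimage (f := fun z : ℂ × ℂ => (z.1, z.2 * z.1)) (by fun_prop)
  contMDiffOn := by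
    refine ((contMDiffOn_symm_of_mem_maximalAtlas h.1).comp (t := φ.target)
      (f := fun z : ℂ × ℂ => (z.1, z.2 * z.1)) ?_ fun z hz => hz).congr
        fun _ _ => proj_lift h _ rfl
    exact (contDiff_fst.prodMk (contDiff_snd.mul contDiff_fst)).contMDiff.contMDiffOn
  exists_map := by
    refine ⟨φ.source ∩ φ ⁻¹' {z | z.1 ≠ 0}, (fun z : ℂ × ℂ => (z.1, z.2 / z.1)) ∘ φ,
      φ.isOpen_inter_preimage (isOpen_ne_fun continuous_fst continuous_const),
      fun hp => hp.2 (by rw [h.2.2]; rfl), ?_, ?_⟩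
    · refine ContMDiffOn.comp (t := {z : ℂ × ℂ | z.1 ≠ 0}) (ContDiffOn.contMDiffOn ?_)
        ((contMDiffOn_of_mem_maximalAtlas h.1).mono inter_subset_left) fun z hz => hz.2
      exact contDiff_fst.contDiffOn.prodMk
        (contDiff_snd.contDiffOn.div contDiff_fst.contDiffOn fun z hz => hz)
    · rintro (⟨q, hq⟩ | t | _) ha
      · exact ⟨by simp [chart₀], fun _ => rfl⟩
      · exact absurd rfl ha
      · exact absurd rfl ha

theorem isCompatible_chart₁ : IsCompatible h (chart₁ h) where
  isOpen_target := φ.open_target.preimage (f := fun z : ℂ × ℂ => (z.1 * z.2, z.2)) (by fun_prop)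
  contMDiffOn := by
    refine ((contMDiffOn_symm_of_mem_maximalAtlas h.1).comp (t := φ.target)
      (f := fun z : ℂ × ℂ => (z.1 * z.2, z.2)) ?_ fun z hz => hz).congr
        fun _ _ => proj_lift h _ (by split_ifs <;> rfl)
    exact ((contDiff_fst.mul contDiff_snd).prodMk contDiff_snd).contMDiff.contMDiffOn
  exists_map := by
    refine ⟨φ.source ∩ φ ⁻¹' {z | z.2 ≠ 0}, (fun z : ℂ × ℂ => (z.1 / z.2, z.2)) ∘ φ,
      φ.isOpen_inter_preimage (isOpen_ne_fun continuous_snd continuous_const),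
      fun hp => hp.2 (by rw [h.2.2]; rfl), ?_, ?_⟩
    · refine ContMDiffOn.comp (t := {z : ℂ × ℂ | z.2 ≠ 0}) (ContDiffOn.contMDiffOn ?_)
        ((contMDiffOn_of_mem_maximalAtlas h.1).mono inter_subset_left) fun z hz => hz.2
      exact (contDiff_fst.contDiffOn.div contDiff_snd.contDiffOn fun z hz => hz).prodMk
        contDiff_snd.contDiffOn
    · rintro (⟨q, hq⟩ | t | _) ha
      · exact ⟨by simp [chart₁], fun _ => rfl⟩
      · exact absurd rfl ha
      · exact absurd rfl ha

/-- The change of charts from `c` to `c'` is holomorphic, with open domain. -/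
def IsSmoothTransition (c c' : PartialEquiv (BlowUpSpace h) (ℂ × ℂ)) : Prop :=
  IsOpen (c.symm.trans c').source ∧ ContDiffOn ℂ ω (c.symm.trans c') (c.symm.trans c').source

variable {h}

/-- Two compatible charts have a smooth transition if they do not meet over the center. -/
theorem IsCompatible.isSmoothTransition {c c' : PartialEquiv (BlowUpSpace h) (ℂ × ℂ)}
    (hc : IsCompatible h c) (hc' : IsCompatible h c')
    (hd : ∀ a ∈ c.source, a ∈ c'.source → proj h a ≠ p) : IsSmoothTransition h c c' := by
  obtain ⟨W, F, hW, hpW, hF, h1⟩ := hc'.exists_map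
  have hs : (c.symm.trans c').source = c.target ∩ (fun z => proj h (c.symm z)) ⁻¹' W := by
    ext z
    refine and_congr_right fun hz => ?_
    constructor
    · intro h2
      exact (h1 _ (hd _ (c.map_target hz) h2)).1.1 h2
    · intro h2
      exact (h1 _ fun hp => hpW (hp ▸ h2)).1.2 h2
  refine ⟨?_, ?_⟩
  · rw [hs]
    exact hc.contMDiffOn.continuousOn.isOpen_inter_preimage hc.isOpen_target hW
  · rw [← contMDiffOn_iff_contDiffOn]
    refine (ContMDiffOn.comp hF (hc.contMDiffOn.mono inter_subset_left)
      fun z hz => (hs.subset hz).2).congr fun z hz => ?_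
    exact (h1 _ fun hp => hpW (hp ▸ (hs.subset hz).2)).2 hz.2

theorem IsCompatible.isSmoothTransition_self {c : PartialEquiv (BlowUpSpace h) (ℂ × ℂ)}
    (hc : IsCompatible h c) : IsSmoothTransition h c c := by
  have hs : (c.symm.trans c).source = c.target :=
    inter_eq_left.2 fun z hz => c.map_target hz
  refine ⟨hs ▸ hc.isOpen_target, contDiffOn_id.congr fun z hz => c.right_inv hz.1⟩

variable (h)

theorem isSmoothTransition_chart₀_chart₁ : IsSmoothTransition h (chart₀ h) (chart₁ h) := by
  have hs : ((chart₀ h).symm.trans (chart₁ h)).source = (chart₀ h).target ∩ {z | z.2 ≠ 0} := by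
    ext z
    refine and_congr_right fun hz => ?_
    change (chart₀ h).symm z ∈ (chart₁ h).source ↔ _
    rw [mem_source₁_iff h ((chart₀ h).map_target hz)]
    rw [(chart₀ h).right_inv hz, mem_ofPred_eq]
  refine ⟨?_, ?_⟩
  · rw [hs]
    exact (isCompatible_chart₀ h).isOpen_target.inter
      (isOpen_ne_fun continuous_snd continuous_const)
  · rw [hs]
    refine ContDiffOn.congr (f := fun z : ℂ × ℂ => (z.2⁻¹, z.2 * z.1)) ?_ fun z hz => ?_
    · exact (contDiff_snd.contDiffOn.inv fun z hz => hz.2).prodMk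
        (contDiff_snd.mul contDiff_fst).contDiffOn
    · refine (chart₁_eq h ((chart₀ h).map_target hz.1)).trans ?_
      rw [(chart₀ h).right_inv hz.1]

theorem isSmoothTransition_chart₁_chart₀ : IsSmoothTransition h (chart₁ h) (chart₀ h) := by
  have hs : ((chart₁ h).symm.trans (chart₀ h)).source = (chart₁ h).target ∩ {z | z.1 ≠ 0} := by
    ext z
    refine and_congr_right fun hz => ?_
    change (chart₁ h).symm z ∈ (chart₀ h).source ↔ _
    rw [mem_source₀_iff h ((chart₁ h).map_target hz)]
    rw [(chart₁ h).right_inv hz, mem_ofPred_eq]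
  refine ⟨?_, ?_⟩
  · rw [hs]
    exact (isCompatible_chart₁ h).isOpen_target.inter
      (isOpen_ne_fun continuous_fst continuous_const)
  · refine ContDiffOn.congr (f := fun z : ℂ × ℂ => (z.1 * z.2, z.1⁻¹)) ?_ fun z hz => ?_
    · exact (contDiff_fst.mul contDiff_snd).contDiffOn.prodMk
        (contDiff_fst.contDiffOn.inv fun z hz => (hs.subset hz).2)
    · refine (chart₀_eq h hz.2 ((chart₁ h).map_target hz.1)).trans ?_
      rw [show chart₁ h ((chart₁ h).symm.symm.symm z) = z from (chart₁ h).right_inv hz.1]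

/-- The charts of the blow-up. -/
def charts : Set (PartialEquiv (BlowUpSpace h) (ℂ × ℂ)) :=
  insert (chart₀ h) (insert (chart₁ h)
    (oldChart h '' IsManifold.maximalAtlas 𝓘(ℂ, ℂ × ℂ) ω S))

theorem isCompatible_of_mem {c : PartialEquiv (BlowUpSpace h) (ℂ × ℂ)} (hc : c ∈ charts h) :
    IsCompatible h c := by
  rcases hc with rfl | rfl | ⟨e, he, rfl⟩
  exacts [isCompatible_chart₀ h, isCompatible_chart₁ h, isCompatible_oldChart h he]

theorem isSmoothTransition_of_mem {c c' : PartialEquiv (BlowUpSpace h) (ℂ × ℂ)}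
    (hc : c ∈ charts h) (hc' : c' ∈ charts h) : IsSmoothTransition h c c' := by
  have h1 := isCompatible_of_mem h hc
  have h2 := isCompatible_of_mem h hc'
  rcases hc with rfl | rfl | ⟨e, -, rfl⟩
  · rcases hc' with rfl | rfl | ⟨e', -, rfl⟩
    · exact h1.isSmoothTransition_self
    · exact isSmoothTransition_chart₀_chart₁ h
    · exact h1.isSmoothTransition h2 fun a _ ha => ha.2
  · rcases hc' with rfl | rfl | ⟨e', -, rfl⟩
    · exact isSmoothTransition_chart₁_chart₀ h
    · exact h1.isSmoothTransition_self
    · exact h1.isSmoothTransition h2 fun a _ ha => ha.2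
  · exact h1.isSmoothTransition h2 fun a ha _ => ha.2

open Classical in
/-- The atlas that defines the topology of the blow-up. -/
noncomputable def core : ChartedSpaceCore (ℂ × ℂ) (BlowUpSpace h) where
  atlas := charts h
  chartAt
    | .off q _ => oldChart h (chartAt (ℂ × ℂ) q)
    | .slope _ => chart₀ h
    | .vertical => chart₁ h
  mem_chart_source := by
    rintro (⟨q, hq⟩ | t | _)
    · exact ⟨mem_chart_source _ q, hq⟩
    · exact ⟨h.2.1, .inr ⟨t, rfl⟩⟩
    · exact ⟨h.2.1, .inr (.inl rfl)⟩
  chart_mem_atlas := by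
    rintro (⟨q, hq⟩ | t | _)
    · exact .inr (.inr ⟨_, IsManifold.chart_mem_maximalAtlas q, rfl⟩)
    · exact .inl rfl
    · exact .inr (.inl rfl)
  open_source c c' hc hc' := (isSmoothTransition_of_mem h hc hc').1
  continuousOn_toFun c c' hc hc' := (isSmoothTransition_of_mem h hc hc').2.continuousOn

noncomputable instance : TopologicalSpace (BlowUpSpace h) := (core h).toTopologicalSpace

noncomputable instance : ChartedSpace (ℂ × ℂ) (BlowUpSpace h) := (core h).toChartedSpace

/-- The charts of the blow-up, as local homeomorphisms. -/
noncomputable def homeo {c : PartialEquiv (BlowUpSpace h) (ℂ × ℂ)} (hc : c ∈ charts h) :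
    OpenPartialHomeomorph (BlowUpSpace h) (ℂ × ℂ) := (core h).openPartialHomeomorph c hc

theorem mem_atlas_iff {e : OpenPartialHomeomorph (BlowUpSpace h) (ℂ × ℂ)} :
    e ∈ atlas (ℂ × ℂ) (BlowUpSpace h) ↔ ∃ (c : _) (hc : c ∈ charts h), e = homeo h hc := by
  change e ∈ (⋃ (c : PartialEquiv (BlowUpSpace h) (ℂ × ℂ)) (hc : c ∈ (core h).atlas),
    {(core h).openPartialHomeomorph c hc}) ↔ _
  simp only [mem_iUnion, mem_singleton_iff]
  rfl

instance : IsManifold 𝓘(ℂ, ℂ × ℂ) ω (BlowUpSpace h) := by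
  refine isManifold_of_contDiffOn _ _ _ fun e e' he he' => ?_
  obtain ⟨c, hc, rfl⟩ := (mem_atlas_iff h).1 he
  obtain ⟨c', hc', rfl⟩ := (mem_atlas_iff h).1 he'
  exact (isSmoothTransition_of_mem h hc hc').2.mono fun z hz => hz.1

theorem homeo_mem_maximalAtlas {c : PartialEquiv (BlowUpSpace h) (ℂ × ℂ)} (hc : c ∈ charts h) :
    homeo h hc ∈ IsManifold.maximalAtlas 𝓘(ℂ, ℂ × ℂ) ω (BlowUpSpace h) :=
  IsManifold.subset_maximalAtlas ((mem_atlas_iff h).2 ⟨c, hc, rfl⟩)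

theorem exists_mem_source (a : BlowUpSpace h) : ∃ c ∈ charts h, a ∈ c.source :=
  ⟨_, (core h).chart_mem_atlas a, (core h).mem_chart_source a⟩

theorem contMDiff_proj : ContMDiff 𝓘(ℂ, ℂ × ℂ) 𝓘(ℂ, ℂ × ℂ) ω (proj h) := by
  intro a
  obtain ⟨c, hc, ha⟩ := exists_mem_source h a
  have h1 := contMDiffOn_of_mem_maximalAtlas (homeo_mem_maximalAtlas h hc)
  have h2 : ContMDiffOn 𝓘(ℂ, ℂ × ℂ) 𝓘(ℂ, ℂ × ℂ) ω (proj h) (homeo h hc).source :=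
    ((isCompatible_of_mem h hc).contMDiffOn.comp h1 fun b hb => c.map_source hb).congr
      fun b hb => congrArg (proj h) (c.left_inv hb).symm
  exact h2.contMDiffAt ((homeo h hc).open_source.mem_nhds ha)

theorem exists_disjoint_of_mem_source {c : PartialEquiv (BlowUpSpace h) (ℂ × ℂ)} (hc : c ∈ charts h)
    {a b : BlowUpSpace h} (ha : a ∈ c.source) (hb : b ∈ c.source) (hab : a ≠ b) :
    Disjoint (𝓝 a) (𝓝 b) := by
  have h1 : c a ≠ c b := fun h0 => hab (c.injOn ha hb h0)
  have h2 : Tendsto c (𝓝 a) (𝓝 (c a)) := (homeo h hc).continuousAt ha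
  have h3 : Tendsto c (𝓝 b) (𝓝 (c b)) := (homeo h hc).continuousAt hb
  exact h2.disjoint (disjoint_nhds_nhds.2 h1) h3

theorem chart₀_mem : chart₀ h ∈ charts h := .inl rfl

theorem chart₁_mem : chart₁ h ∈ charts h := .inr (.inl rfl)

theorem vertical_mem_source : (.vertical : BlowUpSpace h) ∈ (chart₁ h).source :=
  ⟨h.2.1, .inr (.inl rfl)⟩

theorem slope_mem_source (t : ℂ) : (.slope t : BlowUpSpace h) ∈ (chart₀ h).source :=
  ⟨h.2.1, .inr ⟨t, rfl⟩⟩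

/-- A point with a slope and the vertical direction are separated. They lie in a common chart unless
the slope is `0`, and then the neighborhoods `|y / x| < 1` and `|x / y| < 1` are disjoint. -/
theorem disjoint_nhds_slope_vertical (t : ℂ) :
    Disjoint (𝓝 (.slope t : BlowUpSpace h)) (𝓝 .vertical) := by
  have h0 := slope_mem_source h t
  have h1 := vertical_mem_source h
  by_cases ht : t = 0
  · subst ht
    have h2 : ∀ᶠ a in 𝓝 (.slope 0 : BlowUpSpace h),
        a ∈ (chart₀ h).source ∧ ‖(chart₀ h a).2‖ < 1 := by
      refine Eventually.and ((homeo h (chart₀_mem h)).open_source.mem_nhds h0) ?_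
      have h3 : ContinuousAt (fun a => ‖(chart₀ h a).2‖) (.slope 0 : BlowUpSpace h) :=
        (continuous_snd.norm.continuousAt).comp ((homeo h (chart₀_mem h)).continuousAt h0)
      refine h3.eventually_lt continuousAt_const ?_
      change ‖(0 : ℂ)‖ < 1
      simp
    have h3 : ∀ᶠ a in 𝓝 (.vertical : BlowUpSpace h),
        a ∈ (chart₁ h).source ∧ ‖(chart₁ h a).1‖ < 1 := by
      refine Eventually.and ((homeo h (chart₁_mem h)).open_source.mem_nhds h1) ?_
      have h3 : ContinuousAt (fun a => ‖(chart₁ h a).1‖) (.vertical : BlowUpSpace h) :=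
        (continuous_fst.norm.continuousAt).comp ((homeo h (chart₁_mem h)).continuousAt h1)
      refine h3.eventually_lt continuousAt_const ?_
      change ‖(0 : ℂ)‖ < 1
      simp
    refine Filter.disjoint_iff.2 ⟨_, h2, _, h3, Set.disjoint_left.2 fun a h4 h5 => ?_⟩
    have h6 := (mem_source₁_iff h h4.1).1 h5.1
    have h7 := h5.2
    rw [chart₁_eq h h4.1, norm_inv] at h7
    exact absurd ((one_lt_inv₀ (norm_pos_iff.2 h6)).2 h4.2) h7.le.not_gt
  · exact exists_disjoint_of_mem_source h (chart₁_mem h)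
      ((mem_source₁_iff h h0).2 ht) h1 (by simp)

instance : T2Space (BlowUpSpace h) := by
  refine t2Space_iff_disjoint_nhds.2 fun a b hab => ?_
  by_cases hp : proj h a = proj h b
  · rcases a with ⟨q, hq⟩ | t | _ <;> rcases b with ⟨q', hq'⟩ | t' | _
    · exact absurd (by cases (show q = q' from hp); rfl) hab
    · exact absurd hp hq
    · exact absurd hp hq
    · exact absurd hp.symm hq'
    · exact exists_disjoint_of_mem_source h (chart₀_mem h) (slope_mem_source h t)
        (slope_mem_source h t') hab
    · exact disjoint_nhds_slope_vertical h t
    · exact absurd hp.symm hq'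
    · exact (disjoint_nhds_slope_vertical h t').symm
    · exact absurd rfl hab
  · have h1 := (contMDiff_proj h).continuous
    exact (h1.tendsto a).disjoint (disjoint_nhds_nhds.2 hp) (h1.tendsto b)

/-- The blow-up as a complex surface. -/
noncomputable def surface : ComplexSurface where
  carrier := BlowUpSpace h

/-- The blow-down map is biholomorphic outside of the center. The inverse is `lift`, whose value over
the center is irrelevant here. -/
noncomputable def projDiffeomorph :
    PartialDiffeomorph 𝓘(ℂ, ℂ × ℂ) 𝓘(ℂ, ℂ × ℂ) (BlowUpSpace h) S ω where
  toFun := proj h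
  invFun q := lift h q .vertical
  source := {a | proj h a ≠ p}
  target := {p}ᶜ
  map_source' _ ha := ha
  map_target' q hq := by
    rw [mem_ofPred_eq, proj_lift h _ rfl]
    exact hq
  left_inv' a ha := lift_proj h ha _
  right_inv' q _ := proj_lift h q rfl
  open_source := isOpen_compl_singleton.preimage (contMDiff_proj h).continuous
  open_target := isOpen_compl_singleton
  contMDiffOn_toFun := (contMDiff_proj h).contMDiffOn
  contMDiffOn_invFun := by
    intro q hq
    have he := IsManifold.chart_mem_maximalAtlas (I := 𝓘(ℂ, ℂ × ℂ)) (n := ω) q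
    have hc : oldChart h (chartAt (ℂ × ℂ) q) ∈ charts h := .inr (.inr ⟨_, he, rfl⟩)
    have h1 := contMDiffOn_symm_of_mem_maximalAtlas (homeo_mem_maximalAtlas h hc)
    have h2 : ContMDiffOn 𝓘(ℂ, ℂ × ℂ) 𝓘(ℂ, ℂ × ℂ) ω (fun q => lift h q .vertical)
        ((chartAt (ℂ × ℂ) q).source ∩ {p}ᶜ) := by
      refine (h1.comp ((contMDiffOn_of_mem_maximalAtlas he).mono inter_subset_left)
        fun x hx => ?_).congr fun x hx => ?_
      · exact ⟨(chartAt (ℂ × ℂ) q).map_source hx.1, by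
          rw [(chartAt (ℂ × ℂ) q).left_inv hx.1]; exact hx.2⟩
      · exact congrArg (fun x => lift h x .vertical) ((chartAt (ℂ × ℂ) q).left_inv hx.1).symm
    exact (h2.contMDiffAt (((chartAt (ℂ × ℂ) q).open_source.inter
      isOpen_compl_singleton).mem_nhds ⟨mem_chart_source _ q, hq⟩)).contMDiffWithinAt

theorem isBlowUpCharts : IsBlowUpCharts (S' := surface h) p (proj h) φ (homeo h (chart₀_mem h))
    (homeo h (chart₁_mem h)) where
  centered := h
  mem_atlas₀ := homeo_mem_maximalAtlas h _
  mem_atlas₁ := homeo_mem_maximalAtlas h _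
  source := source_union h
  target₀ := rfl
  target₁ := rfl
  eq₀ _ ha := proj_chart₀ h ha
  eq₁ _ ha := proj_chart₁ h ha
  mem_iff₀ _ ha := mem_source₁_iff h ha
  mem_iff₁ _ ha := mem_source₀_iff h ha
  transition _ ha := chart₁_eq h ha.1

theorem isBlowUpAt : IsBlowUpAt (S' := surface h) p (proj h) := by
  obtain ⟨h0, h1, h2, h3, h4, h5, h6, h7, h8, h9, h10⟩ := isBlowUpCharts h
  refine ⟨contMDiff_proj h, ⟨fun _ ha => ha, ?_, ?_⟩, fun a => ?_,
    φ, h0, _, h1, _, h2, h3, h4, h5, h6, h7, h8, h9, h10⟩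
  · intro a ha b hb hab
    rw [← lift_proj h ha .vertical, ← lift_proj h hb .vertical, hab]
  · exact fun q hq => ⟨lift h q .vertical,
      fun hp => hq ((proj_lift h q rfl).symm.trans hp), proj_lift h q rfl⟩
  · exact ⟨projDiffeomorph h, a.2, fun _ _ => rfl⟩

end BlowUpSpace

open ComplexSurface

/-! ### Iterated blow-ups -/

section Iterated

variable {S S₁ S₂ : ComplexSurface} {Z : Set S} {π : S₁ → S}

theorem _root_.ComplexSurface.IsIteratedBlowUp.contMDiff (h : IsIteratedBlowUp S Z S₁ π) :
    ContMDiff 𝓘(ℂ, ℂ × ℂ) 𝓘(ℂ, ℂ × ℂ) ω π := by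
  induction h with
  | refl => exact contMDiff_id
  | step p _ _ hσ ih => exact ih.comp hσ.1

theorem _root_.ComplexSurface.IsIteratedBlowUp.trans {Z₁ : Set S₁} {σ : S₂ → S₁}
    (h : IsIteratedBlowUp S Z S₁ π) (h' : IsIteratedBlowUp S₁ Z₁ S₂ σ) (hZ : ∀ x ∈ Z₁, π x ∈ Z) :
    IsIteratedBlowUp S Z S₂ (π ∘ σ) := by
  induction h' with
  | refl => exact h
  | step p _ hp hσ ih => exact (ih.step p (hZ _ hp) hσ :)

theorem _root_.ComplexSurface.IsIteratedBlowUp.mono {Z' : Set S} (h : IsIteratedBlowUp S Z S₁ π)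
    (hZ : Z ⊆ Z') : IsIteratedBlowUp S Z' S₁ π :=
  IsIteratedBlowUp.refl.trans h hZ

theorem _root_.ComplexSurface.IsBlowUpAt.isIteratedBlowUp {p : S} (h : IsBlowUpAt p π) :
    IsIteratedBlowUp S {p} S₁ π :=
  ((IsIteratedBlowUp.refl (S := S)).step (Z := {p}) p rfl h :)

variable {θ : ℂ × ℂ → (ℂ × ℂ →L[ℂ] ℂ)} {f : S → ℂ × ℂ}

/-- The transformed foliation has a local form at each point, and finitely many singular points, all
of them over `Z`. -/
theorem _root_.ComplexSurface.IsIteratedBlowUp.exists_hasLocalForm (h : IsIteratedBlowUp S Z S₁ π)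
    (hf : ContMDiff 𝓘(ℂ, ℂ × ℂ) 𝓘(ℂ, ℂ × ℂ) ω f) (h0 : ∀ q, ∃ A B, HasLocalForm θ f q A B)
    (h1 : {q | ¬ IsRegularAt θ f q}.Finite) (h2 : ∀ q, ¬ IsRegularAt θ f q → q ∈ Z) :
    (∀ q, ∃ A B, HasLocalForm θ (f ∘ π) q A B) ∧ {q | ¬ IsRegularAt θ (f ∘ π) q}.Finite ∧
      ∀ q, ¬ IsRegularAt θ (f ∘ π) q → π q ∈ Z := by
  induction h with
  | refl => exact ⟨h0, h1, h2⟩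
  | @step S₁ S₂ π σ p hπ hp hσ ih =>
    obtain ⟨h3, h4, h5⟩ := ih
    obtain ⟨φ, ψ₀, ψ₁, hc⟩ := hσ.exists_charts
    obtain ⟨A, B, hA⟩ := h3 p
    have hfπ := hf.comp hπ.contMDiff
    refine ⟨fun q => ?_, ?_, fun q hq => ?_⟩
    · by_cases hq : σ q = p
      · exact hc.exists_hasLocalForm hfπ hA hq
      · obtain ⟨A', B', h6⟩ := h3 (σ q)
        exact ⟨A', B', HasLocalForm.comp (f := f ∘ π) (hσ.isIsoOff.isLocalDiffeomorphAt hq) h6⟩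
    · have h6 : (σ ⁻¹' {q | ¬ IsRegularAt θ (f ∘ π) q} ∩ σ ⁻¹' {p}ᶜ).Finite := by
        refine Finite.of_finite_image (h4.subset (image_subset_iff.2 inter_subset_left)) ?_
        exact hσ.isIsoOff.injOn.mono inter_subset_right
      refine (h6.union (hc.finite_not_isRegularAt hfπ hσ.1 hA)).subset fun q hq => ?_
      by_cases hqp : σ q = p
      · exact .inr ⟨hqp, hq⟩
      · exact .inl ⟨fun h7 => hq (IsRegularAt.comp (f := f ∘ π)
          (hσ.isIsoOff.isLocalDiffeomorphAt hqp) h7), hqp⟩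
    · by_cases hqp : σ q = p
      · rw [← hqp] at hp
        exact hp
      · exact h5 _ fun h7 => hq (IsRegularAt.comp (f := f ∘ π)
          (hσ.isIsoOff.isLocalDiffeomorphAt hqp) h7)

end Iterated

/-! ### Reduction by iterated blow-ups -/

/-- At every point of a surface at which a foliation is defined by `A dx + B dy`, the foliation can
be reduced by blow-ups over this point. -/
def IsReducible (θ : ℂ × ℂ → (ℂ × ℂ →L[ℂ] ℂ)) (A B : ℂ × ℂ → ℂ) : Prop :=
  ∀ (S : ComplexSurface) (f : S → ℂ × ℂ) (p : S), ContMDiff 𝓘(ℂ, ℂ × ℂ) 𝓘(ℂ, ℂ × ℂ) ω f →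
    HasLocalForm θ f p A B → ∃ (S' : ComplexSurface) (σ : S' → S), IsIteratedBlowUp S {p} S' σ ∧
      IsIsoOff σ {p} ∧ ∀ q, σ q = p → IsReducedAt θ (f ∘ σ) q

variable {θ : ℂ × ℂ → (ℂ × ℂ →L[ℂ] ℂ)}

/-- Finitely many points can be treated one after the other. -/
theorem exists_reduction_of_finite {S : ComplexSurface} {f : S → ℂ × ℂ} {T : Set S} (hT : T.Finite)
    (hf : ContMDiff 𝓘(ℂ, ℂ × ℂ) 𝓘(ℂ, ℂ × ℂ) ω f)
    (h : ∀ q ∈ T, ∃ A B, HasLocalForm θ f q A B ∧ IsReducible θ A B) :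
    ∃ (S' : ComplexSurface) (σ : S' → S), IsIteratedBlowUp S T S' σ ∧ IsIsoOff σ T ∧
      ∀ q, σ q ∈ T → IsReducedAt θ (f ∘ σ) q := by
  induction hn : T.ncard generalizing S with
  | zero =>
    obtain rfl := (ncard_eq_zero hT).1 hn
    exact ⟨S, id, .refl, isIsoOff_id _, fun q hq => absurd hq (notMem_empty q)⟩
  | succ n ih =>
    obtain ⟨p, T', hp, rfl, hn'⟩ := (ncard_eq_succ hT).1 hn
    obtain ⟨A, B, hA, hr⟩ := h p (mem_insert _ _)
    obtain ⟨S₁, σ₁, h1, h2, h3⟩ := hr S f p hf hA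
    have hpT : ∀ {q}, σ₁ q ∈ T' → σ₁ q ∉ ({p} : Set S) := fun hq hq' => hp (hq' ▸ hq)
    have hinj : InjOn σ₁ (σ₁ ⁻¹' T') := h2.injOn.mono fun q hq => hpT hq
    have hsurj : T' ⊆ range σ₁ := fun x hx => by
      obtain ⟨y, hy, -⟩ := h2 x fun hx' => hp (hx' ▸ hx)
      exact ⟨y, hy⟩
    -- over the remaining points `σ₁` is biholomorphic, so they lift to as many points of `S₁`
    have hT' : T'.Finite := hT.subset (subset_insert _ _)
    obtain ⟨S₂, σ₂, h4, h5, h6⟩ := ih (S := S₁) (f := f ∘ σ₁) (T := σ₁ ⁻¹' T')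
      (hT'.preimage hinj) (hf.comp h1.contMDiff) (fun q hq => by
        obtain ⟨A', B', h7, h8⟩ := h _ (mem_insert_of_mem p hq)
        exact ⟨A', B', h7.comp (h2.isLocalDiffeomorphAt (hpT hq)), h8⟩) (by
        rw [← hn', ← hinj.ncard_image, image_preimage_eq_of_subset hsurj])
    refine ⟨S₂, σ₁ ∘ σ₂, (h1.mono (singleton_subset_iff.2 (mem_insert _ _))).trans h4
      fun x hx => mem_insert_of_mem p hx,
      (h2.mono (singleton_subset_iff.2 (mem_insert _ _))).comp h5
        fun x hx => mem_insert_of_mem p hx, fun q hq => ?_⟩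
    rcases hq with hq | hq
    · exact IsReducedAt.comp (f := f ∘ σ₁) (h5.isLocalDiffeomorphAt fun h7 => hpT h7 hq) (h3 _ hq)
    · exact h6 q hq

/-- Each blow-up in a resolution of a germ is realized by `BlowUpSpace`. By finiteness, only finitely
many points of the exceptional divisor remain to be treated. -/
theorem Resolvable.isReducible {A B : ℂ × ℂ → ℂ} (h : Resolvable A B) : IsReducible θ A B := by
  induction h with
  | regular h =>
    exact fun S f p hf hA => ⟨S, id, .refl, isIsoOff_id _, by
      rintro q rfl; exact ⟨_, _, hA, .inl h⟩⟩
  | final h =>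
    exact fun S f p hf hA => ⟨S, id, .refl, isIsoOff_id _, by
      rintro q rfl; exact ⟨_, _, hA, .inr h⟩⟩
  | change hΦ h0 hL hu hu0 hi h _ ih =>
    exact fun S f p hf hA => ih S f p hf (hA.change hf hΦ h0 hL hu hu0 hi h)
  | @blowUp A B K A' B' K' A'' B'' h h' _ _ ih ih' =>
    rintro S f p hf ⟨φ, hφ, hA⟩
    have hσ := BlowUpSpace.isBlowUpAt hφ
    have hc := BlowUpSpace.isBlowUpCharts hφ
    have hfσ := hf.comp hσ.1
    set σ : BlowUpSpace.surface hφ → S := BlowUpSpace.proj hφ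
    obtain ⟨S₂, σ₂, h1, h2, h3⟩ := exists_reduction_of_finite (θ := θ) (f := f ∘ σ)
      (T := {q | σ q = p ∧ ¬ IsReducedAt θ (f ∘ σ) q})
      ((hc.finite_not_isRegularAt hf hσ.1 ⟨φ, hφ, hA⟩).subset fun q hq =>
        ⟨hq.1, fun h4 => hq.2 h4.isReducedAt⟩) hfσ fun q hq => by
          rcases hc.hasLocalForm hf hA h h' hq.1 with ⟨t, h4⟩ | h4
          exacts [⟨_, _, h4, ih t⟩, ⟨_, _, h4, ih'⟩]
    refine ⟨S₂, σ ∘ σ₂, hσ.isIteratedBlowUp.trans h1 fun x hx => hx.1,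
      hσ.isIsoOff.comp h2 fun x hx => hx.1, fun q hq => ?_⟩
    by_cases h4 : IsReducedAt θ (f ∘ σ) (σ₂ q)
    · by_cases h5 : σ₂ q ∈ {q | σ q = p ∧ ¬ IsReducedAt θ (f ∘ σ) q}
      · exact h3 q h5
      · exact IsReducedAt.comp (f := f ∘ σ) (h2.isLocalDiffeomorphAt h5) h4
    · exact h3 q ⟨hq, h4⟩

/-! ### Seidenberg reduction -/

section Seidenberg

variable {U : TopologicalSpace.Opens (ℂ × ℂ)} {A B : ℂ × ℂ → ℂ}

theorem contMDiff_toPlane_id : ContMDiff 𝓘(ℂ, ℂ × ℂ) 𝓘(ℂ, ℂ × ℂ) ω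
    (toPlane (id : ofOpens U → ofOpens U)) :=
  contMDiff_subtype_val

/-- Before any blow-up, the form itself is a local generator. -/
theorem hasLocalForm_toPlane_id (hA : AnalyticOnNhd ℂ A U) (hB : AnalyticOnNhd ℂ B U)
    (hsing : ∀ z ∈ U, (A z = 0 ∧ B z = 0) ↔ z = 0) (q : ofOpens U) :
    HasLocalForm (oneForm A B) (toPlane (id : ofOpens U → ofOpens U)) q
      (fun z => A (z + (show U from q).1)) (fun z => B (z + (show U from q).1)) := by
  obtain ⟨χ, hχ, h1⟩ := exists_chart_translate
    (IsManifold.chart_mem_maximalAtlas (I := 𝓘(ℂ, ℂ × ℂ)) (n := ω) q) (mem_chart_source (ℂ × ℂ) q)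
  set c : ℂ × ℂ := (show U from q).1 with hc
  have hcU : c ∈ U := (show U from q).2
  have hsh : AnalyticAt ℂ (fun z : ℂ × ℂ => z + c) 0 := analyticAt_id.add analyticAt_const
  have hsh0 : (0 : ℂ × ℂ) + c = c := zero_add c
  have ht : Tendsto (fun z : ℂ × ℂ => z + c) (𝓝 0) (𝓝 c) :=
    (by fun_prop : Continuous fun z : ℂ × ℂ => z + c).tendsto' _ _ hsh0
  have hev : ∀ᶠ z in 𝓝 0, z + c = toPlane (id : ofOpens U → ofOpens U) (χ.symm z) := by
    filter_upwards [ht.eventually (TopologicalSpace.Opens.chartAt_subtype_val_symm_eventuallyEq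
      (H := ℂ × ℂ) U (x := (show U from q)))] with z hz
    rw [h1]
    exact hz
  refine ⟨χ, hχ, GermForm.congr (g := fun z => z + c)
    ⟨⟨AnalyticAt.fun_comp (hsh0.symm ▸ hA c hcU) hsh,
      AnalyticAt.fun_comp (hsh0.symm ▸ hB c hcU) hsh, ?_⟩, fun _ => 1, analyticAt_const,
    denseNe_of_ne analyticAt_const one_ne_zero, Eventually.of_forall fun z => ?_⟩ hev⟩
  · have hU : ∀ᶠ z in 𝓝 0, z + c ∈ U := ht.eventually (U.isOpen.mem_nhds hcU)
    by_cases hc0 : c = 0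
    · filter_upwards [hU] with z hz h2 h3
      simpa [hc0] using (hsing _ hz).1 ⟨h2, h3⟩
    · filter_upwards [hU, ht.eventually_ne hc0] with z hz h4 h2 h3
      exact absurd ((hsing _ hz).1 ⟨h2, h3⟩) h4
  · have h2 : fderiv ℂ (fun z : ℂ × ℂ => z + c) z = ContinuousLinearMap.id ℂ (ℂ × ℂ) :=
      ((hasFDerivAt_id z).add_const c).fderiv
    rw [pullback, h2, one_smul]
    rfl

/-- Every iterated blow-up over the origin can be continued to a reduced one. -/
theorem exists_isReducedAt (hA : AnalyticOnNhd ℂ A U) (hB : AnalyticOnNhd ℂ B U)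
    (hsing : ∀ z ∈ U, (A z = 0 ∧ B z = 0) ↔ z = 0) {V : ComplexSurface} {π : V → ofOpens U}
    (hπ : IsIteratedBlowUp (ofOpens U) {q | (show U from q).1 = 0} V π) :
    ∃ (V' : ComplexSurface) (σ : V' → V), IsIteratedBlowUp V {p | toPlane π p = 0} V' σ ∧
      IsSeidenbergReduction (oneForm A B) U V' (π ∘ σ) ∧
      ∀ p : V', HasOrderAt (oneForm A B) (toPlane (π ∘ σ)) p 1 →
        HasFinalForm (oneForm A B) (toPlane (π ∘ σ)) p := by
  have h0 := hasLocalForm_toPlane_id hA hB hsing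
  have h1 : ∀ q : ofOpens U, ¬ IsRegularAt (oneForm A B) (toPlane id) q →
      q ∈ {q : ofOpens U | (show U from q).1 = 0} := by
    intro q hq
    by_contra hq0
    refine hq ⟨_, _, h0 q, ?_⟩
    have h2 := mt (hsing _ (show U from q).2).1 hq0
    simp only [zero_add]
    tauto
  obtain ⟨h2, h3, h4⟩ := hπ.exists_hasLocalForm (θ := oneForm A B) contMDiff_toPlane_id
    (fun q => ⟨_, _, h0 q⟩) (Set.Subsingleton.finite fun q hq q' hq' =>
      Subtype.ext ((h1 q hq).trans (h1 q' hq').symm)) h1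
  have hf : ContMDiff 𝓘(ℂ, ℂ × ℂ) 𝓘(ℂ, ℂ × ℂ) ω (toPlane π) :=
    contMDiff_toPlane_id.comp hπ.contMDiff
  obtain ⟨V', σ, h5, h6, h7⟩ := exists_reduction_of_finite (θ := oneForm A B) (f := toPlane π)
    (T := {q | ¬ IsReducedAt (oneForm A B) (toPlane π) q})
    (h3.subset fun q hq h8 => hq h8.isReducedAt) hf fun q _ => by
      obtain ⟨A', B', h8⟩ := h2 q
      exact ⟨A', B', h8, h8.isolatedForm.resolvable.isReducible⟩
  have hT : ∀ q ∈ {q | ¬ IsReducedAt (oneForm A B) (toPlane π) q}, toPlane π q = 0 :=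
    fun q hq => h4 q fun h8 => hq h8.isReducedAt
  have h8 : ∀ q, IsReducedAt (oneForm A B) (toPlane (π ∘ σ)) q := by
    intro q
    by_cases h9 : σ q ∈ {q | ¬ IsReducedAt (oneForm A B) (toPlane π) q}
    · exact h7 q h9
    · exact IsReducedAt.comp (f := toPlane π) (h6.isLocalDiffeomorphAt h9) (not_not.1 h9)
  exact ⟨V', σ, h5.mono hT, ⟨hπ.trans h5 hT, fun p => (h8 p).exists_hasOrderAt⟩,
    fun p => (h8 p).hasFinalForm (hf.comp h5.contMDiff)⟩

end Seidenberg

end PlaneFoliation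

theorem theoremt11 (U : TopologicalSpace.Opens (ℂ × ℂ)) (h0 : (0 : ℂ × ℂ) ∈ U)
    (A B : ℂ × ℂ → ℂ) (hA : AnalyticOnNhd ℂ A U) (hB : AnalyticOnNhd ℂ B U)
    (hsing : ∀ z ∈ U, (A z = 0 ∧ B z = 0) ↔ z = 0) :
    (∃ (V : ComplexSurface) (π : V → ComplexSurface.ofOpens U),
      PlaneFoliation.IsSeidenbergReduction (PlaneFoliation.oneForm A B) U V π) ∧
    ∀ (V : ComplexSurface) (π : V → ComplexSurface.ofOpens U),
      PlaneFoliation.IsSeidenbergReduction (PlaneFoliation.oneForm A B) U V π →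
      ∃ (V' : ComplexSurface) (σ : V' → V),
        ComplexSurface.IsIteratedBlowUp V {p | PlaneFoliation.toPlane π p = 0} V' σ ∧
        PlaneFoliation.IsSeidenbergReduction (PlaneFoliation.oneForm A B) U V' (π ∘ σ) ∧
        ∀ p : V',
          PlaneFoliation.HasOrderAt (PlaneFoliation.oneForm A B)
            (PlaneFoliation.toPlane (π ∘ σ)) p 1 →
          PlaneFoliation.HasFinalForm (PlaneFoliation.oneForm A B)
            (PlaneFoliation.toPlane (π ∘ σ)) p := by
  refine ⟨?_, fun V π hπ => PlaneFoliation.exists_isReducedAt hA hB hsing hπ.1⟩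
  obtain ⟨V, σ, -, h, -⟩ := PlaneFoliation.exists_isReducedAt hA hB hsing
    (ComplexSurface.IsIteratedBlowUp.refl (S := ComplexSurface.ofOpens U))
  exact ⟨V, _, h⟩
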